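/- **Setting.** Let $\gamma>0$. Configurations of the infinite chain are $\omega=(r_x,p_x)_{x\in\mathbb Z}\in(\mathbb R\times\mathbb R)^{\mathbb Z}$. Throughout, $V:\mathbb R\to\mathbb R$ is $C^\infty$, even and nonnegative, with $V(r)>0$ for $r\neq0$. For $T>0$ let $\mu_T$ be the product measure on $(\mathbb R\times\mathbb R)^{\mathbb Z}$ under which all $r_x,p_x$ are independent, $r_x$ has density $Z(T)^{-1}e^{-V(r)/T}$ and $p_x$ is centred Gaussian with variance $T$. With $(\theta_x\omega)_z=\omega_{x+z}$ and $\theta_xg=g\circ\theta_x$, let $\mathcal H_T$ be the Hilbert space completion of the square integrable local functions (functions of finitely many coordinates) for the semi-inner product $$\ll f,g\gg=\sum_{x\in\mathbb Z}\{\mu_T(f\,\theta_xg)-\mu_T(f)\mu_T(g)\}.$$ Let $\mathfrak L'=\mathfrak A+\gamma(\mathfrak S+\mathfrak S')$ with $$\mathfrak A=\sum_x\big[(p_x-p_{x-1})\partial_{r_x}+(V'(r_{x+1})-V'(r_x))\partial_{p_x}\big],\qquad (\mathfrak Sf)(\omega)=\sum_x[f(\omega^x)-f(\omega)],\qquad \mathfrak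 S'=\tfrac12\sum_x(p_{x+1}\partial_{p_x}-p_x\partial_{p_{x+1}})^2,$$ where $\omega^x$ is $\omega$ with $p_x$ replaced by $-p_x$. Assume that for every $T>0$ the closure of $\mathfrak L'$, defined on the linear span of the compactly supported $C^2$ functions of finitely many coordinates, generates a strongly continuous contraction semigroup on $\mathcal H_T$. Let $j_{0,1}=-p_0V'(r_1)$ and $$\kappa'(T)=\gamma+T^{-2}\lim_{\lambda\downarrow0}\ll j_{0,1},(\lambda-\mathfrak L')^{-1}j_{0,1}\gg .$$ For $A>0$, $\alpha>1$ put $$C(\alpha,A)=A^2\alpha^2\,\frac{\int_0^\infty s^{2\alpha-2}e^{-As^\alpha}ds}{\int_0^\infty e^{-As^\alpha}ds}.$$ Below, $f\sim g$ means $f/g\to1$. **Statement.** In each of the following cases $j_{0,1}\in\mathcal H_T$ and the limit defining $\kappa'(T)$ exists for every $T>0$, and: 1. *(High temperature, $1<\alpha<2$.)* If $V(r)=Ar^\alpha+W(r)$ for $r\ge1$, where $A>0$ and $W$ is $C^\infty$ with $W,W'$ bounded on $[1,\infty)$, then, with $C_\infty=C(\alpha,A)$, $$\kappa'(T)\sim\gamma+\frac{C_\infty}{6\gamma}T^{1-2/\alpha},\qquad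 T\to\infty .$$ If moreover $\int_1^RW''(r)^2dr=o(R^{\alpha-1})$ as $R\to\infty$, then also $$\kappa'(T)-\gamma\sim\frac{C_\infty}{6\gamma}T^{1-2/\alpha},\qquad T\to\infty .$$ 2. *(High temperature, $\alpha>2$.)* For all $\alpha>2$, $A>0$ there is $C>0$, depending only on $\alpha$, $A$ and the fixed parameter $\gamma$, such that for every $V$ with $V(r)=Ar^\alpha+W(r)$ for $r\ge1$, $W$ as in 1, one has for all sufficiently large $T$ $$C^{-1}\le\kappa'(T)\le C\,T^{1-2/\alpha}.$$ 3. *(Low temperature.)* If $V(r)\sim Ar^\delta$ as $r\downarrow0$ with $A>0$, $\delta>2$, and $V(r)=Br^\alpha+W(r)$ for $r\ge1$ with $B>0$, $\alpha>0$ and $W$ as in 1, then, with $C_0=C(\delta,A)$, $$\kappa'(T)\sim\gamma+\frac{C_0}{6\gamma}T^{1-2/\delta},\qquad T\downarrow0 .$$ If moreover $\int_{\mathbb R}V''(r)^2e^{-V(r)/T_0}dr<\infty$ for some $T_0>0$, then also $$\kappa'(T)-\gamma\sim\frac{C_0}{6\gamma}T^{1-2/\delta},\qquad T\downarrow0 .$$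 -/

import Mathlib

open MeasureTheory ProbabilityTheory Filter Topology Asymptotics

noncomputable section

/-! ### Configurations of the infinite chain -/

/-- A configuration `ω = (r, p)` of the infinite chain: `ω x = (r_x, p_x)`, where `r_x` is the
interparticle distance `q_x - q_{x-1}` and `p_x` is the momentum of particle `x`. -/
abbrev Config : Type := ℤ → ℝ × ℝ

namespace Chain

/-- The shift `(θ_x ω)_z = ω_{x+z}`. -/
def shift (x : ℤ) (ω : Config) : Config := fun z => ω (x + z)

/-- The configuration `ω^x`, in which the momentum of particle `x` is flipped. -/
def flip (x : ℤ) (ω : Config) : Config := Function.update ω x ((ω x).1, -(ω x).2)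

/-- The one-site Gibbs measure at temperature `T` and zero pressure: `r` has the density
`exp (-V(r)/T) / Z(T)` and `p` is an independent centred Gaussian variable of variance `T`. -/
def siteMeasure (V : ℝ → ℝ) (T : ℝ) : Measure (ℝ × ℝ) :=
  (volume.tilted fun r => -V r / T).prod (gaussianReal 0 T.toNNReal)

/-- The infinite product of a one-site measure over the sites of `ℤ`. -/
def productMeasure (ν : Measure (ℝ × ℝ)) : Measure Config := Measure.infinitePi fun _ : ℤ => ν

/-! ### The Hilbert space of local functions modulo spatial gradients -/

/-- Square integrable local functions: measurable functions of finitely many coordinates which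
are square integrable with respect to the product measure. -/
def localSubmodule (ν : Measure (ℝ × ℝ)) : Submodule ℝ (Config → ℝ) where
  carrier := {f | Measurable f ∧ MemLp f 2 (productMeasure ν) ∧
    ∃ s : Finset ℤ, DependsOn f (s : Set ℤ)}
  add_mem' := by
    rintro f g ⟨hf, hf2, s, hs⟩ ⟨hg, hg2, t, ht⟩
    classical
    refine ⟨hf.add hg, hf2.add hg2, s ∪ t, fun ω η h => ?_⟩
    simp only [Pi.add_apply]
    rw [hs fun i hi => h i (by simp_all), ht fun i hi => h i (by simp_all)]
  zero_mem' := ⟨measurable_const, MemLp.zero, ∅, fun _ _ _ => rfl⟩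
  smul_mem' := by
    rintro c f ⟨hf, hf2, s, hs⟩
    refine ⟨hf.const_smul c, hf2.const_smul c, s, fun ω η h => ?_⟩
    simp only [Pi.smul_apply]
    rw [hs h]

/-- The space of square integrable local functions, as a type of its own (it will carry the
semi-inner product below). -/
def LocalFun (ν : Measure (ℝ × ℝ)) : Type := localSubmodule ν

instance (ν : Measure (ℝ × ℝ)) : AddCommGroup (LocalFun ν) :=
  inferInstanceAs (AddCommGroup (localSubmodule ν))

instance (ν : Measure (ℝ × ℝ)) : Module ℝ (LocalFun ν) :=
  inferInstanceAs (Module ℝ (localSubmodule ν))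

/-- The function on configurations underlying an element of `LocalFun ν`. -/
def LocalFun.fn {ν : Measure (ℝ × ℝ)} (f : LocalFun ν) : Config → ℝ := f.1

theorem LocalFun.measurable {ν : Measure (ℝ × ℝ)} (f : LocalFun ν) : Measurable f.fn := f.2.1

theorem LocalFun.memLp {ν : Measure (ℝ × ℝ)} (f : LocalFun ν) :
    MemLp f.fn 2 (productMeasure ν) := f.2.2.1

theorem LocalFun.exists_dependsOn {ν : Measure (ℝ × ℝ)} (f : LocalFun ν) :
    ∃ s : Finset ℤ, DependsOn f.fn (s : Set ℤ) := f.2.2.2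

/-- The semi-inner product `≪f, g≫ = ∑_x { μ(f θ_x g) - μ(f) μ(g) }`, where
`(θ_x g)(ω) = g(θ_x ω)`. For local functions the sum has finitely many nonzero terms. -/
def semiInner {ν : Measure (ℝ × ℝ)} (f g : LocalFun ν) : ℝ :=
  ∑' x : ℤ, ((∫ ω, f.fn ω * g.fn (shift x ω) ∂productMeasure ν) -
    (∫ ω, f.fn ω ∂productMeasure ν) * ∫ ω, g.fn ω ∂productMeasure ν)

section SemiInner

variable {ν : Measure (ℝ × ℝ)}

theorem productMeasure_eq_zero (h : ¬ IsProbabilityMeasure ν) : productMeasure ν = 0 := by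
  rw [productMeasure, Measure.infinitePi, dif_neg]
  exact fun h' => h (h' 0)

theorem measurePreserving_shift [IsProbabilityMeasure ν] (x : ℤ) :
    MeasurePreserving (shift x) (productMeasure ν) (productMeasure ν) := by
  refine ⟨?_, ?_⟩
  · exact measurable_pi_lambda _ fun z => measurable_pi_apply _
  · exact Measure.map_infinitePi_infinitePi_of_inj (P := fun _ : ℤ => ν) (f := fun z : ℤ => x + z)
      (add_right_injective x)

instance [IsProbabilityMeasure ν] : IsProbabilityMeasure (productMeasure ν) := by
  unfold productMeasure; infer_instance

/-- The covariance of `f` and `θ_x g`. -/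
def corr (f g : LocalFun ν) (x : ℤ) : ℝ :=
  cov[f.fn, fun ω => g.fn (shift x ω); productMeasure ν]

theorem memLp_shift [IsProbabilityMeasure ν] (f : LocalFun ν) (x : ℤ) :
    MemLp (fun ω => f.fn (shift x ω)) 2 (productMeasure ν) :=
  f.memLp.comp_measurePreserving (measurePreserving_shift x)

theorem corr_eq [IsProbabilityMeasure ν] (f g : LocalFun ν) (x : ℤ) :
    corr f g x = (∫ ω, f.fn ω * g.fn (shift x ω) ∂productMeasure ν) -
      (∫ ω, f.fn ω ∂productMeasure ν) * ∫ ω, g.fn ω ∂productMeasure ν := by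
  rw [corr, covariance_eq_sub f.memLp (memLp_shift g x)]
  congr 2
  have h := (measurePreserving_shift (ν := ν) x).map_eq
  conv_rhs => rw [← h]
  rw [integral_map (measurePreserving_shift (ν := ν) x).measurable.aemeasurable
    g.measurable.aestronglyMeasurable]

theorem semiInner_eq [IsProbabilityMeasure ν] (f g : LocalFun ν) :
    semiInner f g = ∑' x, corr f g x := tsum_congr fun x => (corr_eq f g x).symm

theorem shift_shift (x y : ℤ) (ω : Config) : shift x (shift y ω) = shift (x + y) ω := by
  funext z; simp only [shift]; congr 1; ring

theorem cov_shift [IsProbabilityMeasure ν] (f g : LocalFun ν) (i j : ℤ) :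
    cov[fun ω => f.fn (shift i ω), fun ω => g.fn (shift j ω); productMeasure ν] =
      corr f g (j - i) := by
  have h := (measurePreserving_shift (ν := ν) i).map_eq
  rw [corr]
  conv_rhs => rw [← h]
  rw [covariance_map_fun]
  · simp only [shift_shift, sub_add_cancel]
  · rw [h]; exact f.measurable.aestronglyMeasurable
  · rw [h]; exact (memLp_shift g _).1
  · exact (measurePreserving_shift (ν := ν) i).measurable.aemeasurable

theorem corr_symm [IsProbabilityMeasure ν] (f g : LocalFun ν) (x : ℤ) :
    corr f g x = corr g f (-x) := by
  have := cov_shift (ν := ν) f g (-x) 0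
  rw [covariance_comm, cov_shift g f 0 (-x)] at this
  simpa using this.symm

theorem indepFun_of_dependsOn [IsProbabilityMeasure ν] {f g : Config → ℝ}
    (hf : Measurable f) (hg : Measurable g) {s t : Finset ℤ} (hs : DependsOn f (s : Set ℤ))
    (ht : DependsOn g (t : Set ℤ)) (hst : Disjoint s t) :
    IndepFun f g (productMeasure ν) := by
  classical
  have key : ∀ (h : Config → ℝ) (u : Finset ℤ), Measurable h → DependsOn h (u : Set ℤ) →
      ∃ H : (u → ℝ × ℝ) → ℝ, Measurable H ∧ h = H ∘ fun ω (i : u) => ω i := by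
    intro h u hh hu
    refine ⟨fun v => h fun i => if hi : i ∈ u then v ⟨i, hi⟩ else 0, ?_, ?_⟩
    · refine hh.comp (measurable_pi_lambda _ fun i => ?_)
      by_cases hi : i ∈ u
      · simp only [hi, dite_true]; exact measurable_pi_apply _
      · simp only [hi, dite_false]; exact measurable_const
    · funext ω
      refine hu fun i hi => ?_
      have hi' : i ∈ u := hi
      simp [hi']
  obtain ⟨F, hF, rfl⟩ := key f s hf hs
  obtain ⟨G, hG, rfl⟩ := key g t hg ht
  have hind : iIndepFun (fun (i : ℤ) (ω : Config) => ω i) (productMeasure ν) :=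
    iIndepFun_infinitePi (P := fun _ : ℤ => ν) (X := fun _ x => x) fun _ => measurable_id
  exact (hind.indepFun_finset s t hst fun i => measurable_pi_apply i).comp hF hG

theorem exists_corr_eq_zero [IsProbabilityMeasure ν] (f g : LocalFun ν) :
    ∃ M : ℕ, ∀ x : ℤ, (M : ℤ) < |x| → corr f g x = 0 := by
  classical
  obtain ⟨s, hs⟩ := f.exists_dependsOn
  obtain ⟨t, ht⟩ := g.exists_dependsOn
  refine ⟨∑ i ∈ s, i.natAbs + ∑ i ∈ t, i.natAbs, fun x hx => ?_⟩
  refine IndepFun.covariance_eq_zero ?_ f.memLp (memLp_shift g x)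
  refine indepFun_of_dependsOn (t := t.image fun z => x + z) f.measurable
    (g.measurable.comp (measurePreserving_shift (ν := ν) x).measurable) hs ?_ ?_
  · intro ω η h
    refine ht fun i hi => h (x + i) ?_
    simp only [Finset.coe_image, Set.mem_image]
    exact ⟨i, hi, rfl⟩
  · rw [Finset.disjoint_left]
    rintro i hi hi'
    obtain ⟨k, hk, rfl⟩ := Finset.mem_image.1 hi'
    have h1 := Finset.single_le_sum (f := fun i : ℤ => i.natAbs) (fun _ _ => Nat.zero_le _) hi
    have h2 := Finset.single_le_sum (f := fun i : ℤ => i.natAbs) (fun _ _ => Nat.zero_le _) hk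
    have h3 : ((x + k).natAbs : ℤ) = |x + k| := Int.natCast_natAbs _
    have h4 : (k.natAbs : ℤ) = |k| := Int.natCast_natAbs _
    have h5 : |x| ≤ |x + k| + |k| := by
      have := abs_sub (x + k) k
      simpa using this
    have h6 : ((x + k).natAbs : ℤ) + (k.natAbs : ℤ) ≤
      ((∑ i ∈ s, i.natAbs + ∑ i ∈ t, i.natAbs : ℕ) : ℤ) := by exact_mod_cast add_le_add h1 h2
    omega

theorem summable_corr [IsProbabilityMeasure ν] (f g : LocalFun ν) : Summable (corr f g) := by
  obtain ⟨M, hM⟩ := exists_corr_eq_zero f g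
  refine summable_of_ne_finset_zero (s := Finset.Icc (-(M : ℤ)) M) fun x hx => hM x ?_
  simp only [Finset.mem_Icc, ← abs_le, not_le] at hx
  exact hx

theorem semiInner_comm (f g : LocalFun ν) : semiInner f g = semiInner g f := by
  by_cases hν : IsProbabilityMeasure ν
  · rw [semiInner_eq, semiInner_eq, ← (Equiv.neg ℤ).tsum_eq]
    exact tsum_congr fun x => by rw [corr_symm]; simp
  · simp [semiInner, productMeasure_eq_zero hν]

theorem semiInner_add_left (f g h : LocalFun ν) :
    semiInner (f + g) h = semiInner f h + semiInner g h := by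
  by_cases hν : IsProbabilityMeasure ν
  · rw [semiInner_eq, semiInner_eq, semiInner_eq,
      ← (summable_corr f h).tsum_add (summable_corr g h)]
    exact tsum_congr fun x => covariance_add_left f.memLp g.memLp (memLp_shift h x)
  · simp [semiInner, productMeasure_eq_zero hν]

theorem semiInner_smul_left (c : ℝ) (f g : LocalFun ν) :
    semiInner (c • f) g = c * semiInner f g := by
  by_cases hν : IsProbabilityMeasure ν
  · rw [semiInner_eq, semiInner_eq, ← tsum_mul_left]
    exact tsum_congr fun x => covariance_smul_left c
  · simp [semiInner, productMeasure_eq_zero hν]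

theorem semiInner_self_nonneg (f : LocalFun ν) : 0 ≤ semiInner f f := by
  by_cases hν : IsProbabilityMeasure ν
  swap
  · simp [semiInner, productMeasure_eq_zero hν]
  rw [semiInner_eq]
  obtain ⟨M, hM⟩ := exists_corr_eq_zero f f
  set c := corr f f with hc
  have hsum := summable_corr f f
  set B := ∑' x, |c x| with hB
  have hfin : ∀ (j : ℤ) (t : Finset ℤ), ∑ i ∈ t, |c (j - i)| ≤ B := fun j t => by
    have h := ((Equiv.subLeft j).summable_iff.2 hsum.abs).sum_le_tsum t fun _ _ => abs_nonneg _
    have h' := (Equiv.subLeft j).tsum_eq fun x => |c x|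
    exact h.trans_eq h'
  have hedge : ∀ (s t : Finset ℤ), -(s.card * B) ≤ ∑ i ∈ t, ∑ j ∈ s, c (j - i) := fun s t => by
    rw [Finset.sum_comm]
    have h : ∀ j ∈ s, -B ≤ ∑ i ∈ t, c (j - i) := fun j _ => by
      have h1 := Finset.abs_sum_le_sum_abs (fun i => c (j - i)) t
      have h2 := neg_abs_le (∑ i ∈ t, c (j - i))
      linarith [hfin j t]
    have := Finset.card_nsmul_le_sum s _ _ h
    rw [nsmul_eq_mul] at this
    linarith
  have hmain : ∀ n : ℕ, -(2 * M * B) ≤ n * ∑' x, c x := by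
    intro n
    have h1 : ∀ i ∈ Finset.Ico (0 : ℤ) n,
        ∑ j ∈ Finset.Ico (-(M : ℤ)) (n + M), c (j - i) = ∑' x, c x := by
      intro i hi
      rw [Finset.mem_Ico] at hi
      rw [← (Equiv.subRight i).tsum_eq c, tsum_eq_sum]
      · rfl
      · intro j hj
        refine hM _ ?_
        simp only [Finset.mem_Ico, not_and_or, not_le, not_lt] at hj
        simp only [Equiv.subRight_apply]
        rcases hj with hj | hj
        · rw [abs_of_nonpos (by omega)]; omega
        · rcases le_or_gt (j - i) 0 with h0 | h0
          · omega
          · rw [abs_of_pos h0]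
            by_contra hcon
            omega
    have h2 : (n : ℝ) * ∑' x, c x =
        ∑ i ∈ Finset.Ico (0 : ℤ) n, ∑ j ∈ Finset.Ico (-(M : ℤ)) (n + M), c (j - i) := by
      rw [Finset.sum_congr rfl h1]; simp
    have h3 : ∀ i : ℤ, ∑ j ∈ Finset.Ico (-(M : ℤ)) (n + M), c (j - i) =
        (∑ j ∈ Finset.Ico (-(M : ℤ)) 0, c (j - i)) + (∑ j ∈ Finset.Ico (0 : ℤ) n, c (j - i)) +
          ∑ j ∈ Finset.Ico (n : ℤ) (n + M), c (j - i) := fun i => by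
      rw [← Finset.sum_union (Finset.Ico_disjoint_Ico_consecutive _ _ _),
        Finset.Ico_union_Ico_eq_Ico (by omega) (by omega),
        ← Finset.sum_union (Finset.Ico_disjoint_Ico_consecutive _ _ _),
        Finset.Ico_union_Ico_eq_Ico (by omega) (by omega)]
    have h4 : 0 ≤ ∑ i ∈ Finset.Ico (0 : ℤ) n, ∑ j ∈ Finset.Ico (0 : ℤ) n, c (j - i) := by
      have h5 : ∀ i j : ℤ, c (j - i) =
          cov[fun ω => f.fn (shift i ω), fun ω => f.fn (shift j ω); productMeasure ν] :=
        fun i j => (cov_shift f f i j).symm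
      simp_rw [h5]
      rw [← covariance_fun_sum_fun_sum' (fun i _ => memLp_shift f i) fun i _ => memLp_shift f i]
      rw [covariance_self]
      · exact variance_nonneg _ _
      · exact (Finset.measurable_fun_sum _ fun i _ =>
          f.measurable.comp (measurePreserving_shift (ν := ν) i).measurable).aemeasurable
    have h6 := hedge (Finset.Ico (-(M : ℤ)) 0) (Finset.Ico (0 : ℤ) n)
    have h7 := hedge (Finset.Ico (n : ℤ) (n + M)) (Finset.Ico (0 : ℤ) n)
    simp only [Int.card_Ico, zero_sub, neg_neg, Int.toNat_natCast, add_sub_cancel_left] at h6 h7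
    rw [h2, Finset.sum_congr rfl fun i _ => h3 i, Finset.sum_add_distrib, Finset.sum_add_distrib]
    linarith
  by_contra hneg
  push Not at hneg
  obtain ⟨n, hn⟩ := exists_nat_gt (2 * M * B / -(∑' x, c x))
  rw [div_lt_iff₀ (by linarith)] at hn
  have := hmain n
  linarith

end SemiInner

/-- The semi-inner product structure `≪·, ·≫` on local functions. -/
instance instCore (ν : Measure (ℝ × ℝ)) : PreInnerProductSpace.Core ℝ (LocalFun ν) where
  inner f g := semiInner f g
  conj_inner_symm f g := semiInner_comm g f
  re_inner_nonneg f := semiInner_self_nonneg f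
  add_left f g h := semiInner_add_left f g h
  smul_left f g c := semiInner_smul_left c f g

instance (ν : Measure (ℝ × ℝ)) : SeminormedAddCommGroup (LocalFun ν) :=
  InnerProductSpace.Core.toSeminormedAddCommGroup (𝕜 := ℝ)

instance (ν : Measure (ℝ × ℝ)) : InnerProductSpace ℝ (LocalFun ν) :=
  InnerProductSpace.ofCore (instCore ν)

/-- The Hilbert space `𝓗`: the completion of the local functions with respect to `≪·, ·≫`
(functions of zero semi-norm, in particular the gradients `θ_1 f - f`, become `0`). -/
abbrev HilbertH (ν : Measure (ℝ × ℝ)) : Type := UniformSpace.Completion (LocalFun ν)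

/-! ### The generator -/

/-- The partial derivative `∂_{r_x} f`. -/
def partialR (x : ℤ) (f : Config → ℝ) (ω : Config) : ℝ :=
  deriv (fun t : ℝ => f (Function.update ω x (t, (ω x).2))) (ω x).1

/-- The partial derivative `∂_{p_x} f`. -/
def partialP (x : ℤ) (f : Config → ℝ) (ω : Config) : ℝ :=
  deriv (fun t : ℝ => f (Function.update ω x ((ω x).1, t))) (ω x).2

/-- The Liouville operator
`𝔄 f = ∑_x [(p_x - p_{x-1}) ∂_{r_x} f + (V'(r_{x+1}) - V'(r_x)) ∂_{p_x} f]`;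
for a local function `f` the sum has finitely many nonzero terms. -/
def liouville (V : ℝ → ℝ) (f : Config → ℝ) (ω : Config) : ℝ :=
  ∑ᶠ x : ℤ, (((ω x).2 - (ω (x - 1)).2) * partialR x f ω +
    (deriv V (ω (x + 1)).1 - deriv V (ω x).1) * partialP x f ω)

/-- The velocity-flip noise `𝔖 f = ∑_x [f(ω^x) - f(ω)]`. -/
def flipNoise (f : Config → ℝ) (ω : Config) : ℝ := ∑ᶠ x : ℤ, (f (flip x ω) - f ω)

/-- The rotation field `p_{x+1} ∂_{p_x} - p_x ∂_{p_{x+1}}`. -/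
def rotation (x : ℤ) (f : Config → ℝ) (ω : Config) : ℝ :=
  (ω (x + 1)).2 * partialP x f ω - (ω x).2 * partialP (x + 1) f ω

/-- The energy-conserving exchange noise
`𝔖' = (1/2) ∑_x (p_{x+1} ∂_{p_x} - p_x ∂_{p_{x+1}})²`. -/
def exchangeNoise (f : Config → ℝ) (ω : Config) : ℝ :=
  (1 / 2 : ℝ) * ∑ᶠ x : ℤ, rotation x (rotation x f) ω

/-- The formal generator `𝔏' = 𝔄 + γ (𝔖 + 𝔖')`. -/
def generator (V : ℝ → ℝ) (γ : ℝ) (f : Config → ℝ) (ω : Config) : ℝ :=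
  liouville V f ω + γ * (flipNoise f ω + exchangeNoise f ω)

/-- The test functions: the linear space spanned by the functions that are twice continuously
differentiable and compactly supported as functions of finitely many coordinates. -/
def testFunctions : Submodule ℝ (Config → ℝ) :=
  Submodule.span ℝ {f | ∃ (s : Finset ℤ) (F : (s → ℝ × ℝ) → ℝ),
    ContDiff ℝ 2 F ∧ HasCompactSupport F ∧ f = fun ω => F fun i => ω i}

/-- The graph, in `𝓗 × 𝓗`, of `𝔏'` acting on test functions at temperature `T`. -/
def coreGraph (V : ℝ → ℝ) (γ T : ℝ) :
    Set (HilbertH (siteMeasure V T) × HilbertH (siteMeasure V T)) :=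
  {z | ∃ f g : LocalFun (siteMeasure V T), f.fn ∈ testFunctions ∧
    g.fn = generator V γ f.fn ∧ z = ((f : HilbertH (siteMeasure V T)), (g : HilbertH _))}

/-- Strongly continuous contraction semigroups `(P t)_{t ≥ 0}` on a normed space (the values at
negative times play no role). -/
structure IsContractionSemigroup {E : Type*} [NormedAddCommGroup E] [NormedSpace ℝ E]
    (P : ℝ → E →L[ℝ] E) : Prop where
  zero : P 0 = ContinuousLinearMap.id ℝ E
  add : ∀ s t : ℝ, 0 ≤ s → 0 ≤ t → P (s + t) = (P s).comp (P t)
  norm_le : ∀ t : ℝ, 0 ≤ t → ‖P t‖ ≤ 1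
  continuous : ∀ f : E, Tendsto (fun t => P t f) (𝓝[>] 0) (𝓝 f)

/-- The graph of the infinitesimal generator of a semigroup: the pairs `(f, g)` such that
`(P t f - f) / t → g` as `t ↓ 0`. -/
def infinitesimalGraph {E : Type*} [NormedAddCommGroup E] [NormedSpace ℝ E]
    (P : ℝ → E →L[ℝ] E) : Set (E × E) :=
  {z | Tendsto (fun t : ℝ => t⁻¹ • (P t z.1 - z.1)) (𝓝[>] 0) (𝓝 z.2)}

/-- At temperature `T`, the closure of `𝔏'` on test functions is the generator of a strongly
continuous contraction semigroup on `𝓗`; in other words `𝔏'` generates the dynamics and the test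
functions form a core. -/
def GeneratesDynamics (V : ℝ → ℝ) (γ T : ℝ) : Prop :=
  ∃ P : ℝ → HilbertH (siteMeasure V T) →L[ℝ] HilbertH (siteMeasure V T),
    IsContractionSemigroup P ∧ infinitesimalGraph P = closure (coreGraph V γ T)

/-- The energy current `j_{0,1} = -p_0 V'(r_1)`. -/
def current (V : ℝ → ℝ) (ω : Config) : ℝ := -((ω 0).2 * deriv V (ω 1).1)

/-- `κ` is the conductivity of the dynamics generated by `𝔏'` at temperature `T`: the current
`j = j_{0,1}` belongs to `𝓗`, the resolvent equation `(l - 𝔏') u_l = j` has a solution for all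
`l > 0`, where `𝔏'` denotes the closure of its restriction to test functions, and
`γ + T⁻² ≪j, u_l≫ → κ` as `l ↓ 0`. -/
def IsConductivity (V : ℝ → ℝ) (γ T κ : ℝ) : Prop :=
  ∃ j : LocalFun (siteMeasure V T), j.fn = current V ∧
    ∃ u : ℝ → HilbertH (siteMeasure V T),
      (∀ l : ℝ, 0 < l → (u l, l • u l - (j : HilbertH (siteMeasure V T))) ∈
        closure (coreGraph V γ T)) ∧
      Tendsto (fun l : ℝ => γ + (T ^ 2)⁻¹ * inner ℝ (j : HilbertH (siteMeasure V T)) (u l))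
        (𝓝[>] 0) (𝓝 κ)

/-! ### The potentials -/

/-- Smooth nonnegative even potentials, positive away from the origin. -/
structure IsChainPotential (V : ℝ → ℝ) : Prop where
  smooth : ContDiff ℝ ((⊤ : ℕ∞) : WithTop ℕ∞) V
  nonneg : ∀ r, 0 ≤ V r
  pos : ∀ r, r ≠ 0 → 0 < V r
  even : ∀ r, V (-r) = V r

/-- `V(r) = A r^α + W(r)` for `r ≥ 1`, where `W` is smooth and `W`, `W'` are bounded. -/
structure HasPowerTail (V W : ℝ → ℝ) (A α : ℝ) : Prop where
  smooth : ContDiff ℝ ((⊤ : ℕ∞) : WithTop ℕ∞) W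
  bounded : ∃ M : ℝ, ∀ r, 1 ≤ r → |W r| ≤ M ∧ |deriv W r| ≤ M
  eq : ∀ r, 1 ≤ r → V r = A * r ^ α + W r

/-- The constant
`A² α² (∫_0^∞ s^{2α-2} exp(-A s^α) ds) / (∫_0^∞ exp(-A s^α) ds)`. -/
def tailConst (A α : ℝ) : ℝ :=
  A ^ 2 * α ^ 2 * (∫ s in Set.Ioi (0 : ℝ), s ^ (2 * α - 2) * Real.exp (-(A * s ^ α))) /
    ∫ s in Set.Ioi (0 : ℝ), Real.exp (-(A * s ^ α))

end Chain

end

/-! Write `j = j_s + e / 2`, where `j_s = -(p_0 + p_1) V'(r_1) / 2` and `e = (p_1 - p_0) V'(r_1) = 𝔄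
V(r_1)`. The noise annihilates `V(r_1)`, so `e` is a total time derivative, and its contribution to
`≪j, u_l≫` vanishes as `l ↓ 0`, where `u_l = (l - 𝔏')⁻¹ j`. Modulo spatial gradients `j_s` equals
`-p_0 (V'(r_0) + V'(r_1)) / 2`, which is linear in a single momentum and hence an eigenvector of `𝔖
+ 𝔖'` with eigenvalue `-2 - 1 = -3`. Its pairing with `j` and its squared norm are both `J = T ⟨V'²⟩
/ 2`, with `⟨·⟩` the mean under the law of one distance.

Upper bound (`sector_bound`): Cauchy-Schwarz for the Dirichlet form of the noise gives `3γ ≪f, j_s≫²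
≤ J ≪-𝔏' f, f≫`, so the limit `k` of `≪j, u_l≫` is at most `J / (3γ)`.

Distance from the upper bound (`stiffness_bound`): pairing the resolvent equation with `j_s` leaves
`≪𝔄 u_l, j_s≫` as the only error. Up to a gradient, `𝔄 j_s` is a rotation field applied to `p_0 p_1
V''(r_1)`, so the exchange part of the Dirichlet form controls this error, and `(3γk - J)² ≤ T²
⟨V''²⟩ / (2γ) · k`.

Existence of the limit (`exists_conductivity_limit`): if `R` reverses all momenta, then `𝔏'` is
symmetric for the form `≪·, R ·≫` and `R j = -j`. Therefore `φ(l) = ≪j, u_l≫` has derivative `≪u_l,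
R u_l≫ ≥ -‖u_l - R u_l‖² / 4`. The flip noise has a spectral gap on odd functions
(`inner_sub_reverse_le`), which bounds this below near `0`; adding a linear function makes `φ`
monotone.

What remains is one-dimensional. With `r = T^{1/α} s`, dominated convergence
(`tendsto_gibbsInt_div`) gives `⟨V'²⟩ ~ C T^{2-2/α}`. The upper bound alone yields the first
equivalences, whose two sides tend to `γ`, and the case `α > 2`. For the equivalences of `κ' - γ`,
the squared relative error is at most `T ⟨V''²⟩ / (3γ² ⟨V'²⟩)`, which vanishes once `⟨V''²⟩ =
o(T^{1-2/α})`. At high temperature this comes from the growth of `∫ W''²` by integrating over layers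
(`lintegral_mul_exp_neg_le`). At low temperature smoothness forces `δ` to be the order of vanishing
of `V` at `0`, so that the equivalence can be differentiated (`tendsto_derivs_of_isEquivalent`). -/

noncomputable section

namespace Chain

/-! ### Resolvents of contraction semigroups -/

section Semigroup

variable {E : Type*} [NormedAddCommGroup E] [NormedSpace ℝ E]

theorem IsContractionSemigroup.norm_apply_le {P : ℝ → E →L[ℝ] E} (hP : IsContractionSemigroup P)
    {t : ℝ} (ht : 0 ≤ t) (f : E) : ‖P t f‖ ≤ ‖f‖ := by
  simpa using (P t).le_of_opNorm_le (hP.norm_le t ht) f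

/-- For `s ≤ t` the difference is `P s (P (t - s) f - f)` and `P s` is a contraction. Continuity at
every time thus reduces to continuity at `0`. -/
theorem IsContractionSemigroup.norm_sub_le {P : ℝ → E →L[ℝ] E} (hP : IsContractionSemigroup P)
    (f : E) {s t : ℝ} (hs : 0 ≤ s) (ht : 0 ≤ t) : ‖P t f - P s f‖ ≤ ‖P |t - s| f - f‖ := by
  wlog hst : s ≤ t generalizing s t
  · rw [norm_sub_rev, abs_sub_comm]
    exact this ht hs (le_of_not_ge hst)
  have h0 : 0 ≤ t - s := by linarith
  have h : P t f = P s (P (t - s) f) := by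
    have := hP.add s (t - s) hs h0
    rw [add_sub_cancel] at this
    rw [this]; rfl
  rw [abs_of_nonneg h0, h, ← map_sub]
  exact hP.norm_apply_le hs _

/-- The truncation `max t 0` extends the orbit continuously to all of `ℝ`, so that the fundamental
theorem of calculus gives a two-sided derivative at `0`. -/
theorem IsContractionSemigroup.continuous_max {P : ℝ → E →L[ℝ] E} (hP : IsContractionSemigroup P)
    (f : E) : Continuous fun t : ℝ => P (max t 0) f := by
  have hcont : Tendsto (fun t : ℝ => P |t| f) (𝓝 0) (𝓝 f) := by
    have h := Metric.tendsto_nhdsWithin_nhds.1 (hP.continuous f)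
    rw [Metric.tendsto_nhds_nhds]
    intro ε hε
    obtain ⟨δ, hδ, h⟩ := h ε hε
    refine ⟨δ, hδ, fun {t} ht => ?_⟩
    rcases eq_or_ne t 0 with rfl | h0
    · simp [hP.zero, hε]
    · exact h (abs_pos.2 h0) (by simpa using ht)
  rw [continuous_iff_continuousAt]
  intro s
  rw [ContinuousAt, tendsto_iff_norm_sub_tendsto_zero]
  have h1 : Tendsto (fun t : ℝ => ‖P |max t 0 - max s 0| f - f‖) (𝓝 s) (𝓝 0) := by
    rw [← tendsto_iff_norm_sub_tendsto_zero]
    have h2 : Tendsto (fun t : ℝ => max t 0 - max s 0) (𝓝 s) (𝓝 0) := by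
      have : Continuous fun t : ℝ => max t 0 - max s 0 := by fun_prop
      simpa using this.tendsto s
    exact hcont.comp h2
  exact squeeze_zero (fun _ => norm_nonneg _)
    (fun t => hP.norm_sub_le f (le_max_right _ _) (le_max_right _ _)) h1

variable [CompleteSpace E]

/-- The Laplace transform of the semigroup solves the resolvent equation. -/
theorem IsContractionSemigroup.exists_resolvent {P : ℝ → E →L[ℝ] E}
    (hP : IsContractionSemigroup P) (j : E) {l : ℝ} (hl : 0 < l) :
    ∃ u : E, (u, l • u - j) ∈ infinitesimalGraph P := by
  set g : ℝ → E := fun t => Real.exp (-l * t) • P (max t 0) j with hg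
  have hgc : Continuous g := by
    exact (by fun_prop : Continuous fun t : ℝ => Real.exp (-l * t)).smul (hP.continuous_max j)
  have hgi : IntegrableOn g (Set.Ioi 0) := by
    refine Integrable.mono' ((integrableOn_exp_mul_Ioi (neg_neg_iff_pos.2 hl) 0).mul_const ‖j‖)
      hgc.aestronglyMeasurable.restrict (Eventually.of_forall fun t => ?_)
    rw [hg, norm_smul, Real.norm_eq_abs, abs_of_pos (Real.exp_pos _)]
    exact mul_le_mul_of_nonneg_left (hP.norm_apply_le (le_max_right _ _) j) (Real.exp_pos _).le
  set u : E := ∫ t in Set.Ioi 0, g t with hu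
  refine ⟨u, ?_⟩
  -- By the semigroup law `P s u` is `exp (l s)` times the tail `∫_s^∞ g`, and the tail is `u` minus
  -- an integral over `[0, s]`.
  have hsplit : ∀ s : ℝ, 0 < s →
      P s u - u = (Real.exp (l * s) - 1) • u - Real.exp (l * s) • ∫ t in (0 : ℝ)..s, g t := by
    intro s hs
    have h1 : P s u = Real.exp (l * s) • ∫ t in Set.Ioi s, g t := by
      have e0 : (∫ t in Set.Ioi s, g t) = ∫ t in Set.Ioi (0 : ℝ), g (t + s) := by
        have := (measurePreserving_add_right (volume : Measure ℝ) s).setIntegral_preimage_emb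
          (measurableEmbedding_addRight s) g (Set.Ioi s)
        simpa using this.symm
      rw [e0, hu, ← (P s).integral_comp_comm hgi, ← integral_smul]
      refine setIntegral_congr_fun measurableSet_Ioi fun t ht => ?_
      have ht' : (0 : ℝ) < t := ht
      simp only [hg]
      rw [max_eq_left ht'.le, max_eq_left (by linarith : (0 : ℝ) ≤ t + s), map_smul, smul_smul,
        ← Real.exp_add, add_comm t s, hP.add s t hs.le ht'.le]
      congr 2; ring
    have h2 : u = (∫ t in (0 : ℝ)..s, g t) + ∫ t in Set.Ioi s, g t := by
      rw [hu, intervalIntegral.integral_of_le hs.le, ← setIntegral_union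
        (Set.Ioc_disjoint_Ioi le_rfl) measurableSet_Ioi
        (hgi.mono_set Set.Ioc_subset_Ioi_self) (hgi.mono_set (Set.Ioi_subset_Ioi hs.le)),
        Set.Ioc_union_Ioi_eq_Ioi hs.le]
    have h3 : (∫ t in Set.Ioi s, g t) = u - ∫ t in (0 : ℝ)..s, g t := by
      rw [h2]; abel
    rw [h1, h3]
    module
  -- The right-hand side of `hsplit` makes sense for every real `s`; its derivative at `0` is `l u -
  -- g 0 = l u - j`.
  have hd1 : HasDerivAt (fun s : ℝ => (Real.exp (l * s) - 1) • u
      - Real.exp (l * s) • ∫ t in (0 : ℝ)..s, g t) (l • u - j) 0 := by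
    have he : HasDerivAt (fun s : ℝ => Real.exp (l * s)) l 0 := by
      have := (Real.hasDerivAt_exp (l * 0)).comp (0 : ℝ) ((hasDerivAt_id (0 : ℝ)).const_mul l)
      simpa [Function.comp_def] using this
    have hi : HasDerivAt (fun s : ℝ => ∫ t in (0 : ℝ)..s, g t) (g 0) 0 :=
      intervalIntegral.integral_hasDerivAt_right (hgc.intervalIntegrable _ _)
        (hgc.stronglyMeasurableAtFilter _ _) hgc.continuousAt
    have h := ((he.sub_const 1).smul_const u).sub (he.smul hi)
    have hg0 : g 0 = j := by simp [hg, hP.zero]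
    convert! h using 1
    simp [hg0]
  have h2 := hd1.tendsto_slope_zero_right
  refine h2.congr' ?_
  filter_upwards [self_mem_nhdsWithin] with s hs
  simp [hsplit s hs]

end Semigroup

/-! ### The conductivity in an abstract Hilbert space -/

section Abstract

variable {E : Type*} [NormedAddCommGroup E] [InnerProductSpace ℝ E]

/-- A differentiable function which is bounded below and whose derivative is bounded below on
`(0, 1)` has a limit at `0+`. -/
theorem exists_tendsto_of_deriv_ge {φ ψ : ℝ → ℝ} {C : ℝ}
    (hφ : ∀ l, 0 < l → HasDerivAt φ (ψ l) l) (hnn : ∀ l, 0 < l → 0 ≤ φ l)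
    (hψ : ∀ l, 0 < l → l < 1 → -C ≤ ψ l) :
    ∃ k, Tendsto φ (𝓝[>] 0) (𝓝 k) := by
  have hd : ∀ l, 0 < l → HasDerivAt (fun l => φ l + C * l) (ψ l + C) l := fun l hl => by
    convert! (hφ l hl).add ((hasDerivAt_id l).const_mul C) using 1
    simp
  have hmono : MonotoneOn (fun l => φ l + C * l) (Set.Ioo 0 1) := by
    refine monotoneOn_of_deriv_nonneg (convex_Ioo 0 1)
      (fun l hl => (hd l hl.1).continuousAt.continuousWithinAt)
      (fun l hl => ?_) (fun l hl => ?_)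
    · rw [interior_Ioo] at hl; exact (hd l hl.1).differentiableAt.differentiableWithinAt
    · rw [interior_Ioo] at hl
      rw [(hd l hl.1).deriv]; linarith [hψ l hl.1 hl.2]
  have hbdd : BddBelow ((fun l => φ l + C * l) '' Set.Ioo 0 1) := by
    refine ⟨-|C|, ?_⟩
    rintro _ ⟨l, hl, rfl⟩
    have h1 : -|C| ≤ C * l := by
      have : |C * l| ≤ |C| := by
        rw [abs_mul, abs_of_pos hl.1]; exact mul_le_of_le_one_right (abs_nonneg _) hl.2.le
      linarith [neg_abs_le (C * l)]
    simp only
    linarith [hnn l hl.1]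
  have h := hmono.tendsto_nhdsWithin_Ioo_right (Set.nonempty_Ioo.2 one_pos) hbdd
  refine ⟨sInf ((fun l => φ l + C * l) '' Set.Ioo 0 1), ?_⟩
  have h2 : Tendsto (fun l : ℝ => C * l) (𝓝[>] 0) (𝓝 0) := by
    have : Continuous fun l : ℝ => C * l := by fun_prop
    simpa using (this.tendsto 0).mono_left nhdsWithin_le_nhds
  have := h.sub h2
  simpa using this

/-- Existence of the zero-frequency limit of `⟪j, u_l⟫`, together with two-sided bounds,
for a dissipative graph which is symmetric with respect to the form `⟪·, R ·⟫`. -/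
theorem exists_conductivity_limit {G : Set (E × E)} {R : E →L[ℝ] E} {j js e h : E} {γ J : ℝ}
    (hγ : 0 < γ) (hJ : 0 ≤ J)
    (hsub : ∀ z ∈ G, ∀ w ∈ G, z - w ∈ G)
    (hsymm : ∀ z ∈ G, ∀ w ∈ G, inner ℝ z.2 (R w.1) = inner ℝ z.1 (R w.2))
    (hRj : R j = -j)
    (hsector : ∀ z ∈ G, 3 * γ * inner ℝ z.1 js ^ 2 ≤ J * -inner ℝ z.2 z.1)
    (hgap : ∀ z ∈ G, γ * ‖z.1 - R z.1‖ ^ 2 ≤ 2 * -inner ℝ z.2 z.1)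
    (hexact : ∀ z ∈ G, inner ℝ e z.1 = -inner ℝ h z.2)
    (hj : j = js + (1 / 2 : ℝ) • e) (hhj : inner ℝ h j = 0) (hjjs : inner ℝ j js = J)
    {u : ℝ → E} (hu : ∀ l, 0 < l → (u l, l • u l - j) ∈ G) :
    ∃ k, Tendsto (fun l => inner ℝ j (u l)) (𝓝[>] 0) (𝓝 k) ∧ 0 ≤ k ∧ k ≤ J / (3 * γ) ∧
      ∀ M, 0 ≤ M → (∀ z ∈ G, (inner ℝ z.2 js + 3 * γ * inner ℝ z.1 js) ^ 2 ≤ M * -inner ℝ z.2 z.1) →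
        (3 * γ * k - J) ^ 2 ≤ M * k := by
  set φ : ℝ → ℝ := fun l => inner ℝ j (u l) with hφ
  have hdiss : ∀ z ∈ G, 0 ≤ -inner ℝ z.2 z.1 := fun z hz => by
    have := hgap z hz
    have h2 : 0 ≤ γ * ‖z.1 - R z.1‖ ^ 2 := by positivity
    linarith
  have hen : ∀ l, 0 < l → -inner ℝ (l • u l - j) (u l) = φ l - l * ‖u l‖ ^ 2 := fun l hl => by
    rw [inner_sub_left, inner_smul_left, real_inner_self_eq_norm_sq]
    simp [hφ]
  have hφnn : ∀ l, 0 < l → 0 ≤ φ l - l * ‖u l‖ ^ 2 := fun l hl => by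
    have := hdiss _ (hu l hl)
    rwa [hen l hl] at this
  have hφnn' : ∀ l, 0 < l → 0 ≤ φ l := fun l hl => by
    have := hφnn l hl
    have h2 : 0 ≤ l * ‖u l‖ ^ 2 := by positivity
    linarith
  -- Since `⟪h, j⟫ = 0`, exactness gives `⟪e, u_l⟫ = -l ⟪h, u_l⟫`: the exact part of the current
  -- contributes only a multiple of `l ⟪h, u_l⟫`.
  have hjs : ∀ l, 0 < l → inner ℝ (u l) js = φ l + l / 2 * inner ℝ h (u l) := fun l hl => by
    have h1 := hexact _ (hu l hl)
    simp only [inner_sub_right, inner_smul_right, hhj] at h1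
    have h2 : φ l = inner ℝ js (u l) + 1 / 2 * inner ℝ e (u l) := by
      simp only [hφ]
      rw [hj, inner_add_left, inner_smul_left]; simp
    rw [real_inner_comm, h2, h1]; ring
  -- upper bound
  have hup : ∀ l, 0 < l → φ l ≤ J / (3 * γ) + l / 4 * ‖h‖ ^ 2 := fun l hl => by
    have h1 := hsector _ (hu l hl)
    rw [hen l hl] at h1
    simp only at h1
    have h2 := hjs l hl
    have h3 : |inner ℝ h (u l)| ≤ ‖h‖ * ‖u l‖ := abs_real_inner_le_norm _ _
    have h4 := neg_abs_le (inner ℝ h (u l))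
    set x := inner ℝ (u l) js with hx
    set q := φ l - l * ‖u l‖ ^ 2 with hq
    have hq0 : 0 ≤ q := hφnn l hl
    have hx1 : x ^ 2 ≤ J / (3 * γ) * q := by
      rw [div_mul_eq_mul_div, le_div_iff₀ (by positivity)]
      linarith
    have hK : 0 ≤ J / (3 * γ) := by positivity
    set K := J / (3 * γ) with hKdef
    -- Arithmetic-geometric mean, from `x² ≤ K q` with `K, q ≥ 0`.
    have hx2 : x ≤ (K + q) / 2 := by
      nlinarith [sq_nonneg (K - q), sq_nonneg (x - (K + q) / 2), sq_nonneg (K + q)]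
    have h5 : φ l ≤ x + l / 2 * (‖h‖ * ‖u l‖) := by
      have : -(inner ℝ h (u l)) ≤ ‖h‖ * ‖u l‖ := by linarith
      nlinarith
    have hφq : φ l = q + l * ‖u l‖ ^ 2 := by rw [hq]; ring
    -- The weights are chosen so that `l ‖u l‖² / 2` cancels exactly against the same term in `q /
    -- 2`.
    have h6 : l / 2 * (‖h‖ * ‖u l‖) ≤ l / 8 * ‖h‖ ^ 2 + l / 2 * ‖u l‖ ^ 2 := by
      nlinarith [sq_nonneg (‖h‖ - 2 * ‖u l‖)]
    linarith
  -- derivative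
  have hid : ∀ l m, 0 < l → 0 < m → φ l - φ m = (l - m) * inner ℝ (u l) (R (u m)) := by
    intro l m hl hm
    -- The off-diagonal instance compares `l` with `m`; the diagonal one at `m` identifies `-⟪j, R
    -- u_m⟫` with `φ m`.
    have h1 := hsymm _ (hu l hl) _ (hu m hm)
    have h2 := hsymm _ (hu m hm) _ (hu m hm)
    simp only [map_sub, map_smul, hRj, inner_sub_left, inner_sub_right, inner_smul_left,
      inner_smul_right, inner_neg_right] at h1 h2
    simp only [conj_trivial] at h1 h2
    have h3 : inner ℝ (u l) j = φ l := real_inner_comm _ _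
    have h4 : inner ℝ (u m) j = φ m := real_inner_comm _ _
    rw [h3] at h1
    rw [h4] at h2
    linarith
  -- Dissipativity applied to the difference of two solutions, whose second component is `l (u_m -
  -- u_l) + (m - l) u_m`. This yields continuity of the resolvent in `l`.
  have hlip : ∀ l m, 0 < l → 0 < m → l * ‖u m - u l‖ ≤ |m - l| * ‖u m‖ := by
    intro l m hl hm
    have h1 := hdiss _ (hsub _ (hu m hm) _ (hu l hl))
    have h2 : (m • u m - j) - (l • u l - j) = l • (u m - u l) + (m - l) • u m := by module
    simp only [Prod.fst_sub, Prod.snd_sub] at h1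
    rw [h2, inner_add_left, inner_smul_left, inner_smul_left, real_inner_self_eq_norm_sq] at h1
    simp only [conj_trivial] at h1
    have h3 : |(m - l) * inner ℝ (u m) (u m - u l)| ≤ |m - l| * (‖u m‖ * ‖u m - u l‖) := by
      rw [abs_mul]
      exact mul_le_mul_of_nonneg_left (abs_real_inner_le_norm _ _) (abs_nonneg _)
    have h4 := neg_abs_le ((m - l) * inner ℝ (u m) (u m - u l))
    rcases (norm_nonneg (u m - u l)).eq_or_lt with h0 | h0
    · rw [← h0, mul_zero]; positivity
    · refine le_of_mul_le_mul_right ?_ h0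
      nlinarith
  have hucont : ∀ l, 0 < l → ContinuousAt u l := by
    intro l hl
    have h1 : ∀ m, 0 < m → ‖u m - u l‖ ≤ |l - m| / m * ‖u l‖ := by
      intro m hm
      have := hlip m l hm hl
      rw [norm_sub_rev, div_mul_eq_mul_div, le_div_iff₀ hm]
      linarith
    rw [ContinuousAt, tendsto_iff_norm_sub_tendsto_zero]
    have h2 : Tendsto (fun m : ℝ => |l - m| / m * ‖u l‖) (𝓝 l) (𝓝 0) := by
      have : ContinuousAt (fun m : ℝ => |l - m| / m * ‖u l‖) l := by
        refine ContinuousAt.mul (ContinuousAt.div ?_ continuousAt_id hl.ne') continuousAt_const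
        exact (continuous_const.sub continuous_id).abs.continuousAt
      simpa [ContinuousAt] using this
    refine squeeze_zero' (Eventually.of_forall fun _ => norm_nonneg _) ?_ h2
    filter_upwards [lt_mem_nhds hl] with m hm using h1 m hm
  have hder : ∀ l, 0 < l → HasDerivAt φ (inner ℝ (u l) (R (u l))) l := by
    intro l hl
    rw [hasDerivAt_iff_tendsto_slope]
    have hc : Tendsto (fun m => inner ℝ (u m) (R (u l))) (𝓝[≠] l)
        (𝓝 (inner ℝ (u l) (R (u l)))) :=
      ((hucont l hl).tendsto.mono_left nhdsWithin_le_nhds).inner tendsto_const_nhds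
    refine hc.congr' ?_
    have h0 : ∀ᶠ m in 𝓝[≠] l, 0 < m := nhdsWithin_le_nhds (lt_mem_nhds hl)
    filter_upwards [h0, self_mem_nhdsWithin] with m hm hml
    have hne : m - l ≠ 0 := sub_ne_zero.2 hml
    rw [slope_def_field, hid m l hm hl]
    field_simp
  -- By polarization `4 ⟪u, R u⟫ = ‖u + R u‖² - ‖u - R u‖²`. The gap bounds the negative term by `2
  -- φ / γ`, and `hup` bounds `φ` on `(0, 1)`.
  have hder_ge : ∀ l, 0 < l → l < 1 →
      -((J / (3 * γ) + 1 / 4 * ‖h‖ ^ 2) / (2 * γ)) ≤ inner ℝ (u l) (R (u l)) := by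
    intro l hl hl1
    have h1 := hgap _ (hu l hl)
    rw [hen l hl] at h1
    simp only at h1
    have h2 : -(‖u l - R (u l)‖ ^ 2) ≤ 4 * inner ℝ (u l) (R (u l)) := by
      have ha := norm_sub_sq_real (u l) (R (u l))
      have hb := norm_add_sq_real (u l) (R (u l))
      nlinarith [sq_nonneg ‖u l + R (u l)‖]
    have h3 : φ l ≤ J / (3 * γ) + 1 / 4 * ‖h‖ ^ 2 := by
      have := hup l hl
      nlinarith [sq_nonneg ‖h‖]
    have h4 : 0 ≤ l * ‖u l‖ ^ 2 := by positivity
    rw [neg_le, le_div_iff₀ (by positivity)]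
    nlinarith
  obtain ⟨k, hk⟩ := exists_tendsto_of_deriv_ge hder hφnn' hder_ge
  have hε : Tendsto (fun l : ℝ => J / (3 * γ) + l / 4 * ‖h‖ ^ 2) (𝓝[>] 0) (𝓝 (J / (3 * γ))) := by
    have : Continuous fun l : ℝ => J / (3 * γ) + l / 4 * ‖h‖ ^ 2 := by fun_prop
    simpa using (this.tendsto 0).mono_left nhdsWithin_le_nhds
  have hpos : ∀ᶠ l : ℝ in 𝓝[>] 0, 0 < l := self_mem_nhdsWithin
  refine ⟨k, hk, ge_of_tendsto hk (hpos.mono hφnn'), le_of_tendsto_of_tendsto hk hε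
    (hpos.mono hup), fun M hM₀ hM => ?_⟩
  -- the vanishing correction
  have hsq : ∀ l, 0 < l → l < 1 → (l * inner ℝ h (u l)) ^ 2 ≤
      l * (‖h‖ ^ 2 * (J / (3 * γ) + 1 / 4 * ‖h‖ ^ 2)) := by
    intro l hl hl1
    have h1 : (inner ℝ h (u l)) ^ 2 ≤ ‖h‖ ^ 2 * ‖u l‖ ^ 2 := by
      rw [← mul_pow, sq_le_sq, abs_of_nonneg (by positivity : 0 ≤ ‖h‖ * ‖u l‖)]
      exact abs_real_inner_le_norm _ _
    have h2 : l * ‖u l‖ ^ 2 ≤ J / (3 * γ) + 1 / 4 * ‖h‖ ^ 2 := by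
      have := hup l hl
      have := hφnn l hl
      nlinarith [sq_nonneg ‖h‖]
    calc (l * inner ℝ h (u l)) ^ 2 = l ^ 2 * (inner ℝ h (u l)) ^ 2 := by ring
      _ ≤ l ^ 2 * (‖h‖ ^ 2 * ‖u l‖ ^ 2) := by gcongr
      _ = l * (‖h‖ ^ 2 * (l * ‖u l‖ ^ 2)) := by ring
      _ ≤ _ := by gcongr
  have hcorr : Tendsto (fun l => l * inner ℝ h (u l)) (𝓝[>] 0) (𝓝 0) := by
    have h1 : Tendsto (fun l => (l * inner ℝ h (u l)) ^ 2) (𝓝[>] 0) (𝓝 0) := by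
      have h2 : Tendsto (fun l : ℝ => l * (‖h‖ ^ 2 * (J / (3 * γ) + 1 / 4 * ‖h‖ ^ 2)))
          (𝓝[>] 0) (𝓝 0) := by
        have : Continuous fun l : ℝ => l * (‖h‖ ^ 2 * (J / (3 * γ) + 1 / 4 * ‖h‖ ^ 2)) := by
          fun_prop
        simpa using (this.tendsto 0).mono_left nhdsWithin_le_nhds
      refine squeeze_zero' (Eventually.of_forall fun _ => sq_nonneg _) ?_ h2
      filter_upwards [Ioo_mem_nhdsGT (zero_lt_one' ℝ)] with l hl using hsq l hl.1 hl.2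
    have h3 := h1.sqrt
    simp only [Real.sqrt_sq_eq_abs, Real.sqrt_zero] at h3
    exact (tendsto_zero_iff_abs_tendsto_zero _).2 h3
  have hl0 : Tendsto (fun l : ℝ => l) (𝓝[>] 0) (𝓝 0) := nhdsWithin_le_nhds
  have hx : Tendsto (fun l => inner ℝ (u l) js) (𝓝[>] 0) (𝓝 k) := by
    have h1 := hk.add (hcorr.const_mul (1 / 2))
    simp only [mul_zero, add_zero] at h1
    refine h1.congr' (hpos.mono fun l hl => ?_)
    simp only
    rw [hjs l hl]; ring
  -- The hypothesis at the resolvent point: the second component `l u_l - j` pairs with `js` to `l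
  -- ⟪u_l, js⟫ - J`.
  have hineq : ∀ l, 0 < l → (l * inner ℝ (u l) js - J + 3 * γ * inner ℝ (u l) js) ^ 2 ≤
      M * (φ l - l * ‖u l‖ ^ 2) := by
    intro l hl
    have h1 := hM _ (hu l hl)
    rw [hen l hl] at h1
    simp only [inner_sub_left, inner_smul_left, hjjs] at h1
    simpa using h1
  have hM0 : ∀ l, 0 < l → (l * inner ℝ (u l) js - J + 3 * γ * inner ℝ (u l) js) ^ 2 ≤
      M * φ l := by
    intro l hl
    refine (hineq l hl).trans (mul_le_mul_of_nonneg_left ?_ hM₀)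
    have : 0 ≤ l * ‖u l‖ ^ 2 := by positivity
    linarith
  have h1 : Tendsto (fun l => (l * inner ℝ (u l) js - J + 3 * γ * inner ℝ (u l) js) ^ 2)
      (𝓝[>] 0) (𝓝 ((0 * k - J + 3 * γ * k) ^ 2)) :=
    (((hl0.mul hx).sub_const J).add (hx.const_mul (3 * γ))).pow 2
  have h2 := le_of_tendsto_of_tendsto h1 (hk.const_mul M) (hpos.mono hM0)
  calc (3 * γ * k - J) ^ 2 = (0 * k - J + 3 * γ * k) ^ 2 := by ring
    _ ≤ _ := h2

end Abstract

/-! ### Functions with all moments and functions integrable against them -/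

section Temperate

variable {Ω : Type*} [MeasurableSpace Ω] {μ : Measure Ω}

/-- Measurable functions all of whose moments are finite. -/
structure Temperate (μ : Measure Ω) (f : Ω → ℝ) : Prop where
  meas : Measurable f
  moments : ∀ n : ℕ, Integrable (fun ω => |f ω| ^ n) μ

/-- Measurable functions which are integrable against every function with all moments. -/
structure Tame (μ : Measure Ω) (k : Ω → ℝ) : Prop where
  meas : Measurable k
  pairing : ∀ φ, Temperate μ φ → Integrable (fun ω => φ ω * k ω) μ

theorem Temperate.integrable {f : Ω → ℝ} (hf : Temperate μ f) : Integrable f μ := by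
  have := hf.moments 1
  simp only [pow_one] at this
  exact (integrable_norm_iff hf.meas.aestronglyMeasurable).1 this

theorem Temperate.memLp_two {f : Ω → ℝ} (hf : Temperate μ f) : MemLp f 2 μ := by
  rw [memLp_two_iff_integrable_sq hf.meas.aestronglyMeasurable]
  simpa using hf.moments 2

theorem Temperate.mul {f g : Ω → ℝ} (hf : Temperate μ f) (hg : Temperate μ g) :
    Temperate μ fun ω => f ω * g ω := by
  refine ⟨hf.meas.mul hg.meas, fun n => ?_⟩
  refine ((hf.moments (2 * n)).add (hg.moments (2 * n))).mono'
    ((hf.meas.mul hg.meas).abs.pow_const n).aestronglyMeasurable (Eventually.of_forall fun ω => ?_)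
  rw [Real.norm_eq_abs, abs_pow, abs_abs, abs_mul, mul_pow]
  simp only [Pi.add_apply, pow_mul', sq]
  nlinarith [sq_nonneg (|f ω| ^ n - |g ω| ^ n), sq_nonneg (|f ω| ^ n), sq_nonneg (|g ω| ^ n)]

theorem Temperate.add {f g : Ω → ℝ} (hf : Temperate μ f) (hg : Temperate μ g) :
    Temperate μ fun ω => f ω + g ω := by
  refine ⟨hf.meas.add hg.meas, fun n => ?_⟩
  refine (((hf.moments n).add (hg.moments n)).const_mul (2 ^ n)).mono'
    ((hf.meas.add hg.meas).abs.pow_const n).aestronglyMeasurable (Eventually.of_forall fun ω => ?_)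
  rw [Real.norm_eq_abs, abs_pow, abs_abs]
  simp only [Pi.add_apply]
  have hm : |f ω + g ω| ≤ 2 * max |f ω| |g ω| := by
    have := abs_add_le (f ω) (g ω)
    linarith [le_max_left |f ω| |g ω|, le_max_right |f ω| |g ω|]
  calc |f ω + g ω| ^ n ≤ (2 * max |f ω| |g ω|) ^ n := by gcongr
    _ = 2 ^ n * max |f ω| |g ω| ^ n := by rw [mul_pow]
    _ ≤ 2 ^ n * (|f ω| ^ n + |g ω| ^ n) := by
      gcongr
      rcases max_choice |f ω| |g ω| with h | h <;> rw [h]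
      · linarith [pow_nonneg (abs_nonneg (g ω)) n]
      · linarith [pow_nonneg (abs_nonneg (f ω)) n]

theorem Temperate.of_bound [IsFiniteMeasure μ] {f : Ω → ℝ} (hf : Measurable f) (C : ℝ)
    (h : ∀ ω, |f ω| ≤ C) : Temperate μ f := by
  refine ⟨hf, fun n => Integrable.of_bound (hf.abs.pow_const n).aestronglyMeasurable (C ^ n)
    (Eventually.of_forall fun ω => ?_)⟩
  rw [Real.norm_eq_abs, abs_pow, abs_abs]
  exact pow_le_pow_left₀ (abs_nonneg _) (h ω) n

theorem Temperate.const [IsFiniteMeasure μ] (c : ℝ) : Temperate μ fun _ : Ω => c :=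
  Temperate.of_bound measurable_const |c| fun _ => le_rfl

theorem Temperate.const_mul [IsFiniteMeasure μ] {f : Ω → ℝ} (c : ℝ) (hf : Temperate μ f) :
    Temperate μ fun ω => c * f ω := (Temperate.const c).mul hf

theorem Temperate.neg [IsFiniteMeasure μ] {f : Ω → ℝ} (hf : Temperate μ f) :
    Temperate μ fun ω => -f ω := by simpa using hf.const_mul (-1)

theorem Temperate.sub [IsFiniteMeasure μ] {f g : Ω → ℝ} (hf : Temperate μ f)
    (hg : Temperate μ g) : Temperate μ fun ω => f ω - g ω := by
  simpa [sub_eq_add_neg] using hf.add hg.neg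

theorem Temperate.sum [IsFiniteMeasure μ] {ι : Type*} {f : ι → Ω → ℝ} (s : Finset ι)
    (hf : ∀ i ∈ s, Temperate μ (f i)) : Temperate μ fun ω => ∑ i ∈ s, f i ω := by
  classical
  induction s using Finset.induction_on with
  | empty => simpa using Temperate.const (μ := μ) 0
  | insert a s ha ih =>
    simp only [Finset.sum_insert ha]
    exact (hf a (Finset.mem_insert_self _ _)).add
      (ih fun i hi => hf i (Finset.mem_insert_of_mem hi))

theorem Temperate.comp {Ω' : Type*} [MeasurableSpace Ω'] {μ' : Measure Ω'} {f : Ω → ℝ}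
    (hf : Temperate μ f) {e : Ω' → Ω} (he : MeasurePreserving e μ' μ) :
    Temperate μ' fun ω => f (e ω) :=
  ⟨hf.meas.comp he.measurable, fun n => he.integrable_comp_of_integrable (hf.moments n)⟩

/-- Functions with all moments lie in `L²`, so they pair with `L²`. This is how `V''` enters: it is
only assumed square integrable, while everything multiplied with it has all moments. -/
theorem tame_of_memLp_two {k : Ω → ℝ} (hk : Measurable k) (h : MemLp k 2 μ) : Tame μ k :=
  ⟨hk, fun _ hφ => hφ.memLp_two.integrable_mul h⟩

theorem Temperate.tame {f : Ω → ℝ} (hf : Temperate μ f) : Tame μ f :=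
  tame_of_memLp_two hf.meas hf.memLp_two

theorem Tame.integrable [IsFiniteMeasure μ] {k : Ω → ℝ} (hk : Tame μ k) : Integrable k μ := by
  simpa using hk.pairing _ (Temperate.const 1)

theorem Temperate.mul_tame {φ k : Ω → ℝ} (hφ : Temperate μ φ) (hk : Tame μ k) :
    Tame μ fun ω => φ ω * k ω :=
  ⟨hφ.meas.mul hk.meas, fun ψ hψ => by simpa [mul_assoc] using hk.pairing _ (hψ.mul hφ)⟩

theorem Tame.add {k l : Ω → ℝ} (hk : Tame μ k) (hl : Tame μ l) : Tame μ fun ω => k ω + l ω :=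
  ⟨hk.meas.add hl.meas, fun φ hφ => by
    simp only [mul_add]
    exact (hk.pairing φ hφ).add (hl.pairing φ hφ)⟩

theorem Tame.const_mul {k : Ω → ℝ} (c : ℝ) (hk : Tame μ k) :
    Tame μ fun ω => c * k ω :=
  ⟨hk.meas.const_mul c, fun φ hφ => by
    simpa [mul_left_comm] using (hk.pairing φ hφ).const_mul c⟩

theorem Tame.neg {k : Ω → ℝ} (hk : Tame μ k) : Tame μ fun ω => -k ω := by
  simpa using hk.const_mul (-1)

theorem Tame.sub {k l : Ω → ℝ} (hk : Tame μ k) (hl : Tame μ l) : Tame μ fun ω => k ω - l ω := by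
  simpa [sub_eq_add_neg] using hk.add hl.neg

/-- The test function is moved to the other side by the inverse map, which must therefore preserve
the measure as well. -/
theorem Tame.comp {k : Ω → ℝ} (hk : Tame μ k) {e e' : Ω → Ω} (he : MeasurePreserving e μ μ)
    (he' : MeasurePreserving e' μ μ) (hee' : ∀ ω, e' (e ω) = ω) : Tame μ fun ω => k (e ω) :=
  ⟨hk.meas.comp he.measurable, fun φ hφ => by
    have := he.integrable_comp_of_integrable (hk.pairing _ (hφ.comp he'))
    simpa [Function.comp_def, hee'] using this⟩

end Temperate

theorem integral_comp_measurePreserving {Ω Ω' : Type*} [MeasurableSpace Ω] [MeasurableSpace Ω']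
    {μ : Measure Ω} {μ' : Measure Ω'} {e : Ω → Ω'} (he : MeasurePreserving e μ μ') {f : Ω' → ℝ}
    (hf : Measurable f) : ∫ ω, f (e ω) ∂μ = ∫ ω, f ω ∂μ' := by
  rw [← he.map_eq, integral_map he.measurable.aemeasurable hf.aestronglyMeasurable]

/-! ### Integration by parts in one dimension -/

/-- The integrand times the density is the derivative of `ρ g`. Only the combination `g' - s g` has
to be integrable, which is all that Fubini supplies on almost every slice. -/
theorem integral_deriv_sub_eq_zero {ρ s g : ℝ → ℝ} (hρm : Measurable ρ) (hρ0 : ∀ x, 0 ≤ ρ x)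
    (hρ : ∀ x, HasDerivAt ρ (-(s x * ρ x)) x) (hg : Differentiable ℝ g)
    (hgi : Integrable g (volume.withDensity fun x => ENNReal.ofReal (ρ x)))
    (hgi' : Integrable (fun x => deriv g x - s x * g x)
      (volume.withDensity fun x => ENNReal.ofReal (ρ x))) :
    ∫ x, (deriv g x - s x * g x) ∂(volume.withDensity fun x => ENNReal.ofReal (ρ x)) = 0 := by
  have hm : Measurable fun x => ENNReal.ofReal (ρ x) := hρm.ennreal_ofReal
  rw [integrable_withDensity_iff_integrable_smul' hm (by simp)] at hgi hgi'
  rw [integral_withDensity_eq_integral_toReal_smul hm (by simp)]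
  simp only [ENNReal.toReal_ofReal (hρ0 _), smul_eq_mul] at hgi hgi' ⊢
  refine integral_eq_zero_of_hasDerivAt_of_integrable (f := fun x => ρ x * g x) (fun x => ?_)
    hgi' hgi
  convert! (hρ x).mul (hg x).hasDerivAt using 1
  ring

theorem integral_deriv_sub_eq_zero_gaussian {T : ℝ} (hT : 0 < T) {g : ℝ → ℝ}
    (hg : Differentiable ℝ g) (hgi : Integrable g (gaussianReal 0 T.toNNReal))
    (hgi' : Integrable (fun x => deriv g x - x / T * g x) (gaussianReal 0 T.toNNReal)) :
    ∫ x, (deriv g x - x / T * g x) ∂(gaussianReal 0 T.toNNReal) = 0 := by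
  have hv : T.toNNReal ≠ 0 := by simpa using hT
  rw [gaussianReal_of_var_ne_zero _ hv] at hgi hgi' ⊢
  refine integral_deriv_sub_eq_zero (measurable_gaussianPDFReal _ _)
    (gaussianPDFReal_nonneg _ _) (fun x => ?_) hg hgi hgi'
  have hT' : ((T.toNNReal : NNReal) : ℝ) = T := Real.coe_toNNReal T hT.le
  unfold gaussianPDFReal
  rw [hT']
  have h1 : HasDerivAt (fun x : ℝ => -(x - 0) ^ 2 / (2 * T)) (-(x / T)) x := by
    have := (((hasDerivAt_id x).sub_const 0).pow 2).neg.div_const (2 * T)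
    convert! this using 1
    simp; field_simp
  convert! (h1.exp.const_mul (√(2 * Real.pi * T))⁻¹) using 1
  simp only [sub_zero]; ring

theorem integral_deriv_sub_eq_zero_tilted {V : ℝ → ℝ} {T : ℝ} (hV : Differentiable ℝ V)
    {g : ℝ → ℝ} (hg : Differentiable ℝ g)
    (hgi : Integrable g (volume.tilted fun r => -V r / T))
    (hgi' : Integrable (fun x => deriv g x - deriv V x / T * g x)
      (volume.tilted fun r => -V r / T)) :
    ∫ x, (deriv g x - deriv V x / T * g x) ∂(volume.tilted fun r => -V r / T) = 0 := by
  unfold Measure.tilted at *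
  refine integral_deriv_sub_eq_zero (ρ := fun x => Real.exp (-V x / T) /
    ∫ y, Real.exp (-V y / T)) ?_ (fun x => ?_) (fun x => ?_) hg hgi hgi'
  · exact ((hV.continuous.neg.div_const T).rexp.div_const _).measurable
  · exact div_nonneg (Real.exp_pos _).le (integral_nonneg fun y => (Real.exp_pos _).le)
  · have := (((hV x).hasDerivAt.neg.div_const T).exp.div_const (∫ y, Real.exp (-V y / T)))
    convert! this using 1
    simp only [Pi.neg_apply]
    ring

/-! ### Resampling and measure preserving maps of configurations -/

section Product

variable {ν : Measure (ℝ × ℝ)} [IsProbabilityMeasure ν]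

theorem measurePreserving_eval (x : ℤ) :
    MeasurePreserving (fun ω : Config => ω x) (productMeasure ν) ν :=
  measurePreserving_eval_infinitePi (fun _ : ℤ => ν) x

theorem measurable_update_comp {Y : Type*} [MeasurableSpace Y] {Φ : (ℝ × ℝ) × Y → ℝ × ℝ}
    (hΦ : Measurable Φ) (x : ℤ) :
    Measurable fun z : Config × Y => Function.update z.1 x (Φ (z.1 x, z.2)) := by
  refine measurable_pi_lambda _ fun i => ?_
  by_cases hi : i = x
  · subst hi
    simp only [Function.update_self]
    fun_prop
  · simp only [Function.update_of_ne hi]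
    fun_prop

/-- A product measure is determined by finite boxes. For fixed `y` the preimage of a box is a box
with only the factor at `x` changed, and averaging that factor over `y` restores its mass because
`Φ` preserves the site measure. -/
theorem measurePreserving_update_comp {Y : Type*} [MeasurableSpace Y] {lam : Measure Y}
    [IsProbabilityMeasure lam] {Φ : (ℝ × ℝ) × Y → ℝ × ℝ}
    (hΦ : MeasurePreserving Φ (ν.prod lam) ν) (x : ℤ) :
    MeasurePreserving (fun z : Config × Y => Function.update z.1 x (Φ (z.1 x, z.2)))
      ((productMeasure ν).prod lam) (productMeasure ν) := by
  have hm := measurable_update_comp hΦ.measurable x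
  refine ⟨hm, Measure.eq_infinitePi _ fun s t ht => ?_⟩
  classical
  have hbox : MeasurableSet (Set.pi (s : Set ℤ) t) :=
    MeasurableSet.pi s.countable_toSet fun i _ => ht i
  rw [Measure.map_apply hm hbox, Measure.prod_apply_symm (hm hbox)]
  have hsec : ∀ y : Y, (fun ω => (ω, y)) ⁻¹' ((fun z : Config × Y =>
      Function.update z.1 x (Φ (z.1 x, z.2))) ⁻¹' Set.pi (s : Set ℤ) t) =
      Set.pi (s : Set ℤ) (Function.update t x ((fun v => Φ (v, y)) ⁻¹' t x)) := by
    intro y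
    ext ω
    simp only [Set.mem_preimage, Set.mem_pi]
    refine forall₂_congr fun i _ => ?_
    by_cases hi : i = x
    · subst hi; simp
    · simp [Function.update_of_ne hi]
  have hmy : ∀ y, Measurable fun v => Φ (v, y) := fun y => hΦ.measurable.comp (by fun_prop)
  have hmeas : ∀ y i, MeasurableSet (Function.update t x ((fun v => Φ (v, y)) ⁻¹' t x) i) := by
    intro y i
    by_cases hi : i = x
    · subst hi; simpa using hmy y (ht i)
    · simpa [Function.update_of_ne hi] using ht i
  simp only [hsec, productMeasure]
  simp only [Measure.infinitePi_pi (fun _ : ℤ => ν) (s := s) fun i _ => hmeas _ i]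
  by_cases hx : x ∈ s
  · have h1 : ∀ y, ∏ i ∈ s, ν (Function.update t x ((fun v => Φ (v, y)) ⁻¹' t x) i) =
        ν ((fun v => Φ (v, y)) ⁻¹' t x) * ∏ i ∈ s.erase x, ν (t i) := by
      intro y
      rw [← Finset.mul_prod_erase s _ hx, Function.update_self]
      congr 1
      refine Finset.prod_congr rfl fun i hi => ?_
      rw [Function.update_of_ne (Finset.ne_of_mem_erase hi)]
    simp only [h1]
    have h2 : (∫⁻ y, ν ((fun v => Φ (v, y)) ⁻¹' t x) ∂lam) = ν (t x) := by
      rw [← hΦ.measure_preimage (ht x).nullMeasurableSet,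
        Measure.prod_apply_symm (hΦ.measurable (ht x))]
      rfl
    rw [lintegral_mul_const, h2, Finset.mul_prod_erase s (fun i => ν (t i)) hx]
    exact measurable_measure_prodMk_right (hΦ.measurable (ht x))
  · have h1 : ∀ y, ∏ i ∈ s, ν (Function.update t x ((fun v => Φ (v, y)) ⁻¹' t x) i) =
        ∏ i ∈ s, ν (t i) := by
      intro y
      refine Finset.prod_congr rfl fun i hi => ?_
      rw [Function.update_of_ne]
      rintro rfl
      exact hx hi
    simp only [h1, lintegral_const, measure_univ, mul_one]

/-- Integration by parts along a resampled coordinate. -/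
theorem integral_deriv_sub_eq_zero_of_resample {lam : Measure ℝ} [IsProbabilityMeasure lam]
    {c : Config × ℝ → Config}
    (hc : MeasurePreserving c ((productMeasure ν).prod lam) (productMeasure ν))
    {F D s : Config → ℝ} {s' : ℝ → ℝ} (hs : ∀ ω t, s (c (ω, t)) = s' t)
    (hF : ∀ ω, Differentiable ℝ fun t => F (c (ω, t)))
    (hD : ∀ ω t, D (c (ω, t)) = deriv (fun t => F (c (ω, t))) t)
    (hFi : Integrable F (productMeasure ν))
    (hDi : Integrable (fun ω => D ω - s ω * F ω) (productMeasure ν))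
    (hlam : ∀ g : ℝ → ℝ, Differentiable ℝ g → Integrable g lam →
      Integrable (fun x => deriv g x - s' x * g x) lam →
      ∫ x, (deriv g x - s' x * g x) ∂lam = 0) :
    ∫ ω, (D ω - s ω * F ω) ∂productMeasure ν = 0 := by
  have h1 := hc.integrable_comp_of_integrable hFi
  have h2 := hc.integrable_comp_of_integrable hDi
  have h3 : ∫ ω, (D ω - s ω * F ω) ∂productMeasure ν =
      ∫ z, (D (c z) - s (c z) * F (c z)) ∂((productMeasure ν).prod lam) := by
    conv_lhs => rw [← hc.map_eq]
    rw [integral_map hc.measurable.aemeasurable]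
    rw [hc.map_eq]; exact hDi.aestronglyMeasurable
  rw [h3]
  -- By Fubini almost every slice is integrable, and each such slice integral is the one-dimensional
  -- identity.
  refine (integral_prod _ h2).trans ?_
  refine integral_eq_zero_of_ae ?_
  filter_upwards [h1.prod_right_ae, h2.prod_right_ae] with ω hω1 hω2
  simp only [Function.comp_apply, hs, hD] at hω2
  simp only [Function.comp_apply, hs, hD, Pi.zero_apply]
  exact hlam _ (hF ω) hω1 hω2

open Classical in
/-- Flipping the momenta of all sites in `B`. -/
def flipOn (B : Set ℤ) (ω : Config) : Config :=
  fun x => if x ∈ B then ((ω x).1, -(ω x).2) else ω x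

theorem flipOn_singleton (x : ℤ) : flipOn {x} = flip x := by
  funext ω y
  by_cases h : y = x
  · subst h; simp [flipOn, flip]
  · simp [flipOn, flip, h]

theorem flipOn_flipOn (B : Set ℤ) (ω : Config) : flipOn B (flipOn B ω) = ω := by
  funext y
  by_cases h : y ∈ B <;> simp [flipOn, h]

theorem flipOn_flipOn_of_disjoint {A B : Set ℤ} (h : Disjoint A B) (ω : Config) :
    flipOn A (flipOn B ω) = flipOn (A ∪ B) ω := by
  funext y
  by_cases hA : y ∈ A
  · have hB : y ∉ B := Set.disjoint_left.1 h hA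
    simp [flipOn, hA, hB]
  · by_cases hB : y ∈ B <;> simp [flipOn, hA, hB]

theorem flipOn_shift (B : Set ℤ) (x : ℤ) (ω : Config) :
    flipOn B (shift x ω) = shift x (flipOn ((fun y => x + y) '' B) ω) := by
  funext y
  have h : x + y ∈ (fun y => x + y) '' B ↔ y ∈ B := (add_right_injective x).mem_set_image
  by_cases hy : y ∈ B
  · simp only [flipOn, shift, if_pos hy, if_pos (h.2 hy)]
  · simp only [flipOn, shift, if_neg hy, if_neg (mt h.1 hy)]

theorem shift_zero (ω : Config) : shift 0 ω = ω := by
  funext y; simp [shift]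

theorem measurable_flipOn (B : Set ℤ) : Measurable (flipOn B) := by
  classical
  refine measurable_pi_lambda _ fun i => ?_
  by_cases h : i ∈ B
  · simp only [flipOn, h, if_true]; fun_prop
  · simp only [flipOn, h, if_false]; fun_prop

/-- The map acts on each coordinate separately, so `B` may be infinite. Half-lines and the whole
lattice are needed for the spectral gap and for time reversal. -/
theorem measurePreserving_flipOn
    (hν : MeasurePreserving (fun v : ℝ × ℝ => (v.1, -v.2)) ν ν) (B : Set ℤ) :
    MeasurePreserving (flipOn B) (productMeasure ν) (productMeasure ν) := by
  classical
  refine ⟨measurable_flipOn B, ?_⟩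
  have h := Measure.infinitePi_map_pi (fun _ : ℤ => ν)
    (f := fun i v => if i ∈ B then ((v.1, -v.2) : ℝ × ℝ) else v) (fun i => by
      by_cases hi : i ∈ B <;> simp only [hi, if_true, if_false] <;> fun_prop)
  refine Eq.trans ?_ (h.trans ?_)
  · rfl
  · unfold productMeasure
    congr 1
    funext i
    by_cases hi : i ∈ B
    · simp only [hi, if_true]; exact hν.map_eq
    · simp only [hi, if_false]; exact Measure.map_id

end Product

/-! ### Admissible potentials and the site measure -/

/-- Chain potentials for which `V` and `V'` have all moments under the Gibbs measure. -/
structure Admissible (V : ℝ → ℝ) (T : ℝ) : Prop where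
  pot : IsChainPotential V
  pos : 0 < T
  pot_moments : ∀ n : ℕ, Integrable fun r => |V r| ^ n * Real.exp (-V r / T)
  force_moments : ∀ n : ℕ, Integrable fun r => |deriv V r| ^ n * Real.exp (-V r / T)

section Site

variable {V : ℝ → ℝ} {T : ℝ}

theorem IsChainPotential.differentiable (h : IsChainPotential V) : Differentiable ℝ V :=
  h.smooth.differentiable (by simp)

theorem IsChainPotential.contDiff_deriv (h : IsChainPotential V) :
    ContDiff ℝ ((⊤ : ℕ∞) : WithTop ℕ∞) (deriv V) :=
  (contDiff_infty_iff_deriv.1 h.smooth).2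

theorem IsChainPotential.differentiable_deriv (h : IsChainPotential V) :
    Differentiable ℝ (deriv V) := h.contDiff_deriv.differentiable (by simp)

theorem IsChainPotential.contDiff_deriv_deriv (h : IsChainPotential V) :
    ContDiff ℝ ((⊤ : ℕ∞) : WithTop ℕ∞) (deriv (deriv V)) :=
  (contDiff_infty_iff_deriv.1 h.contDiff_deriv).2

theorem Admissible.integrable_exp (h : Admissible V T) :
    Integrable fun r => Real.exp (-V r / T) := by
  simpa using h.pot_moments 0

/-- The law of a single interparticle distance. -/
def distanceMeasure (V : ℝ → ℝ) (T : ℝ) : Measure ℝ := volume.tilted fun r => -V r / T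

theorem Admissible.isProbabilityMeasure_distance (h : Admissible V T) :
    IsProbabilityMeasure (distanceMeasure V T) :=
  isProbabilityMeasure_tilted h.integrable_exp

theorem Admissible.isProbabilityMeasure (h : Admissible V T) :
    IsProbabilityMeasure (siteMeasure V T) := by
  have := h.isProbabilityMeasure_distance
  unfold distanceMeasure at this
  unfold siteMeasure
  infer_instance

theorem Admissible.integrable_distance_iff (h : Admissible V T) {g : ℝ → ℝ} :
    Integrable g (distanceMeasure V T) ↔ Integrable fun r => g r * Real.exp (-V r / T) := by
  rw [distanceMeasure, integrable_tilted_iff h.integrable_exp]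
  simp [mul_comm]

theorem temperate_gaussian : Temperate (gaussianReal 0 T.toNNReal) fun p => p := by
  refine ⟨measurable_id, fun n => ?_⟩
  rcases Nat.eq_zero_or_pos n with rfl | hn
  · simp
  have h := memLp_id_gaussianReal' (μ := 0) (v := T.toNNReal) (n : ENNReal) (by simp)
  have h2 := h.integrable_norm_pow (by omega)
  simpa using h2

theorem Admissible.temperate_pot (h : Admissible V T) : Temperate (distanceMeasure V T) V :=
  ⟨h.pot.smooth.continuous.measurable, fun n => h.integrable_distance_iff.2 (h.pot_moments n)⟩

theorem Admissible.temperate_force (h : Admissible V T) :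
    Temperate (distanceMeasure V T) (deriv V) :=
  ⟨measurable_deriv V, fun n => h.integrable_distance_iff.2 (h.force_moments n)⟩

theorem Admissible.measurePreserving_fst (h : Admissible V T) :
    MeasurePreserving Prod.fst (siteMeasure V T) (distanceMeasure V T) := by
  have := h.isProbabilityMeasure_distance
  unfold siteMeasure
  exact MeasureTheory.measurePreserving_fst

theorem Admissible.measurePreserving_snd (h : Admissible V T) :
    MeasurePreserving Prod.snd (siteMeasure V T) (gaussianReal 0 T.toNNReal) := by
  have := h.isProbabilityMeasure_distance
  unfold distanceMeasure at this
  unfold siteMeasure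
  exact MeasureTheory.measurePreserving_snd

theorem Admissible.measurePreserving_neg_snd (h : Admissible V T) :
    MeasurePreserving (fun v : ℝ × ℝ => (v.1, -v.2)) (siteMeasure V T) (siteMeasure V T) := by
  have := h.isProbabilityMeasure_distance
  unfold distanceMeasure at this
  unfold siteMeasure
  refine (MeasurePreserving.id _).prod ⟨measurable_neg, ?_⟩
  have := gaussianReal_map_neg (μ := 0) (v := T.toNNReal)
  simpa using this

end Site

/-! ### Coordinate derivatives -/

/-- The coordinate `r_x` (for `d = false`) or `p_x` (for `d = true`). -/
def coord (d : Bool) (x : ℤ) (ω : Config) : ℝ := if d then (ω x).2 else (ω x).1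

/-- The configuration `ω` with one coordinate at `x` replaced by `t`. -/
def line (d : Bool) (x : ℤ) (ω : Config) (t : ℝ) : Config :=
  Function.update ω x (if d then ((ω x).1, t) else (t, (ω x).2))

/-- The partial derivative in the coordinate `coord d x`. -/
def pd (d : Bool) (x : ℤ) (f : Config → ℝ) (ω : Config) : ℝ :=
  deriv (fun t => f (line d x ω t)) (coord d x ω)

theorem partialR_eq_pd : partialR = pd false := rfl

theorem partialP_eq_pd : partialP = pd true := rfl

@[simp] theorem coord_line (d : Bool) (x : ℤ) (ω : Config) (t : ℝ) :
    coord d x (line d x ω t) = t := by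
  cases d <;> simp [coord, line]

theorem coord_line_of_ne (d d' : Bool) {x y : ℤ} (h : y ≠ x) (ω : Config) (t : ℝ) :
    coord d' y (line d x ω t) = coord d' y ω := by
  cases d <;> cases d' <;> simp [coord, line, h]

theorem coord_line_of_dir_ne {d d' : Bool} (h : d' ≠ d) (x y : ℤ) (ω : Config) (t : ℝ) :
    coord d' y (line d x ω t) = coord d' y ω := by
  by_cases hy : y = x
  · subst hy
    cases d <;> cases d' <;> simp_all [coord, line]
  · exact coord_line_of_ne d d' hy ω t

@[simp] theorem line_line (d : Bool) (x : ℤ) (ω : Config) (s t : ℝ) :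
    line d x (line d x ω s) t = line d x ω t := by
  cases d <;> simp [line]

@[simp] theorem line_coord (d : Bool) (x : ℤ) (ω : Config) : line d x ω (coord d x ω) = ω := by
  cases d <;> simp [line, coord]

theorem pd_line (d : Bool) (x : ℤ) (f : Config → ℝ) (ω : Config) (t : ℝ) :
    pd d x f (line d x ω t) = deriv (fun s => f (line d x ω s)) t := by
  simp [pd]

theorem line_shift (d : Bool) (x y : ℤ) (ω : Config) (t : ℝ) :
    line d y (shift x ω) t = shift x (line d (x + y) ω t) := by
  funext z
  by_cases h : z = y
  · subst h; cases d <;> simp [line, shift]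
  · simp [line, shift, h]

theorem coord_shift (d : Bool) (x y : ℤ) (ω : Config) :
    coord d y (shift x ω) = coord d (x + y) ω := rfl

theorem pd_comp_shift (d : Bool) (x y : ℤ) (f : Config → ℝ) (ω : Config) :
    pd d (x + y) (fun η => f (shift x η)) ω = pd d y f (shift x ω) := by
  simp only [pd, line_shift, coord_shift]

/-- Reversal of all momenta. -/
def reverse : Config → Config := flipOn Set.univ

theorem reverse_apply (ω : Config) (x : ℤ) : reverse ω x = ((ω x).1, -(ω x).2) := by
  simp [reverse, flipOn]

theorem reverse_shift (x : ℤ) (ω : Config) : reverse (shift x ω) = shift x (reverse ω) := by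
  funext y; simp [reverse_apply, shift]

theorem line_true_reverse (x : ℤ) (ω : Config) (t : ℝ) :
    reverse (line true x ω t) = line true x (reverse ω) (-t) := by
  funext y
  by_cases h : y = x
  · subst h; simp [line, reverse_apply]
  · simp [line, reverse_apply, h]

theorem line_false_reverse (x : ℤ) (ω : Config) (t : ℝ) :
    reverse (line false x ω t) = line false x (reverse ω) t := by
  funext y
  by_cases h : y = x
  · subst h; simp [line, reverse_apply]
  · simp [line, reverse_apply, h]

theorem coord_true_reverse (x : ℤ) (ω : Config) : coord true x (reverse ω) = -coord true x ω := by
  simp [coord, reverse_apply]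

theorem coord_false_reverse (x : ℤ) (ω : Config) : coord false x (reverse ω) = coord false x ω := by
  simp [coord, reverse_apply]

theorem pd_true_comp_reverse (x : ℤ) (f : Config → ℝ) (ω : Config) :
    pd true x (fun η => f (reverse η)) ω = -pd true x f (reverse ω) := by
  simp only [pd, line_true_reverse, coord_true_reverse]
  exact deriv_comp_neg (fun t => f (line true x (reverse ω) t)) _

theorem pd_false_comp_reverse (x : ℤ) (f : Config → ℝ) (ω : Config) :
    pd false x (fun η => f (reverse η)) ω = pd false x f (reverse ω) := by
  simp only [pd, line_false_reverse, coord_false_reverse]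

/-! ### Local functions -/

/-- Functions of the coordinates in `[-N, N]`. -/
def Loc (N : ℕ) (f : Config → ℝ) : Prop := DependsOn f (Set.Icc (-(N : ℤ)) N)

theorem Loc.mono {N M : ℕ} {f : Config → ℝ} (hf : Loc N f) (h : N ≤ M) : Loc M f :=
  fun ω η hω => hf fun i hi => hω i ⟨by have := hi.1; omega, by have := hi.2; omega⟩

theorem exists_loc_of_dependsOn {f : Config → ℝ} {s : Finset ℤ} (hf : DependsOn f (s : Set ℤ)) :
    ∃ N, Loc N f := by
  refine ⟨∑ i ∈ s, i.natAbs, fun ω η h => hf fun i hi => h i ?_⟩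
  have h1 := Finset.single_le_sum (f := fun i : ℤ => i.natAbs) (fun _ _ => Nat.zero_le _) hi
  constructor <;> omega

theorem Loc.dependsOn {N : ℕ} {f : Config → ℝ} (hf : Loc N f) :
    DependsOn f ((Finset.Icc (-(N : ℤ)) N : Finset ℤ) : Set ℤ) := by
  rw [Finset.coe_Icc]; exact hf

theorem Loc.comp_shift {N : ℕ} {f : Config → ℝ} (hf : Loc N f) (x : ℤ) :
    Loc (N + x.natAbs) fun ω => f (shift x ω) := fun ω η h => hf fun i hi => h (x + i) (by
  have := hi.1; have := hi.2; constructor <;> omega)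

theorem Loc.comp_flipOn {N : ℕ} {f : Config → ℝ} (hf : Loc N f) (B : Set ℤ) :
    Loc N fun ω => f (flipOn B ω) := fun ω η h => hf fun i hi => by
  simp only [flipOn, h i hi]

theorem Loc.add {N : ℕ} {f g : Config → ℝ} (hf : Loc N f) (hg : Loc N g) :
    Loc N fun ω => f ω + g ω := fun ω η h => by simp only [hf h, hg h]

theorem Loc.sub {N : ℕ} {f g : Config → ℝ} (hf : Loc N f) (hg : Loc N g) :
    Loc N fun ω => f ω - g ω := fun ω η h => by simp only [hf h, hg h]

theorem Loc.mul {N : ℕ} {f g : Config → ℝ} (hf : Loc N f) (hg : Loc N g) :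
    Loc N fun ω => f ω * g ω := fun ω η h => by simp only [hf h, hg h]

theorem Loc.const_mul {N : ℕ} {f : Config → ℝ} (c : ℝ) (hf : Loc N f) :
    Loc N fun ω => c * f ω := fun ω η h => by simp only [hf h]

theorem Loc.sum {N : ℕ} {ι : Type*} {f : ι → Config → ℝ} (s : Finset ι)
    (hf : ∀ i ∈ s, Loc N (f i)) : Loc N fun ω => ∑ i ∈ s, f i ω :=
  fun _ _ h => Finset.sum_congr rfl fun i hi => hf i hi h

theorem loc_coord {N : ℕ} (d : Bool) {x : ℤ} (hx : x ∈ Set.Icc (-(N : ℤ)) N) :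
    Loc N (coord d x) := fun ω η h => by simp only [coord, h x hx]

theorem Loc.comp_left {N : ℕ} {f : Config → ℝ} (g : ℝ → ℝ) (hf : Loc N f) :
    Loc N fun ω => g (f ω) := fun ω η h => by simp only [hf h]

theorem Loc.line_eq {N : ℕ} {f : Config → ℝ} (hf : Loc N f) (d : Bool) {x : ℤ}
    (hx : x ∉ Set.Icc (-(N : ℤ)) N) (ω : Config) (t : ℝ) : f (line d x ω t) = f ω :=
  hf fun i hi => by
    have : i ≠ x := fun h => hx (h ▸ hi)
    simp [line, this]

theorem Loc.pd_eq_zero {N : ℕ} {f : Config → ℝ} (hf : Loc N f) (d : Bool) {x : ℤ}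
    (hx : x ∉ Set.Icc (-(N : ℤ)) N) (ω : Config) : pd d x f ω = 0 := by
  simp [pd, hf.line_eq d hx]

theorem Loc.flipOn_eq {N : ℕ} {f : Config → ℝ} (hf : Loc N f) {B : Set ℤ}
    (hB : Disjoint B (Set.Icc (-(N : ℤ)) N)) (ω : Config) : f (flipOn B ω) = f ω :=
  hf fun i hi => by
    have : i ∉ B := fun h => Set.disjoint_left.1 hB h hi
    simp [flipOn, this]

theorem Loc.flip_eq {N : ℕ} {f : Config → ℝ} (hf : Loc N f) {x : ℤ}
    (hx : x ∉ Set.Icc (-(N : ℤ)) N) (ω : Config) : f (flip x ω) = f ω := by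
  rw [← flipOn_singleton]
  exact hf.flipOn_eq (Set.disjoint_singleton_left.2 hx) ω

theorem Loc.pd {N : ℕ} {f : Config → ℝ} (hf : Loc N f) (d : Bool) (x : ℤ) :
    Loc N (pd d x f) := by
  by_cases hx : x ∈ Set.Icc (-(N : ℤ)) N
  · intro ω η h
    have h1 : ∀ t, f (line d x ω t) = f (line d x η t) := fun t => hf fun i hi => by
      by_cases hi' : i = x
      · subst hi'; simp [line, h i hi]
      · simp [line, hi', h i hi]
    have h2 : coord d x ω = coord d x η := by simp only [coord, h x hx]
    simp only [Chain.pd, h1, h2]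
  · intro ω η _
    rw [hf.pd_eq_zero d hx, hf.pd_eq_zero d hx]

/-! ### Regular functions -/

/-- Tame functions, differentiable along the coordinates `coord d x`, with tame derivatives. -/
structure Reg (μ : Measure Config) (d : Bool) (k : Config → ℝ) : Prop where
  tame : Tame μ k
  diff : ∀ x ω, Differentiable ℝ fun t => k (line d x ω t)
  tame_pd : ∀ x, Tame μ (pd d x k)

/-- Temperate functions, differentiable along the coordinates `coord d x`, with temperate
derivatives. -/
structure TReg (μ : Measure Config) (d : Bool) (f : Config → ℝ) : Prop where
  temp : Temperate μ f
  diff : ∀ x ω, Differentiable ℝ fun t => f (line d x ω t)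
  temp_pd : ∀ x, Temperate μ (pd d x f)

section Regular

variable {μ : Measure Config} {d : Bool} {f g k : Config → ℝ}

theorem TReg.reg (hf : TReg μ d f) : Reg μ d f :=
  ⟨hf.temp.tame, hf.diff, fun x => (hf.temp_pd x).tame⟩

theorem pd_mul (hf : ∀ x ω, Differentiable ℝ fun t => f (line d x ω t))
    (hg : ∀ x ω, Differentiable ℝ fun t => g (line d x ω t)) (x : ℤ) (ω : Config) :
    pd d x (fun η => f η * g η) ω = pd d x f ω * g ω + f ω * pd d x g ω := by
  have := deriv_fun_mul (hf x ω (coord d x ω)) (hg x ω (coord d x ω))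
  simpa [pd] using this

theorem pd_add (hf : ∀ x ω, Differentiable ℝ fun t => f (line d x ω t))
    (hg : ∀ x ω, Differentiable ℝ fun t => g (line d x ω t)) (x : ℤ) (ω : Config) :
    pd d x (fun η => f η + g η) ω = pd d x f ω + pd d x g ω :=
  deriv_fun_add (hf x ω (coord d x ω)) (hg x ω (coord d x ω))

theorem pd_const_mul (c : ℝ) (f : Config → ℝ) (x : ℤ) (ω : Config) :
    pd d x (fun η => c * f η) ω = c * pd d x f ω := by
  simp [pd]

theorem pd_const (c : ℝ) (x : ℤ) (ω : Config) : pd d x (fun _ => c) ω = 0 := by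
  simp [pd]

theorem TReg.mul_reg (hf : TReg μ d f) (hk : Reg μ d k) : Reg μ d fun ω => f ω * k ω := by
  refine ⟨hf.temp.mul_tame hk.tame, fun x ω => (hf.diff x ω).mul (hk.diff x ω), fun x => ?_⟩
  rw [show pd d x (fun ω => f ω * k ω) = fun ω => pd d x f ω * k ω + f ω * pd d x k ω from
    funext (pd_mul hf.diff hk.diff x)]
  exact ((hf.temp_pd x).mul_tame hk.tame).add (hf.temp.mul_tame (hk.tame_pd x))

theorem TReg.mul (hf : TReg μ d f) (hg : TReg μ d g) : TReg μ d fun ω => f ω * g ω := by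
  refine ⟨hf.temp.mul hg.temp, fun x ω => (hf.diff x ω).mul (hg.diff x ω), fun x => ?_⟩
  rw [show pd d x (fun ω => f ω * g ω) = fun ω => pd d x f ω * g ω + f ω * pd d x g ω from
    funext (pd_mul hf.diff hg.diff x)]
  exact ((hf.temp_pd x).mul hg.temp).add (hf.temp.mul (hg.temp_pd x))

theorem TReg.add (hf : TReg μ d f) (hg : TReg μ d g) : TReg μ d fun ω => f ω + g ω := by
  refine ⟨hf.temp.add hg.temp, fun x ω => (hf.diff x ω).add (hg.diff x ω), fun x => ?_⟩
  rw [show pd d x (fun ω => f ω + g ω) = fun ω => pd d x f ω + pd d x g ω from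
    funext (pd_add hf.diff hg.diff x)]
  exact (hf.temp_pd x).add (hg.temp_pd x)

variable [IsFiniteMeasure μ]

theorem TReg.const (c : ℝ) : TReg μ d fun _ => c :=
  ⟨Temperate.const c, fun x ω => differentiable_const c, fun x => by
    rw [show pd d x (fun _ => c) = fun _ => 0 from funext (pd_const c x)]
    exact Temperate.const 0⟩

theorem TReg.const_mul (c : ℝ) (hf : TReg μ d f) : TReg μ d fun ω => c * f ω :=
  (TReg.const c).mul hf

theorem TReg.sub (hf : TReg μ d f) (hg : TReg μ d g) : TReg μ d fun ω => f ω - g ω := by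
  simpa [sub_eq_add_neg] using hf.add (hg.const_mul (-1))

end Regular

theorem TReg.comp_shift {ν : Measure (ℝ × ℝ)} [IsProbabilityMeasure ν] {d : Bool}
    {f : Config → ℝ} (hf : TReg (productMeasure ν) d f) (x : ℤ) :
    TReg (productMeasure ν) d fun ω => f (shift x ω) := by
  refine ⟨hf.temp.comp (measurePreserving_shift x), fun y ω => ?_, fun y => ?_⟩
  · have := hf.diff (y - x) (shift x ω)
    simpa [line_shift] using this
  · have h : pd d y (fun ω => f (shift x ω)) = fun ω => pd d (y - x) f (shift x ω) := by
      funext ω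
      rw [← pd_comp_shift, add_sub_cancel]
    rw [h]
    exact (hf.temp_pd _).comp (measurePreserving_shift x)

theorem shift_neg_shift (x : ℤ) (ω : Config) : shift (-x) (shift x ω) = ω := by
  rw [shift_shift, neg_add_cancel, shift_zero]

theorem Tame.comp_shift {ν : Measure (ℝ × ℝ)} [IsProbabilityMeasure ν]
    {f : Config → ℝ} (hf : Tame (productMeasure ν) f) (x : ℤ) :
    Tame (productMeasure ν) fun ω => f (shift x ω) :=
  hf.comp (measurePreserving_shift x) (measurePreserving_shift (-x)) (shift_neg_shift x)

theorem Reg.comp_shift {ν : Measure (ℝ × ℝ)} [IsProbabilityMeasure ν] {d : Bool}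
    {f : Config → ℝ} (hf : Reg (productMeasure ν) d f) (x : ℤ) :
    Reg (productMeasure ν) d fun ω => f (shift x ω) := by
  refine ⟨hf.tame.comp_shift x, fun y ω => ?_, fun y => ?_⟩
  · have := hf.diff (y - x) (shift x ω)
    simpa [line_shift] using this
  · have h : pd d y (fun ω => f (shift x ω)) = fun ω => pd d (y - x) f (shift x ω) := by
      funext ω
      rw [← pd_comp_shift, add_sub_cancel]
    rw [h]
    exact (hf.tame_pd _).comp_shift x

theorem TReg.comp_reverse {ν : Measure (ℝ × ℝ)} [IsProbabilityMeasure ν]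
    (hν : MeasurePreserving (fun v : ℝ × ℝ => (v.1, -v.2)) ν ν) {d : Bool}
    {f : Config → ℝ} (hf : TReg (productMeasure ν) d f) :
    TReg (productMeasure ν) d fun ω => f (reverse ω) := by
  have hR : MeasurePreserving reverse (productMeasure ν) (productMeasure ν) :=
    measurePreserving_flipOn hν _
  cases d with
  | false =>
    refine ⟨hf.temp.comp hR, fun y ω => ?_, fun y => ?_⟩
    · simpa [line_false_reverse] using hf.diff y (reverse ω)
    · rw [show pd false y (fun ω => f (reverse ω)) = fun ω => pd false y f (reverse ω) from
        funext (pd_false_comp_reverse y f)]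
      exact (hf.temp_pd y).comp hR
  | true =>
    refine ⟨hf.temp.comp hR, fun y ω => ?_, fun y => ?_⟩
    · simpa [line_true_reverse, Function.comp_def] using
        (hf.diff y (reverse ω)).comp differentiable_neg
    · rw [show pd true y (fun ω => f (reverse ω)) = fun ω => -pd true y f (reverse ω) from
        funext (pd_true_comp_reverse y f)]
      exact ((hf.temp_pd y).comp hR).neg

/-! ### Integration by parts on configurations -/

/-- The logarithmic derivative of the Gibbs density in the coordinate `coord d x`, with the
opposite sign. -/
def score (V : ℝ → ℝ) (T : ℝ) (d : Bool) (x : ℤ) (ω : Config) : ℝ :=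
  (if d then coord true x ω else deriv V (coord false x ω)) / T

section Ibp

variable {V : ℝ → ℝ} {T : ℝ}

theorem Admissible.temperate_coord (h : Admissible V T) (x : ℤ) :
    Temperate (productMeasure (siteMeasure V T)) (coord true x) := by
  have := h.isProbabilityMeasure
  exact (temperate_gaussian.comp h.measurePreserving_snd).comp (measurePreserving_eval x)

theorem Admissible.temperate_comp_distance (h : Admissible V T) {g : ℝ → ℝ}
    (hg : Temperate (distanceMeasure V T) g) (x : ℤ) :
    Temperate (productMeasure (siteMeasure V T)) fun ω => g (coord false x ω) := by
  have := h.isProbabilityMeasure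
  exact (hg.comp h.measurePreserving_fst).comp (measurePreserving_eval x)

theorem Admissible.temperate_score (h : Admissible V T) (d : Bool) (x : ℤ) :
    Temperate (productMeasure (siteMeasure V T)) (score V T d x) := by
  have := h.isProbabilityMeasure
  cases d
  · convert! (h.temperate_comp_distance h.temperate_force x).const_mul T⁻¹ using 2
    simp [score, div_eq_inv_mul]
  · convert! (h.temperate_coord x).const_mul T⁻¹ using 2
    simp [score, div_eq_inv_mul]

/-- Integration by parts: `E[∂F] = E[score · F]`. -/
theorem Admissible.integral_pd (h : Admissible V T) {d : Bool} {F : Config → ℝ}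
    (hF : Reg (productMeasure (siteMeasure V T)) d F) (x : ℤ) :
    ∫ ω, pd d x F ω ∂productMeasure (siteMeasure V T) =
      ∫ ω, score V T d x ω * F ω ∂productMeasure (siteMeasure V T) := by
  have := h.isProbabilityMeasure
  have hpr := h.isProbabilityMeasure_distance
  have hi1 := (hF.tame_pd x).integrable
  have hi2 := hF.tame.pairing _ (h.temperate_score d x)
  rw [← sub_eq_zero, ← integral_sub hi1 hi2]
  unfold distanceMeasure at hpr
  cases d with
  | true =>
    -- Resampling the momentum while keeping the distance preserves the site measure, since the two
    -- are independent.
    have hΦ : MeasurePreserving (fun z : (ℝ × ℝ) × ℝ => (z.1.1, z.2))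
        ((siteMeasure V T).prod (gaussianReal 0 T.toNNReal)) (siteMeasure V T) :=
      h.measurePreserving_fst.prod (MeasurePreserving.id _)
    refine integral_deriv_sub_eq_zero_of_resample (s' := fun t => t / T)
      (measurePreserving_update_comp hΦ x) (fun ω t => ?_) (fun ω => ?_) (fun ω t => ?_)
      hF.tame.integrable (hi1.sub hi2)
      fun g hg h1 h2 => integral_deriv_sub_eq_zero_gaussian h.pos hg h1 h2
    · simp [score, coord]
    · exact hF.diff x ω
    · exact pd_line true x F ω t
  | false =>
    have hΦ : MeasurePreserving (fun z : (ℝ × ℝ) × ℝ => (z.2, z.1.2))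
        ((siteMeasure V T).prod (volume.tilted fun r => -V r / T)) (siteMeasure V T) :=
      (Measure.measurePreserving_swap (μ := gaussianReal 0 T.toNNReal)
        (ν := volume.tilted fun r => -V r / T)).comp
        (h.measurePreserving_snd.prod (MeasurePreserving.id _))
    refine integral_deriv_sub_eq_zero_of_resample (s' := fun t => deriv V t / T)
      (measurePreserving_update_comp hΦ x) (fun ω t => ?_) (fun ω => ?_) (fun ω t => ?_)
      hF.tame.integrable (hi1.sub hi2)
      fun g hg h1 h2 => integral_deriv_sub_eq_zero_tilted h.pot.differentiable hg h1 h2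
    · simp [score, coord]
    · exact hF.diff x ω
    · exact pd_line false x F ω t

/-- Integration by parts for the vector field `a ∂`, with `a` independent of the coordinate. -/
theorem Admissible.integral_mul_pd_mul (h : Admissible V T) {d : Bool} {a f k : Config → ℝ}
    (ha : TReg (productMeasure (siteMeasure V T)) d a)
    (hf : TReg (productMeasure (siteMeasure V T)) d f)
    (hk : Reg (productMeasure (siteMeasure V T)) d k) (x : ℤ)
    (ha0 : ∀ ω, pd d x a ω = 0) :
    ∫ ω, a ω * pd d x f ω * k ω ∂productMeasure (siteMeasure V T) =
      ∫ ω, score V T d x ω * (a ω * f ω) * k ω ∂productMeasure (siteMeasure V T) -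
      ∫ ω, f ω * (a ω * pd d x k ω) ∂productMeasure (siteMeasure V T) := by
  have := h.isProbabilityMeasure
  have h1 := h.integral_pd ((ha.mul hf).mul_reg hk) x
  have h2 : ∀ ω, pd d x (fun ω => a ω * f ω * k ω) ω =
      a ω * pd d x f ω * k ω + f ω * (a ω * pd d x k ω) := fun ω => by
    rw [pd_mul (ha.mul hf).diff hk.diff, pd_mul ha.diff hf.diff, ha0]; ring
  simp only [h2] at h1
  rw [integral_add] at h1
  · rw [eq_sub_iff_add_eq, h1]
    simp only [mul_assoc]
  · exact ((ha.temp.mul (hf.temp_pd x)).mul_tame hk.tame).integrable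
  · exact (hf.temp.mul_tame (ha.temp.mul_tame (hk.tame_pd x))).integrable

end Ibp

/-- The Gibbs measure of the infinite chain. -/
abbrev gibbs (V : ℝ → ℝ) (T : ℝ) : Measure Config := productMeasure (siteMeasure V T)

/-! ### Regularity of test functions -/

/-- Local functions which can be differentiated twice in the momenta. -/
structure MomTest (μ : Measure Config) (f : Config → ℝ) : Prop where
  loc : ∃ N, Loc N f
  mom : TReg μ true f
  mom2 : ∀ x, TReg μ true (pd true x f)

/-- The regularity of test functions needed to integrate by parts twice. -/
structure TestLike (μ : Measure Config) (f : Config → ℝ) : Prop extends MomTest μ f where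
  pos : TReg μ false f

section Cylinder

variable {s : Finset ℤ}

theorem hasDerivAt_cylinder {F : (s → ℝ × ℝ) → ℝ} (hF : Differentiable ℝ F)
    (d : Bool) (x : ℤ) (ω : Config) (t : ℝ) :
    HasDerivAt (fun t => F fun i => line d x ω t i)
      (if hx : x ∈ s then fderiv ℝ F (fun i => line d x ω t i)
        (Pi.single ⟨x, hx⟩ (if d then (0, 1) else (1, 0))) else 0) t := by
  classical
  by_cases hx : x ∈ s
  · rw [dif_pos hx]
    have hline : ∀ u, (fun i : s => line d x ω u i) = (fun i : s => ω i) +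
        (u - coord d x ω) • (Pi.single ⟨x, hx⟩ (if d then (0, 1) else (1, 0)) :
          s → ℝ × ℝ) := by
      intro u
      funext i
      by_cases hi : i = ⟨x, hx⟩
      · subst hi
        cases d <;> simp [line, coord, Prod.ext_iff]
      · have : (i : ℤ) ≠ x := fun h => hi (Subtype.ext h)
        simp [line, this, hi]
    have h1 : HasDerivAt (fun u => (fun i : s => ω i) +
        (u - coord d x ω) • (Pi.single ⟨x, hx⟩ (if d then (0, 1) else (1, 0)) :
          s → ℝ × ℝ)) (Pi.single ⟨x, hx⟩ (if d then (0, 1) else (1, 0))) t := by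
      have := (((hasDerivAt_id t).sub_const (coord d x ω)).smul_const
        (Pi.single ⟨x, hx⟩ (if d then (0, 1) else (1, 0)) : s → ℝ × ℝ)).const_add
        (fun i : s => ω i)
      simpa using this
    simp only [hline]
    exact (hF _).hasFDerivAt.comp_hasDerivAt t h1
  · rw [dif_neg hx]
    have hline : ∀ u, (fun i : s => line d x ω u i) = fun i : s => ω i := by
      intro u
      funext i
      have : (i : ℤ) ≠ x := fun h => hx (h ▸ i.2)
      simp [line, this]
    simp only [hline]
    exact hasDerivAt_const t _

theorem temperate_cylinder {μ : Measure Config} [IsFiniteMeasure μ] {F : (s → ℝ × ℝ) → ℝ}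
    (hF : Continuous F) (hc : HasCompactSupport F) : Temperate μ fun ω => F fun i => ω i := by
  obtain ⟨C, hC⟩ := hc.exists_bound_of_continuous hF
  exact Temperate.of_bound (hF.measurable.comp (by fun_prop)) C fun ω => hC _

theorem exists_pd_cylinder {n : ℕ} {F : (s → ℝ × ℝ) → ℝ} (hF : ContDiff ℝ (n + 1 : ℕ) F)
    (hc : HasCompactSupport F) (d : Bool) (x : ℤ) :
    ∃ G : (s → ℝ × ℝ) → ℝ, ContDiff ℝ n G ∧ HasCompactSupport G ∧
      pd d x (fun ω => F fun i => ω i) = fun ω => G fun i => ω i := by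
  classical
  have hd : Differentiable ℝ F := hF.differentiable (by simp)
  have hpd : ∀ ω, pd d x (fun ω => F fun i => ω i) ω = if hx : x ∈ s then
      fderiv ℝ F (fun i => ω i) (Pi.single ⟨x, hx⟩ (if d then (0, 1) else (1, 0))) else 0 := by
    intro ω
    have h := (hasDerivAt_cylinder hd d x ω (coord d x ω)).deriv
    rwa [line_coord] at h
  by_cases hx : x ∈ s
  · refine ⟨fun v => fderiv ℝ F v (Pi.single ⟨x, hx⟩ (if d then (0, 1) else (1, 0))), ?_, ?_, ?_⟩
    · have : ContDiff ℝ n (fderiv ℝ F) := hF.fderiv_right (by norm_cast)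
      exact this.clm_apply contDiff_const
    · exact hc.fderiv_apply (𝕜 := ℝ) _
    · funext ω; rw [hpd, dif_pos hx]
  · refine ⟨fun _ => 0, contDiff_const, HasCompactSupport.zero, ?_⟩
    funext ω; rw [hpd, dif_neg hx]

theorem tReg_cylinder {μ : Measure Config} [IsFiniteMeasure μ] {F : (s → ℝ × ℝ) → ℝ}
    (hF : ContDiff ℝ 1 F) (hc : HasCompactSupport F) (d : Bool) :
    TReg μ d fun ω => F fun i => ω i := by
  refine ⟨temperate_cylinder hF.continuous hc, fun x ω t =>
    (hasDerivAt_cylinder (hF.differentiable (by simp)) d x ω t).differentiableAt, fun x => ?_⟩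
  obtain ⟨G, hG, hGc, h⟩ := exists_pd_cylinder (n := 0) (by simpa using hF) hc d x
  rw [h]
  exact temperate_cylinder hG.continuous hGc

end Cylinder

theorem TestLike.add {μ : Measure Config} {f g : Config → ℝ} (hf : TestLike μ f)
    (hg : TestLike μ g) : TestLike μ fun ω => f ω + g ω := by
  obtain ⟨N, hN⟩ := hf.loc
  obtain ⟨M, hM⟩ := hg.loc
  refine ⟨⟨⟨max N M, (hN.mono (le_max_left _ _)).add (hM.mono (le_max_right _ _))⟩,
    hf.mom.add hg.mom, fun x => ?_⟩, hf.pos.add hg.pos⟩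
  rw [show pd true x (fun ω => f ω + g ω) = fun ω => pd true x f ω + pd true x g ω from
    funext (pd_add hf.mom.diff hg.mom.diff x)]
  exact (hf.mom2 x).add (hg.mom2 x)

theorem TestLike.const_mul {μ : Measure Config} [IsFiniteMeasure μ] {f : Config → ℝ} (c : ℝ)
    (hf : TestLike μ f) : TestLike μ fun ω => c * f ω := by
  obtain ⟨N, hN⟩ := hf.loc
  refine ⟨⟨⟨N, hN.const_mul c⟩, hf.mom.const_mul c, fun x => ?_⟩, hf.pos.const_mul c⟩
  rw [show pd true x (fun ω => c * f ω) = fun ω => c * pd true x f ω from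
    funext (pd_const_mul c f x)]
  exact (hf.mom2 x).const_mul c

/-- A compactly supported `C²` function and its derivatives up to order two are bounded, hence have
all moments. Compact support is lost under sums of functions of different coordinates, whereas the
moment conditions are stable under linear combinations. -/
theorem testLike_of_mem_testFunctions {μ : Measure Config} [IsFiniteMeasure μ] {f : Config → ℝ}
    (hf : f ∈ testFunctions) : TestLike μ f := by
  refine Submodule.span_induction (p := fun f _ => TestLike μ f) ?_ ?_
    (fun f g _ _ hf hg => hf.add hg) (fun c f _ hf => hf.const_mul c) hf
  · rintro _ ⟨s, F, hF, hc, rfl⟩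
    refine ⟨⟨exists_loc_of_dependsOn (s := s) fun ω η h => ?_,
      tReg_cylinder (hF.of_le (by norm_num)) hc true, fun x => ?_⟩,
      tReg_cylinder (hF.of_le (by norm_num)) hc false⟩
    · exact congrArg F (funext fun i => h i i.2)
    · obtain ⟨G, hG, hGc, h⟩ := exists_pd_cylinder (n := 1) (by simpa using hF) hc true x
      rw [h]
      exact tReg_cylinder (by simpa using hG) hGc true
  · have h0 : ∀ d, TReg μ d (0 : Config → ℝ) := fun d => TReg.const 0
    refine ⟨⟨⟨0, fun _ _ _ => rfl⟩, h0 _, fun x => ?_⟩, h0 _⟩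
    have : pd true x (0 : Config → ℝ) = fun _ => 0 := funext (pd_const 0 x)
    rw [this]
    exact TReg.const 0

theorem pd_comp_shift_fun (d : Bool) (x y : ℤ) (f : Config → ℝ) :
    pd d y (fun ω => f (shift x ω)) = fun ω => pd d (y - x) f (shift x ω) := by
  funext ω
  rw [← pd_comp_shift, add_sub_cancel]

theorem MomTest.comp_shift {ν : Measure (ℝ × ℝ)} [IsProbabilityMeasure ν] {f : Config → ℝ}
    (hf : MomTest (productMeasure ν) f) (x : ℤ) :
    MomTest (productMeasure ν) fun ω => f (shift x ω) := by
  obtain ⟨N, hN⟩ := hf.loc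
  refine ⟨⟨_, hN.comp_shift x⟩, hf.mom.comp_shift x, fun y => ?_⟩
  rw [pd_comp_shift_fun]
  exact (hf.mom2 _).comp_shift x

theorem TestLike.comp_reverse {ν : Measure (ℝ × ℝ)} [IsProbabilityMeasure ν]
    (hν : MeasurePreserving (fun v : ℝ × ℝ => (v.1, -v.2)) ν ν) {f : Config → ℝ}
    (hf : TestLike (productMeasure ν) f) :
    TestLike (productMeasure ν) fun ω => f (reverse ω) := by
  obtain ⟨N, hN⟩ := hf.loc
  refine ⟨⟨⟨_, hN.comp_flipOn _⟩, hf.mom.comp_reverse hν, fun y => ?_⟩, hf.pos.comp_reverse hν⟩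
  rw [show pd true y (fun ω => f (reverse ω)) = fun ω => -1 * pd true y f (reverse ω) from
    funext fun ω => by rw [pd_true_comp_reverse, neg_one_mul]]
  exact ((hf.mom2 y).comp_reverse hν).const_mul (-1)

/-! ### Coordinates as regular functions -/

theorem pd_eq_zero_of_line {d : Bool} {x : ℤ} {a : Config → ℝ}
    (h : ∀ ω t, a (line d x ω t) = a ω) (ω : Config) : pd d x a ω = 0 := by
  simp [pd, h]

theorem tReg_of_line {μ : Measure Config} [IsFiniteMeasure μ] {d : Bool} {a : Config → ℝ}
    (ha : Temperate μ a) (h : ∀ x ω t, a (line d x ω t) = a ω) : TReg μ d a := by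
  refine ⟨ha, fun x ω => by simp [h], fun x => ?_⟩
  rw [show pd d x a = fun _ => 0 from funext fun ω => pd_eq_zero_of_line (h x) ω]
  exact Temperate.const 0

theorem pd_coord_comp_self {d : Bool} {g : ℝ → ℝ} (x : ℤ) (ω : Config) :
    pd d x (fun ω => g (coord d x ω)) ω = deriv g (coord d x ω) := by
  simp [pd]

theorem pd_coord_comp_of_ne {d : Bool} {g : ℝ → ℝ} {x y : ℤ} (h : y ≠ x) (ω : Config) :
    pd d x (fun ω => g (coord d y ω)) ω = 0 := by
  simp [pd, coord_line_of_ne d d h]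

theorem differentiable_coord_comp {d : Bool} {g : ℝ → ℝ} (hg : Differentiable ℝ g) (x y : ℤ)
    (ω : Config) : Differentiable ℝ fun t => g (coord d y (line d x ω t)) := by
  by_cases h : y = x
  · subst h; simpa using hg
  · simp [coord_line_of_ne d d h]

@[simp] theorem pd_coord_self (x : ℤ) (ω : Config) : pd true x (coord true x) ω = 1 := by
  simp [pd]

theorem pd_coord_of_ne {x y : ℤ} (h : y ≠ x) (ω : Config) : pd true x (coord true y) ω = 0 :=
  pd_coord_comp_of_ne (g := fun t => t) h ω

section Coordinates

variable {V : ℝ → ℝ} {T : ℝ}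

theorem Admissible.tReg_coord (h : Admissible V T) (d : Bool) (y : ℤ) :
    TReg (gibbs V T) d (coord true y) := by
  have := h.isProbabilityMeasure
  cases d with
  | false =>
    exact tReg_of_line (h.temperate_coord y) fun x ω t =>
      coord_line_of_dir_ne (by simp) x y ω t
  | true =>
    refine ⟨h.temperate_coord y, fun x ω =>
      differentiable_coord_comp (g := fun t => t) differentiable_id x y ω, fun x => ?_⟩
    by_cases hxy : y = x
    · subst hxy
      rw [show pd true y (coord true y) = fun _ => 1 from funext (pd_coord_self y)]
      exact Temperate.const 1
    · rw [show pd true x (coord true y) = fun _ => 0 from funext (pd_coord_of_ne hxy)]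
      exact Temperate.const 0

theorem Admissible.tReg_distance_mom (h : Admissible V T) {g : ℝ → ℝ}
    (hg : Temperate (distanceMeasure V T) g) (y : ℤ) :
    TReg (gibbs V T) true fun ω => g (coord false y ω) := by
  have := h.isProbabilityMeasure
  exact tReg_of_line (h.temperate_comp_distance hg y) fun x ω t => by
    rw [coord_line_of_dir_ne (by simp)]

theorem Admissible.tame_comp_distance (h : Admissible V T) {g : ℝ → ℝ} (hm : Measurable g)
    (hg : MemLp g 2 (distanceMeasure V T)) (x : ℤ) :
    Tame (gibbs V T) fun ω => g (coord false x ω) := by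
  have := h.isProbabilityMeasure
  have hmp := h.measurePreserving_fst.comp (measurePreserving_eval (ν := siteMeasure V T) x)
  exact tame_of_memLp_two (hm.comp hmp.measurable) (hg.comp_measurePreserving hmp)

theorem Admissible.reg_distance_pos (h : Admissible V T) {g : ℝ → ℝ} (hd : Differentiable ℝ g)
    (hg : MemLp g 2 (distanceMeasure V T)) (hg' : MemLp (deriv g) 2 (distanceMeasure V T))
    (y : ℤ) : Reg (gibbs V T) false fun ω => g (coord false y ω) := by
  have := h.isProbabilityMeasure
  refine ⟨h.tame_comp_distance hd.continuous.measurable hg y,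
    fun x ω => differentiable_coord_comp hd x y ω, fun x => ?_⟩
  by_cases hxy : y = x
  · subst hxy
    rw [show pd false y (fun ω => g (coord false y ω)) = fun ω => deriv g (coord false y ω) from
      funext (pd_coord_comp_self y)]
    exact h.tame_comp_distance (measurable_deriv g) hg' y
  · rw [show pd false x (fun ω => g (coord false y ω)) = fun _ => 0 from
      funext (pd_coord_comp_of_ne hxy)]
    exact (Temperate.const 0).tame

end Coordinates

/-! ### The operators as finite sums -/

/-- The sites `-M, …, M`. -/
def box (M : ℕ) : Finset ℤ := Finset.Icc (-(M : ℤ)) M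

theorem sum_box_sub (G : ℤ → ℝ) (M : ℕ) :
    ∑ x ∈ box M, (G (x + 1) - G x) = G (M + 1) - G (-M) := by
  have key : ∀ n : ℕ, ∑ x ∈ Finset.Ico (-(M : ℤ)) (-M + n), (G (x + 1) - G x) =
      G (-M + n) - G (-M) := by
    intro n
    induction n with
    | zero => simp
    | succ n ih =>
      have h1 : (-(M : ℤ) + (n + 1 : ℕ)) = -M + n + 1 := by push_cast; ring
      rw [h1, ← Finset.insert_Ico_right_eq_Ico_add_one (by omega), Finset.sum_insert (by simp), ih]
      ring
  have h2 : box M = Finset.Ico (-(M : ℤ)) (-M + (2 * M + 1 : ℕ)) := by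
    ext i; simp only [box, Finset.mem_Icc, Finset.mem_Ico]; omega
  rw [h2, key]
  congr 2
  push_cast; ring

theorem finsum_eq_sum_box {F : ℤ → ℝ} {M : ℕ} (h : ∀ x ∉ box M, F x = 0) :
    ∑ᶠ x, F x = ∑ x ∈ box M, F x :=
  finsum_eq_sum_of_support_subset _ fun x hx => by
    by_contra hx'
    exact hx (h x (by simpa using hx'))

theorem notMem_Icc_of_notMem_box {N M : ℕ} (h : N ≤ M) {x : ℤ} (hx : x ∉ box M) :
    x ∉ Set.Icc (-(N : ℤ)) N := by
  simp only [box, Finset.mem_Icc, Set.mem_Icc] at *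
  omega

theorem liouville_eq_sum {N M : ℕ} (hNM : N ≤ M) {f : Config → ℝ} (hf : Loc N f) (V : ℝ → ℝ)
    (ω : Config) : liouville V f ω = ∑ x ∈ box M,
      ((coord true x ω - coord true (x - 1) ω) * pd false x f ω +
        (deriv V (coord false (x + 1) ω) - deriv V (coord false x ω)) * pd true x f ω) :=
  finsum_eq_sum_box fun x hx => by
    have := notMem_Icc_of_notMem_box hNM hx
    rw [partialR_eq_pd, partialP_eq_pd, hf.pd_eq_zero false this, hf.pd_eq_zero true this]
    simp

theorem flipNoise_eq_sum {N M : ℕ} (hNM : N ≤ M) {f : Config → ℝ} (hf : Loc N f)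
    (ω : Config) : flipNoise f ω = ∑ x ∈ box M, (f (flip x ω) - f ω) :=
  finsum_eq_sum_box fun x hx => by
    rw [hf.flip_eq (notMem_Icc_of_notMem_box hNM hx), sub_self]

theorem rotation_apply (x : ℤ) (f : Config → ℝ) (ω : Config) : rotation x f ω =
    coord true (x + 1) ω * pd true x f ω - coord true x ω * pd true (x + 1) f ω := rfl

theorem rotation_zero (x : ℤ) : rotation x (fun _ => 0) = fun _ => 0 := by
  funext ω
  simp [rotation_apply, pd_const]

theorem Loc.rotation_eq_zero {N M : ℕ} (hNM : N + 1 ≤ M) {f : Config → ℝ} (hf : Loc N f) {x : ℤ}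
    (hx : x ∉ box M) : rotation x f = fun _ => 0 := by
  funext ω
  have h1 : x ∉ Set.Icc (-(N : ℤ)) N := notMem_Icc_of_notMem_box (by omega) hx
  have h2 : x + 1 ∉ Set.Icc (-(N : ℤ)) N := by
    simp only [box, Finset.mem_Icc, Set.mem_Icc] at *
    omega
  rw [rotation_apply, hf.pd_eq_zero true h1, hf.pd_eq_zero true h2]
  simp

theorem exchangeNoise_eq_sum {N M : ℕ} (hNM : N + 1 ≤ M) {f : Config → ℝ} (hf : Loc N f)
    (ω : Config) :
    exchangeNoise f ω = (1 / 2 : ℝ) * ∑ x ∈ box M, rotation x (rotation x f) ω := by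
  unfold exchangeNoise
  rw [finsum_eq_sum_box fun x hx => by rw [hf.rotation_eq_zero hNM hx, rotation_zero]]

theorem Loc.rotation {N : ℕ} {f : Config → ℝ} (hf : Loc N f) (x : ℤ) :
    Loc (N + 1) (rotation x f) := by
  by_cases hx : x ∈ box (N + 1)
  · by_cases hx' : x + 1 ∈ Set.Icc (-((N + 1 : ℕ) : ℤ)) (N + 1 : ℕ)
    · have hx0 : x ∈ Set.Icc (-((N + 1 : ℕ) : ℤ)) (N + 1 : ℕ) := by
        simpa [box] using hx
      have hf' := hf.mono (Nat.le_succ N)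
      exact ((loc_coord true hx').mul (hf'.pd true x)).sub
        ((loc_coord true hx0).mul (hf'.pd true (x + 1)))
    · have h1 : x ∉ Set.Icc (-(N : ℤ)) N := by
        simp only [box, Finset.mem_Icc, Set.mem_Icc] at *
        omega
      have h2 : x + 1 ∉ Set.Icc (-(N : ℤ)) N := by
        simp only [box, Finset.mem_Icc, Set.mem_Icc] at *
        omega
      intro ω η _
      simp only [rotation_apply, hf.pd_eq_zero true h1, hf.pd_eq_zero true h2]
      simp
  · rw [hf.rotation_eq_zero le_rfl hx]
    exact fun _ _ _ => rfl

/-! ### Adjoints of the three operators under the Gibbs measure -/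

section Adjoints

variable {V : ℝ → ℝ} {T : ℝ}

theorem Admissible.temperate_rotation (h : Admissible V T) {f : Config → ℝ}
    (hf : TReg (gibbs V T) true f) (x : ℤ) : Temperate (gibbs V T) (rotation x f) := by
  have := h.isProbabilityMeasure
  exact ((h.temperate_coord (x + 1)).mul (hf.temp_pd x)).sub
    ((h.temperate_coord x).mul (hf.temp_pd (x + 1)))

theorem Admissible.tame_rotation (h : Admissible V T) {f : Config → ℝ}
    (hf : Reg (gibbs V T) true f) (x : ℤ) : Tame (gibbs V T) (rotation x f) :=
  ((h.temperate_coord (x + 1)).mul_tame (hf.tame_pd x)).sub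
    ((h.temperate_coord x).mul_tame (hf.tame_pd (x + 1)))

theorem MomTest.tReg_rotation (h : Admissible V T) {f : Config → ℝ}
    (hf : MomTest (gibbs V T) f) (x : ℤ) : TReg (gibbs V T) true (rotation x f) := by
  have := h.isProbabilityMeasure
  exact ((h.tReg_coord true (x + 1)).mul (hf.mom2 x)).sub
    ((h.tReg_coord true x).mul (hf.mom2 (x + 1)))

/-- The Gaussian law of a pair of momenta is rotation invariant: the two score terms are both `p_z
p_{z+1} f k / T` and cancel in the integration by parts. -/
theorem Admissible.integral_rotation_mul (h : Admissible V T) {f k : Config → ℝ}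
    (hf : TReg (gibbs V T) true f) (hk : Reg (gibbs V T) true k) (z : ℤ) :
    ∫ ω, rotation z f ω * k ω ∂gibbs V T = -∫ ω, f ω * rotation z k ω ∂gibbs V T := by
  have := h.isProbabilityMeasure
  have h1 := h.integral_mul_pd_mul (h.tReg_coord true (z + 1)) hf hk z
    (pd_coord_of_ne (by omega))
  have h2 := h.integral_mul_pd_mul (h.tReg_coord true z) hf hk (z + 1)
    (pd_coord_of_ne (by omega))
  have c1 := h.temperate_coord z
  have c2 := h.temperate_coord (z + 1)
  have e1 : ∫ ω, rotation z f ω * k ω ∂gibbs V T =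
      ∫ ω, coord true (z + 1) ω * pd true z f ω * k ω ∂gibbs V T -
      ∫ ω, coord true z ω * pd true (z + 1) f ω * k ω ∂gibbs V T := by
    rw [← integral_sub ((c2.mul (hf.temp_pd z)).mul_tame hk.tame).integrable
      ((c1.mul (hf.temp_pd (z + 1))).mul_tame hk.tame).integrable]
    simp only [rotation_apply, sub_mul]
  have e2 : ∫ ω, f ω * rotation z k ω ∂gibbs V T =
      ∫ ω, f ω * (coord true (z + 1) ω * pd true z k ω) ∂gibbs V T -
      ∫ ω, f ω * (coord true z ω * pd true (z + 1) k ω) ∂gibbs V T := by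
    rw [← integral_sub (hf.temp.mul_tame (c2.mul_tame (hk.tame_pd z))).integrable
      (hf.temp.mul_tame (c1.mul_tame (hk.tame_pd (z + 1)))).integrable]
    simp only [rotation_apply, mul_sub]
  rw [e1, e2, h1, h2]
  have e3 : ∀ ω, score V T true z ω * (coord true (z + 1) ω * f ω) * k ω =
      score V T true (z + 1) ω * (coord true z ω * f ω) * k ω := fun ω => by
    simp only [score, if_true]; ring
  simp only [e3]
  ring

theorem Admissible.integral_exchangeNoise_mul (h : Admissible V T) {N M : ℕ} (hNM : N + 1 ≤ M)
    {f k : Config → ℝ} (hN : Loc N f) (hf : MomTest (gibbs V T) f)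
    (hk : Reg (gibbs V T) true k) :
    ∫ ω, exchangeNoise f ω * k ω ∂gibbs V T =
      -(1 / 2 * ∑ z ∈ box M, ∫ ω, rotation z f ω * rotation z k ω ∂gibbs V T) := by
  have := h.isProbabilityMeasure
  simp only [exchangeNoise_eq_sum hNM hN, mul_assoc, Finset.sum_mul]
  rw [integral_const_mul, integral_finsetSum]
  · simp only [h.integral_rotation_mul (hf.tReg_rotation h _) hk, Finset.sum_neg_distrib]
    ring
  · intro z _
    exact ((h.temperate_rotation (hf.tReg_rotation h z) z).mul_tame hk.tame).integrable

theorem Admissible.measurePreserving_flip (h : Admissible V T) (x : ℤ) :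
    MeasurePreserving (flip x) (gibbs V T) (gibbs V T) := by
  have := h.isProbabilityMeasure
  rw [← flipOn_singleton]
  exact measurePreserving_flipOn h.measurePreserving_neg_snd _

theorem Admissible.measurePreserving_flipOn (h : Admissible V T) (B : Set ℤ) :
    MeasurePreserving (flipOn B) (gibbs V T) (gibbs V T) := by
  have := h.isProbabilityMeasure
  exact Chain.measurePreserving_flipOn h.measurePreserving_neg_snd B

theorem Admissible.integral_flipOn_mul (h : Admissible V T) (B : Set ℤ) {f k : Config → ℝ}
    (hf : Measurable f) (hk : Measurable k) :
    ∫ ω, f (flipOn B ω) * k ω ∂gibbs V T = ∫ ω, f ω * k (flipOn B ω) ∂gibbs V T := by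
  have hmp := h.measurePreserving_flipOn B
  have h1 := integral_comp_measurePreserving hmp (hf.mul (hk.comp hmp.measurable))
  simpa only [Function.comp_apply, flipOn_flipOn, Pi.mul_apply] using h1

theorem Admissible.integral_flip_mul (h : Admissible V T) (x : ℤ) {f k : Config → ℝ}
    (hf : Measurable f) (hk : Measurable k) :
    ∫ ω, f (flip x ω) * k ω ∂gibbs V T = ∫ ω, f ω * k (flip x ω) ∂gibbs V T := by
  simpa [flipOn_singleton] using h.integral_flipOn_mul {x} hf hk

theorem Admissible.integral_flipNoise_mul (h : Admissible V T) {N M : ℕ} (hNM : N ≤ M)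
    {f k : Config → ℝ} (hN : Loc N f) (hf : Temperate (gibbs V T) f) (hk : Tame (gibbs V T) k) :
    ∫ ω, flipNoise f ω * k ω ∂gibbs V T =
      ∑ z ∈ box M, ∫ ω, (f (flip z ω) - f ω) * k ω ∂gibbs V T := by
  have := h.isProbabilityMeasure
  simp only [flipNoise_eq_sum hNM hN, Finset.sum_mul]
  rw [integral_finsetSum]
  intro z _
  exact (((hf.comp (h.measurePreserving_flip z)).sub hf).mul_tame hk).integrable

theorem Admissible.integral_flip_sub_mul (h : Admissible V T) (z : ℤ) {f k : Config → ℝ}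
    (hf : Temperate (gibbs V T) f) (hk : Tame (gibbs V T) k) :
    ∫ ω, (f (flip z ω) - f ω) * k ω ∂gibbs V T =
      ∫ ω, f ω * (k (flip z ω) - k ω) ∂gibbs V T := by
  have := h.isProbabilityMeasure
  have hmp := h.measurePreserving_flip z
  have hkf : Tame (gibbs V T) fun ω => k (flip z ω) := hk.comp hmp hmp fun ω => by
    rw [← flipOn_singleton, flipOn_flipOn]
  simp only [sub_mul, mul_sub]
  rw [integral_sub ((hf.comp hmp).mul_tame hk).integrable (hf.mul_tame hk).integrable,
    integral_sub (hf.mul_tame hkf).integrable (hf.mul_tame hk).integrable,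
    h.integral_flip_mul z hf.meas hk.meas]

theorem Admissible.integral_flipNoise_symm (h : Admissible V T) {f k : Config → ℝ}
    (hf : MomTest (gibbs V T) f) (hk : MomTest (gibbs V T) k) :
    ∫ ω, flipNoise f ω * k ω ∂gibbs V T = ∫ ω, f ω * flipNoise k ω ∂gibbs V T := by
  obtain ⟨N, hN⟩ := hf.loc
  obtain ⟨N', hN'⟩ := hk.loc
  have h1 := h.integral_flipNoise_mul (M := N + N') (by omega) hN hf.mom.temp hk.mom.temp.tame
  have h2 := h.integral_flipNoise_mul (M := N + N') (by omega) hN' hk.mom.temp hf.mom.temp.tame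
  simp only [mul_comm (f _) (flipNoise _ _)]
  rw [h1, h2]
  refine Finset.sum_congr rfl fun z _ => ?_
  rw [h.integral_flip_sub_mul z hf.mom.temp hk.mom.temp.tame]
  simp only [mul_comm]

/-- A function independent of site `x` is orthogonal to `p_x`. -/
theorem Admissible.integral_coord_mul_eq_zero (h : Admissible V T) {k : Config → ℝ}
    (hk : Measurable k) {x : ℤ} (hx : ∀ ω, k (flip x ω) = k ω) :
    ∫ ω, coord true x ω * k ω ∂gibbs V T = 0 := by
  have hmp := h.measurePreserving_flip x
  have hc : Measurable (coord true x) := (h.temperate_coord x).meas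
  have h1 := integral_comp_measurePreserving hmp (hc.mul hk)
  have h2 : ∀ ω, coord true x (flip x ω) = -coord true x ω := fun ω => by simp [coord, flip]
  simp only [Pi.mul_apply, h2, hx, neg_mul, integral_neg] at h1
  linarith

/-- The Hamiltonian field has no divergence in its own coordinates, so only the score terms could
spoil antisymmetry. At site `x` they add up to `(p_x V'(r_{x+1}) - p_{x-1} V'(r_x)) f k / T`, which
telescopes. A boundary term contains a momentum on which `f` and `k` do not depend, and integrates
to zero. -/
theorem Admissible.integral_liouville_mul (h : Admissible V T) {f k : Config → ℝ}
    (hf : TestLike (gibbs V T) f) (hkl : ∃ N, Loc N k) (hkp : Reg (gibbs V T) false k)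
    (hkm : Reg (gibbs V T) true k) :
    ∫ ω, liouville V f ω * k ω ∂gibbs V T = -∫ ω, f ω * liouville V k ω ∂gibbs V T := by
  have := h.isProbabilityMeasure
  obtain ⟨N₁, hN₁⟩ := hf.loc
  obtain ⟨N₂, hN₂⟩ := hkl
  set N := max N₁ N₂ with hN
  have hlf : Loc N f := hN₁.mono (le_max_left _ _)
  have hlk : Loc N k := hN₂.mono (le_max_right _ _)
  -- The right boundary term carries the momentum at site `M`, which must lie outside `[-N, N]`; the
  -- box of radius `N` would be too small.
  set M := N + 1 with hM
  have hNM : N ≤ M := by omega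
  set a : ℤ → Config → ℝ := fun x ω => coord true x ω - coord true (x - 1) ω with ha
  set b : ℤ → Config → ℝ := fun x ω =>
    deriv V (coord false (x + 1) ω) - deriv V (coord false x ω) with hb
  have hF := h.temperate_force
  have ta : ∀ x, TReg (gibbs V T) false (a x) := fun x =>
    (h.tReg_coord false x).sub (h.tReg_coord false (x - 1))
  have tb : ∀ x, TReg (gibbs V T) true (b x) := fun x =>
    (h.tReg_distance_mom hF (x + 1)).sub (h.tReg_distance_mom hF x)
  have ea : ∀ x, ∫ ω, a x ω * pd false x f ω * k ω ∂gibbs V T = _ := fun x =>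
    h.integral_mul_pd_mul (ta x) hf.pos hkp x (pd_eq_zero_of_line fun ω t => by
      simp only [ha, coord_line_of_dir_ne (show true ≠ false by simp)])
  have eb : ∀ x, ∫ ω, b x ω * pd true x f ω * k ω ∂gibbs V T = _ := fun x =>
    h.integral_mul_pd_mul (tb x) hf.mom hkm x (pd_eq_zero_of_line fun ω t => by
      simp only [hb, coord_line_of_dir_ne (show false ≠ true by simp)])
  have ia : ∀ x, Integrable (fun ω => a x ω * pd false x f ω * k ω) (gibbs V T) := fun x =>
    (((ta x).temp.mul (hf.pos.temp_pd x)).mul_tame hkp.tame).integrable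
  have ib : ∀ x, Integrable (fun ω => b x ω * pd true x f ω * k ω) (gibbs V T) := fun x =>
    (((tb x).temp.mul (hf.mom.temp_pd x)).mul_tame hkp.tame).integrable
  have ja : ∀ x, Integrable (fun ω => f ω * (a x ω * pd false x k ω)) (gibbs V T) := fun x =>
    (hf.mom.temp.mul_tame ((ta x).temp.mul_tame (hkp.tame_pd x))).integrable
  have jb : ∀ x, Integrable (fun ω => f ω * (b x ω * pd true x k ω)) (gibbs V T) := fun x =>
    (hf.mom.temp.mul_tame ((tb x).temp.mul_tame (hkm.tame_pd x))).integrable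
  have sa : ∀ x, Integrable (fun ω => score V T false x ω * (a x ω * f ω) * k ω) (gibbs V T) :=
    fun x => (((h.temperate_score false x).mul ((ta x).temp.mul hf.mom.temp)).mul_tame
      hkp.tame).integrable
  have sb : ∀ x, Integrable (fun ω => score V T true x ω * (b x ω * f ω) * k ω) (gibbs V T) :=
    fun x => (((h.temperate_score true x).mul ((tb x).temp.mul hf.mom.temp)).mul_tame
      hkp.tame).integrable
  have eL : ∫ ω, liouville V f ω * k ω ∂gibbs V T = ∑ x ∈ box M,
      (∫ ω, a x ω * pd false x f ω * k ω ∂gibbs V T +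
        ∫ ω, b x ω * pd true x f ω * k ω ∂gibbs V T) := by
    simp only [liouville_eq_sum hNM hlf, Finset.sum_mul, add_mul]
    rw [integral_finsetSum]
    · exact Finset.sum_congr rfl fun x _ => integral_add (ia x) (ib x)
    · exact fun x _ => (ia x).add (ib x)
  have eR : ∫ ω, f ω * liouville V k ω ∂gibbs V T = ∑ x ∈ box M,
      (∫ ω, f ω * (a x ω * pd false x k ω) ∂gibbs V T +
        ∫ ω, f ω * (b x ω * pd true x k ω) ∂gibbs V T) := by
    simp only [liouville_eq_sum hNM hlk, Finset.mul_sum, mul_add]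
    rw [integral_finsetSum]
    · exact Finset.sum_congr rfl fun x _ => integral_add (ja x) (jb x)
    · exact fun x _ => (ja x).add (jb x)
  -- the boundary terms of the telescoping sum
  set G : ℤ → Config → ℝ := fun x ω =>
    coord true (x - 1) ω * (T⁻¹ * deriv V (coord false x ω) * f ω * k ω) with hG
  have tG : ∀ x, Tame (gibbs V T) (G x) := fun x => (h.temperate_coord (x - 1)).mul_tame
    ((((h.temperate_comp_distance hF x).const_mul _).mul hf.mom.temp).mul_tame hkp.tame)
  have hG0 : ∀ x, x - 1 ∉ Set.Icc (-(N : ℤ)) N → ∫ ω, G x ω ∂gibbs V T = 0 := fun x hx => by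
    refine h.integral_coord_mul_eq_zero
      ((((h.temperate_comp_distance hF x).const_mul _).mul hf.mom.temp).mul_tame hkp.tame).meas
      fun ω => ?_
    rw [hlf.flip_eq hx, hlk.flip_eq hx]
    have : coord false x (flip (x - 1) ω) = coord false x ω := by
      simp [coord, flip, Function.update_of_ne (show x ≠ x - 1 by omega)]
    rw [this]
  have hsum : ∑ x ∈ box M, (∫ ω, score V T false x ω * (a x ω * f ω) * k ω ∂gibbs V T +
      ∫ ω, score V T true x ω * (b x ω * f ω) * k ω ∂gibbs V T) = 0 := by
    have h1 : ∀ x, ∫ ω, score V T false x ω * (a x ω * f ω) * k ω ∂gibbs V T +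
      ∫ ω, score V T true x ω * (b x ω * f ω) * k ω ∂gibbs V T =
        ∫ ω, G (x + 1) ω ∂gibbs V T - ∫ ω, G x ω ∂gibbs V T := by
      intro x
      rw [← integral_add (sa x) (sb x), ← integral_sub (tG _).integrable (tG _).integrable]
      refine integral_congr_ae (Eventually.of_forall fun ω => ?_)
      simp only [score, ha, hb, hG, if_true, add_sub_cancel_right]
      simp only [Bool.false_eq_true, if_false]
      ring
    rw [Finset.sum_congr rfl fun x _ => h1 x, sum_box_sub (fun x => ∫ ω, G x ω ∂gibbs V T),
      hG0, hG0, sub_zero]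
    · simp only [Set.mem_Icc, hM]; push_cast; omega
    · simp only [Set.mem_Icc, hM]; push_cast; omega
  rw [eL, eR, ← Finset.sum_neg_distrib, ← sub_eq_zero, ← Finset.sum_sub_distrib]
  refine Eq.trans (Finset.sum_congr rfl fun x _ => ?_) hsum
  rw [ea, eb]; ring

end Adjoints

/-! ### Commutation with shifts and reversal -/

theorem rotation_comp_shift (x z : ℤ) (f : Config → ℝ) (ω : Config) :
    rotation (x + z) (fun η => f (shift x η)) ω = rotation z f (shift x ω) := by
  simp only [rotation_apply, pd_comp_shift, coord_shift, add_assoc]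

theorem flip_shift (x z : ℤ) (ω : Config) : flip z (shift x ω) = shift x (flip (x + z) ω) := by
  rw [← flipOn_singleton, ← flipOn_singleton, flipOn_shift, Set.image_singleton]

theorem finsum_comp_add (x : ℤ) (F : ℤ → ℝ) : ∑ᶠ z, F (x + z) = ∑ᶠ z, F z :=
  finsum_comp_equiv (Equiv.addLeft x)

theorem liouville_comp_shift (V : ℝ → ℝ) (x : ℤ) (f : Config → ℝ) (ω : Config) :
    liouville V (fun η => f (shift x η)) ω = liouville V f (shift x ω) := by
  unfold liouville
  rw [← finsum_comp_add x]
  refine finsum_congr fun z => ?_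
  rw [partialR_eq_pd, partialP_eq_pd, pd_comp_shift, pd_comp_shift]
  simp only [shift, add_assoc, add_sub_assoc]

theorem rotation_comp_reverse (z : ℤ) (f : Config → ℝ) (ω : Config) :
    rotation z (fun η => f (reverse η)) ω = rotation z f (reverse ω) := by
  simp only [rotation_apply, pd_true_comp_reverse, coord_true_reverse]
  ring

theorem reverse_flip (z : ℤ) (ω : Config) : reverse (flip z ω) = flip z (reverse ω) := by
  funext y
  by_cases h : y = z
  · subst h; simp [reverse_apply, flip]
  · simp [reverse_apply, flip, h]

theorem liouville_comp_reverse (V : ℝ → ℝ) (f : Config → ℝ) (ω : Config) :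
    liouville V (fun η => f (reverse η)) ω = -liouville V f (reverse ω) := by
  unfold liouville
  rw [← finsum_neg_distrib]
  refine finsum_congr fun z => ?_
  rw [partialR_eq_pd, partialP_eq_pd, pd_true_comp_reverse, pd_false_comp_reverse]
  simp only [reverse_apply]
  ring

theorem flipNoise_comp_reverse (f : Config → ℝ) (ω : Config) :
    flipNoise (fun η => f (reverse η)) ω = flipNoise f (reverse ω) := by
  unfold flipNoise
  simp only [reverse_flip]

theorem exchangeNoise_comp_reverse (f : Config → ℝ) (ω : Config) :
    exchangeNoise (fun η => f (reverse η)) ω = exchangeNoise f (reverse ω) := by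
  unfold exchangeNoise
  congr 1
  refine finsum_congr fun z => ?_
  rw [show rotation z (fun η => f (reverse η)) = fun η => rotation z f (reverse η) from
    funext (rotation_comp_reverse z f), rotation_comp_reverse]

/-! ### Locality and moments of the images -/

theorem Loc.liouville {N : ℕ} {f : Config → ℝ} (hf : Loc N f) (V : ℝ → ℝ) :
    Loc (N + 2) (liouville V f) := by
  have hf' := hf.mono (show N ≤ N + 2 by omega)
  have hc : ∀ (d : Bool) (x : ℤ), x ∈ box N → ∀ y, |y - x| ≤ 1 → Loc (N + 2) (coord d y) :=
    fun d x hx y hy => loc_coord d (by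
      simp only [box, Finset.mem_Icc, Set.mem_Icc] at *
      rw [abs_le] at hy
      omega)
  rw [show Chain.liouville V f = fun ω => _ from funext (liouville_eq_sum le_rfl hf V)]
  refine Loc.sum _ fun x hx => ?_
  exact (((hc true x hx x (by simp)).sub (hc true x hx (x - 1) (by simp))).mul
    (hf'.pd false x)).add ((((hc false x hx (x + 1) (by simp)).comp_left _).sub
    ((hc false x hx x (by simp)).comp_left _)).mul (hf'.pd true x))

theorem Loc.flipNoise {N : ℕ} {f : Config → ℝ} (hf : Loc N f) : Loc N (flipNoise f) := by
  rw [show Chain.flipNoise f = fun ω => _ from funext (flipNoise_eq_sum le_rfl hf)]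
  refine Loc.sum _ fun x _ => Loc.sub ?_ hf
  rw [← flipOn_singleton]
  exact hf.comp_flipOn _

theorem Loc.exchangeNoise {N : ℕ} {f : Config → ℝ} (hf : Loc N f) :
    Loc (N + 2) (exchangeNoise f) := by
  rw [show Chain.exchangeNoise f = fun ω => _ from funext (exchangeNoise_eq_sum le_rfl hf)]
  exact (Loc.sum _ fun x _ => (hf.rotation x).rotation x).const_mul _

section Moments

variable {V : ℝ → ℝ} {T : ℝ} {f : Config → ℝ}

theorem TestLike.temperate_liouville (h : Admissible V T) (hf : TestLike (gibbs V T) f) :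
    Temperate (gibbs V T) (liouville V f) := by
  have := h.isProbabilityMeasure
  obtain ⟨N, hN⟩ := hf.loc
  have hF := h.temperate_force
  rw [show liouville V f = fun ω => _ from funext (liouville_eq_sum le_rfl hN V)]
  exact Temperate.sum _ fun x _ =>
    (((h.temperate_coord x).sub (h.temperate_coord (x - 1))).mul (hf.pos.temp_pd x)).add
      (((h.temperate_comp_distance hF (x + 1)).sub (h.temperate_comp_distance hF x)).mul
        (hf.mom.temp_pd x))

theorem MomTest.temperate_flipNoise (h : Admissible V T) (hf : MomTest (gibbs V T) f) :
    Temperate (gibbs V T) (flipNoise f) := by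
  have := h.isProbabilityMeasure
  obtain ⟨N, hN⟩ := hf.loc
  rw [show flipNoise f = fun ω => _ from funext (flipNoise_eq_sum le_rfl hN)]
  exact Temperate.sum _ fun x _ =>
    (hf.mom.temp.comp (h.measurePreserving_flip x)).sub hf.mom.temp

theorem MomTest.temperate_exchangeNoise (h : Admissible V T) (hf : MomTest (gibbs V T) f) :
    Temperate (gibbs V T) (exchangeNoise f) := by
  have := h.isProbabilityMeasure
  obtain ⟨N, hN⟩ := hf.loc
  rw [show exchangeNoise f = fun ω => _ from funext (exchangeNoise_eq_sum le_rfl hN)]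
  exact (Temperate.sum _ fun x _ => h.temperate_rotation (hf.tReg_rotation h x) x).const_mul _

theorem TestLike.integral_liouville (h : Admissible V T) (hf : TestLike (gibbs V T) f) :
    ∫ ω, liouville V f ω ∂gibbs V T = 0 := by
  have := h.isProbabilityMeasure
  have h1 := h.integral_liouville_mul (k := fun _ => 1) hf ⟨0, fun _ _ _ => rfl⟩
    (TReg.const 1).reg (TReg.const 1).reg
  have h2 : ∀ ω, liouville V (fun _ => 1) ω = 0 := fun ω => by
    simp [liouville, partialR, partialP]
  simpa [h2] using h1

theorem MomTest.integral_flipNoise (h : Admissible V T) (hf : MomTest (gibbs V T) f) :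
    ∫ ω, flipNoise f ω ∂gibbs V T = 0 := by
  have := h.isProbabilityMeasure
  have h1 := h.integral_flipNoise_symm (k := fun _ => 1) hf ⟨⟨0, fun _ _ _ => rfl⟩,
    TReg.const 1, fun x => by
      rw [show pd true x (fun _ => 1) = fun _ => 0 from funext (pd_const 1 x)]
      exact TReg.const 0⟩
  simpa [flipNoise] using h1

theorem MomTest.integral_exchangeNoise (h : Admissible V T) (hf : MomTest (gibbs V T) f) :
    ∫ ω, exchangeNoise f ω ∂gibbs V T = 0 := by
  have := h.isProbabilityMeasure
  obtain ⟨N, hN⟩ := hf.loc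
  have h1 := h.integral_exchangeNoise_mul (k := fun _ => 1) le_rfl hN hf (TReg.const 1).reg
  have h2 : ∀ z ω, rotation z (fun _ => 1) ω = 0 := fun z ω => by
    simp [rotation_apply, pd_const]
  simpa [h2] using h1

end Moments

/-! ### The semi-inner product as a finite sum -/

section LocalFunctions

variable {ν : Measure (ℝ × ℝ)}

/-- The element of `LocalFun ν` defined by a local function in `L²`. -/
def mkLocal (f : Config → ℝ) (hm : Measurable f) (h2 : MemLp f 2 (productMeasure ν))
    (hl : ∃ N, Loc N f) : LocalFun ν :=
  ⟨f, hm, h2, hl.elim fun _ hN => ⟨_, hN.dependsOn⟩⟩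

theorem LocalFun.exists_loc (f : LocalFun ν) : ∃ N, Loc N f.fn :=
  f.exists_dependsOn.elim fun _ hs => exists_loc_of_dependsOn hs

variable [IsProbabilityMeasure ν]

theorem integral_mul_shift_of_far {f g : Config → ℝ} (hf : Measurable f) (hg : Measurable g)
    {N : ℕ} (hfl : Loc N f) (hgl : Loc N g) {x : ℤ} (hx : (2 * N : ℤ) < |x|) :
    ∫ ω, f ω * g (shift x ω) ∂productMeasure ν =
      (∫ ω, f ω ∂productMeasure ν) * ∫ ω, g ω ∂productMeasure ν := by
  have hmp := measurePreserving_shift (ν := ν) x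
  have hind : IndepFun f (fun ω => g (shift x ω)) (productMeasure ν) := by
    refine indepFun_of_dependsOn hf (hg.comp hmp.measurable) hfl.dependsOn
      (t := Finset.Icc (x - N) (x + N)) (fun ω η h => hgl fun i hi => h (x + i) ?_) ?_
    · have h1 := hi.1
      have h2 := hi.2
      simp only [Finset.coe_Icc, Set.mem_Icc]
      omega
    · rw [Finset.disjoint_left]
      intro i hi hi'
      simp only [Finset.mem_Icc] at hi hi'
      rcases lt_abs.1 hx with h | h <;> omega
  have h1 := hind.integral_fun_mul_eq_mul_integral hf.aestronglyMeasurable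
    (hg.comp hmp.measurable).aestronglyMeasurable
  rw [h1, integral_comp_measurePreserving hmp hg]

theorem lt_abs_of_notMem_box {M : ℕ} {x : ℤ} (hx : x ∉ box M) : (M : ℤ) < |x| := by
  simp only [box, Finset.mem_Icc, ← abs_le, not_le] at hx
  exact hx

theorem semiInner_eq_sum_box {N L : ℕ} (hL : 2 * N ≤ L) {f g : LocalFun ν} (hf : Loc N f.fn)
    (hg : Loc N g.fn)
    (h0 : ∫ ω, f.fn ω ∂productMeasure ν = 0 ∨ ∫ ω, g.fn ω ∂productMeasure ν = 0) :
    semiInner f g = ∑ x ∈ box L, ∫ ω, f.fn ω * g.fn (shift x ω) ∂productMeasure ν := by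
  have h0' : (∫ ω, f.fn ω ∂productMeasure ν) * ∫ ω, g.fn ω ∂productMeasure ν = 0 := by
    rcases h0 with h | h <;> simp [h]
  unfold semiInner
  rw [tsum_eq_sum (s := box L)]
  · simp only [h0', sub_zero]
  · intro x hx
    have := lt_abs_of_notMem_box hx
    rw [integral_mul_shift_of_far f.measurable g.measurable hf hg (by omega), sub_self]

/-- Reindexing the sum over translations absorbs the shift. Hence a function and its translate
represent the same vector, which permits moving `p_1 V'(r_1)` to `p_0 V'(r_0)`. -/
theorem semiInner_comp_shift {f g g' : LocalFun ν} (h : ∀ ω, g'.fn ω = g.fn (shift 1 ω)) :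
    semiInner f g' = semiInner f g := by
  have hmp := measurePreserving_shift (ν := ν) 1
  have h1 : ∫ ω, g'.fn ω ∂productMeasure ν = ∫ ω, g.fn ω ∂productMeasure ν := by
    simp only [h]
    exact integral_comp_measurePreserving hmp g.measurable
  unfold semiInner
  rw [h1, ← (Equiv.addLeft (1 : ℤ)).tsum_eq fun x =>
    ((∫ ω, f.fn ω * g.fn (shift x ω) ∂productMeasure ν) -
      (∫ ω, f.fn ω ∂productMeasure ν) * ∫ ω, g.fn ω ∂productMeasure ν)]
  simp only [h, shift_shift, Equiv.coe_addLeft]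

/-! ### Translation covariant families of operators -/

/-- A family `K z` of operators with `K z = τ_z K 0 τ_{-z}`. -/
def Covariant (K : ℤ → (Config → ℝ) → Config → ℝ) : Prop :=
  ∀ z f ω, K z (fun η => f (shift z η)) ω = K 0 f (shift z ω)

theorem Covariant.apply_eq {K : ℤ → (Config → ℝ) → Config → ℝ} (hK : Covariant K) (z x : ℤ)
    (f : Config → ℝ) (ω : Config) :
    K z (fun η => f (shift x η)) ω = K 0 (fun η => f (shift (x - z) η)) (shift z ω) := by
  rw [← hK]
  simp only [shift_shift, sub_add_cancel]

/-- The formal sum `∑_y K 0 (τ_y f)`. -/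
def total (K : ℤ → (Config → ℝ) → Config → ℝ) (M : ℕ) (f : Config → ℝ) (ω : Config) : ℝ :=
  ∑ y ∈ box M, K 0 (fun η => f (shift y η)) ω

theorem neg_mem_box {M : ℕ} {x : ℤ} : -x ∈ box M ↔ x ∈ box M := by
  simp only [box, Finset.mem_Icc]; omega

theorem box_subset {M L : ℕ} (h : M ≤ L) : box M ⊆ box L := by
  intro x hx
  simp only [box, Finset.mem_Icc] at *
  omega

theorem sum_box_neg (M : ℕ) (F : ℤ → ℝ) : ∑ x ∈ box M, F (-x) = ∑ x ∈ box M, F x :=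
  Finset.sum_nbij' (fun x => -x) (fun x => -x) (fun _ h => neg_mem_box.2 h)
    (fun _ h => neg_mem_box.2 h) (fun _ _ => neg_neg _) (fun _ _ => neg_neg _) fun _ _ => rfl

/-- The change of variables `y = -z`, `y' = x - z` turns the skew sum into a sum over a product. The
radii `M` and `2 M` are large enough to contain every nonzero term. -/
theorem sum_box_double {c : ℤ → ℤ → ℝ} {M L L' : ℕ} (hL : M ≤ L) (hL' : 2 * M ≤ L')
    (hc : ∀ y y', y ∉ box M ∨ y' ∉ box M → c y y' = 0) :
    ∑ x ∈ box L', ∑ z ∈ box L, c (-z) (x - z) = ∑ y ∈ box M, ∑ y' ∈ box M, c y y' := by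
  rw [Finset.sum_comm, ← sum_box_neg]
  simp only [neg_neg, sub_neg_eq_add]
  rw [← Finset.sum_subset (box_subset hL) fun y _ hy =>
    Finset.sum_eq_zero fun x _ => hc _ _ (Or.inl hy)]
  refine Finset.sum_congr rfl fun y hy => ?_
  have e1 : ∑' y', c y y' = ∑ y' ∈ box M, c y y' :=
    tsum_eq_sum fun y' hy' => hc _ _ (Or.inr hy')
  have e2 : ∑' x, c y (x + y) = ∑ x ∈ box L', c y (x + y) := tsum_eq_sum fun x hx => by
    refine hc _ _ (Or.inr ?_)
    simp only [box, Finset.mem_Icc] at *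
    omega
  have e3 : ∑' x, c y (x + y) = ∑' x, c y x := (Equiv.addRight y).tsum_eq (c y)
  rw [← e1, ← e2, e3]

/-- Translating by `-z` turns `K z f · K z (τ_x g)` into `K 0 (τ_{-z} f) · K 0 (τ_{x-z} g)`, so the
double sum over `x` and `z` factorizes. For `f = g` the result is the integral of a square: this is
how the form `≪·, ·≫`, itself a sum over translations, acquires positive Dirichlet forms and a
Cauchy-Schwarz inequality in `L²(μ)`. -/
theorem Covariant.sum_integral_mul {K : ℤ → (Config → ℝ) → Config → ℝ} (hK : Covariant K)
    {M L L' : ℕ} (hL : M ≤ L) (hL' : 2 * M ≤ L') {f g : Config → ℝ}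
    (hf : ∀ y, Temperate (productMeasure ν) (K 0 fun η => f (shift y η)))
    (hg : ∀ y, Temperate (productMeasure ν) (K 0 fun η => g (shift y η)))
    (hf0 : ∀ y ∉ box M, ∀ ω, K 0 (fun η => f (shift y η)) ω = 0)
    (hg0 : ∀ y ∉ box M, ∀ ω, K 0 (fun η => g (shift y η)) ω = 0) :
    ∑ x ∈ box L', ∑ z ∈ box L, ∫ ω, K z f ω * K z (fun η => g (shift x η)) ω ∂productMeasure ν =
      ∫ ω, total K M f ω * total K M g ω ∂productMeasure ν := by
  set c : ℤ → ℤ → ℝ := fun y y' => ∫ ω, K 0 (fun η => f (shift y η)) ω *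
    K 0 (fun η => g (shift y' η)) ω ∂productMeasure ν with hc
  have h1 : ∀ x z, ∫ ω, K z f ω * K z (fun η => g (shift x η)) ω ∂productMeasure ν =
      c (-z) (x - z) := by
    intro x z
    have hz : ∀ ω, K z f ω = K 0 (fun η => f (shift (-z) η)) (shift z ω) := fun ω => by
      have := hK.apply_eq z 0 f ω
      simpa only [shift_zero, zero_sub] using this
    simp only [hz, hK.apply_eq z x g, hc]
    exact integral_comp_measurePreserving (measurePreserving_shift z)
      ((hf (-z)).meas.mul (hg (x - z)).meas)
  simp only [h1]
  rw [sum_box_double hL hL']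
  · simp only [total, Finset.sum_mul_sum]
    rw [integral_finsetSum]
    · refine Finset.sum_congr rfl fun y _ => ?_
      rw [integral_finsetSum]
      exact fun y' _ => ((hf y).mul (hg y')).integrable
    · exact fun y _ => integrable_finsetSum _ fun y' _ => ((hf y).mul (hg y')).integrable
  · rintro y y' (hy | hy)
    · simp [hc, hf0 y hy]
    · simp [hc, hg0 y' hy]

/-- The variant in which only one factor is differentiated: translation invariance moves every shift
onto `f`. -/
theorem Covariant.sum_integral_mul_shift {K : ℤ → (Config → ℝ) → Config → ℝ} (hK : Covariant K)
    {M L : ℕ} (hL : M ≤ L) {f g : Config → ℝ}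
    (hf : ∀ y, Temperate (productMeasure ν) (K 0 fun η => f (shift y η)))
    (hg : Tame (productMeasure ν) g)
    (hf0 : ∀ y ∉ box M, ∀ ω, K 0 (fun η => f (shift y η)) ω = 0) :
    ∑ x ∈ box L, ∫ ω, K x f ω * g (shift x ω) ∂productMeasure ν =
      ∫ ω, total K M f ω * g ω ∂productMeasure ν := by
  have h1 : ∀ x, ∫ ω, K x f ω * g (shift x ω) ∂productMeasure ν =
      ∫ ω, K 0 (fun η => f (shift (-x) η)) ω * g ω ∂productMeasure ν := by
    intro x
    have hz : ∀ ω, K x f ω = K 0 (fun η => f (shift (-x) η)) (shift x ω) := fun ω => by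
      have := hK.apply_eq x 0 f ω
      simpa only [shift_zero, zero_sub] using this
    simp only [hz]
    exact integral_comp_measurePreserving (measurePreserving_shift x)
      ((hf (-x)).meas.mul hg.meas)
  simp only [h1]
  rw [sum_box_neg L fun x => ∫ ω, K 0 (fun η => f (shift x η)) ω * g ω ∂productMeasure ν,
    ← Finset.sum_subset (box_subset hL) fun y _ hy => by simp [hf0 y hy]]
  simp only [total, Finset.sum_mul]
  rw [integral_finsetSum]
  exact fun y _ => ((hf y).mul_tame hg).integrable

end LocalFunctions

theorem covariant_rotation : Covariant rotation := fun z f ω => by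
  have := rotation_comp_shift z 0 f ω
  rwa [add_zero] at this

theorem covariant_flip : Covariant fun z f ω => f (flip z ω) - f ω := fun z f ω => by
  have := flip_shift z 0 ω
  rw [add_zero] at this
  simp only [this]

section LocalAlgebra

variable {ν : Measure (ℝ × ℝ)}

theorem LocalFun.ext_fn {f g : LocalFun ν} (h : f.fn = g.fn) : f = g := Subtype.ext h

theorem inner_eq_semiInner (f g : LocalFun ν) : inner ℝ f g = semiInner f g := rfl

/-- The local function of `LocalFun ν` given by a temperate local function. -/
def Temperate.toLocal {f : Config → ℝ} (hf : Temperate (productMeasure ν) f)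
    (hl : ∃ N, Loc N f) : LocalFun ν := mkLocal f hf.meas hf.memLp_two hl

end LocalAlgebra

/-! ### Reversal of momenta on the Hilbert space -/

section Reverse

variable {ν : Measure (ℝ × ℝ)} [IsProbabilityMeasure ν]

/-- Composition with the reversal of momenta. -/
def reverseLin (hν : MeasurePreserving (fun v : ℝ × ℝ => (v.1, -v.2)) ν ν) :
    LocalFun ν →ₗ[ℝ] LocalFun ν where
  toFun f := mkLocal (fun ω => f.fn (reverse ω))
    (f.measurable.comp (measurable_flipOn _))
    (f.memLp.comp_measurePreserving (measurePreserving_flipOn hν _))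
    (f.exists_loc.imp fun _ hN => hN.comp_flipOn _)
  map_add' _ _ := rfl
  map_smul' _ _ := rfl

theorem fn_reverseLin (hν : MeasurePreserving (fun v : ℝ × ℝ => (v.1, -v.2)) ν ν)
    (f : LocalFun ν) : (reverseLin hν f).fn = fun ω => f.fn (reverse ω) := rfl

theorem inner_reverseLin (hν : MeasurePreserving (fun v : ℝ × ℝ => (v.1, -v.2)) ν ν)
    (f g : LocalFun ν) : inner ℝ (reverseLin hν f) (reverseLin hν g) = inner ℝ f g := by
  have hR : MeasurePreserving reverse (productMeasure ν) (productMeasure ν) :=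
    measurePreserving_flipOn hν _
  simp only [inner_eq_semiInner, semiInner, fn_reverseLin]
  rw [integral_comp_measurePreserving hR f.measurable,
    integral_comp_measurePreserving hR g.measurable]
  refine tsum_congr fun x => ?_
  congr 1
  simp only [reverse_shift]
  exact integral_comp_measurePreserving hR
    (f.measurable.mul (g.measurable.comp (measurePreserving_shift (ν := ν) x).measurable))

/-- Reversal of momenta as a continuous operator on local functions. -/
def reverseCLM (hν : MeasurePreserving (fun v : ℝ × ℝ => (v.1, -v.2)) ν ν) :
    LocalFun ν →L[ℝ] LocalFun ν :=
  (reverseLin hν).mkContinuous 1 fun f => by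
    rw [one_mul]
    refine le_of_sq_le_sq ?_ (norm_nonneg _)
    rw [← real_inner_self_eq_norm_sq, ← real_inner_self_eq_norm_sq, inner_reverseLin]

end Reverse

/-! ### Cauchy-Schwarz inequalities -/

/-- Cauchy-Schwarz in the direct sum of two copies of `L²`, by the discriminant. The flip and
exchange parts of the noise are treated jointly, which is what produces the sharp constant `3` in
the sector bound. -/
theorem sq_integral_mul_add_le {Ω : Type*} [MeasurableSpace Ω] {μ : Measure Ω}
    {a b c d : Ω → ℝ} (ha : MemLp a 2 μ) (hb : MemLp b 2 μ) (hc : MemLp c 2 μ)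
    (hd : MemLp d 2 μ) :
    (∫ ω, a ω * b ω ∂μ + ∫ ω, c ω * d ω ∂μ) ^ 2 ≤
      (∫ ω, a ω * a ω ∂μ + ∫ ω, c ω * c ω ∂μ) * (∫ ω, b ω * b ω ∂μ + ∫ ω, d ω * d ω ∂μ) := by
  have key : ∀ {a b : Ω → ℝ}, MemLp a 2 μ → MemLp b 2 μ → ∀ t : ℝ,
      0 ≤ (∫ ω, b ω * b ω ∂μ) * (t * t) + (2 * ∫ ω, a ω * b ω ∂μ) * t +
        ∫ ω, a ω * a ω ∂μ := by
    intro a b ha hb t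
    have iaa : Integrable (fun ω => a ω * a ω) μ := ha.integrable_mul ha
    have iab : Integrable (fun ω => a ω * b ω) μ := ha.integrable_mul hb
    have ibb : Integrable (fun ω => b ω * b ω) μ := hb.integrable_mul hb
    have h0 : 0 ≤ ∫ ω, (a ω + t * b ω) * (a ω + t * b ω) ∂μ :=
      integral_nonneg fun ω => mul_self_nonneg _
    have h1 : ∀ ω, (a ω + t * b ω) * (a ω + t * b ω) =
        a ω * a ω + (2 * t) * (a ω * b ω) + t * t * (b ω * b ω) := fun ω => by ring
    simp only [h1] at h0
    have i1 : Integrable (fun ω => a ω * a ω + (2 * t) * (a ω * b ω)) μ :=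
      iaa.add (iab.const_mul _)
    rw [integral_add i1 (ibb.const_mul _),
      integral_add iaa (iab.const_mul _), integral_const_mul, integral_const_mul] at h0
    linarith
  have h := discrim_le_zero (a := ∫ ω, b ω * b ω ∂μ + ∫ ω, d ω * d ω ∂μ)
    (b := 2 * (∫ ω, a ω * b ω ∂μ + ∫ ω, c ω * d ω ∂μ))
    (c := ∫ ω, a ω * a ω ∂μ + ∫ ω, c ω * c ω ∂μ) fun t => by
      have h1 := key ha hb t
      have h2 := key hc hd t
      linarith
  simp only [discrim] at h
  linarith

theorem sq_integral_mul_le {Ω : Type*} [MeasurableSpace Ω] {μ : Measure Ω}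
    {a b : Ω → ℝ} (ha : MemLp a 2 μ) (hb : MemLp b 2 μ) :
    (∫ ω, a ω * b ω ∂μ) ^ 2 ≤ (∫ ω, a ω * a ω ∂μ) * ∫ ω, b ω * b ω ∂μ := by
  have h0 : MemLp (fun _ : Ω => (0 : ℝ)) 2 μ := MemLp.zero
  simpa using sq_integral_mul_add_le ha hb h0 h0

/-! ### Dirichlet forms -/

/-- The flip gradient `f(ω^z) - f(ω)`. -/
def flipGrad (z : ℤ) (f : Config → ℝ) (ω : Config) : ℝ := f (flip z ω) - f ω

theorem covariant_flipGrad : Covariant flipGrad := covariant_flip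

section Forms

variable {V : ℝ → ℝ} {T : ℝ}

theorem flipGrad_comp_shift_eq_zero {N : ℕ} {f : Config → ℝ} (hf : Loc N f) {y : ℤ}
    (hy : y ∉ box N) (ω : Config) : flipGrad 0 (fun η => f (shift y η)) ω = 0 := by
  have h1 := flip_shift y (-y) ω
  rw [add_neg_cancel] at h1
  have h2 : -y ∉ Set.Icc (-(N : ℤ)) N :=
    notMem_Icc_of_notMem_box le_rfl (mt neg_mem_box.1 hy)
  simp only [flipGrad, ← h1, hf.flip_eq h2, sub_self]

theorem rotation_comp_shift_eq_zero {N : ℕ} {f : Config → ℝ} (hf : Loc N f) {y : ℤ}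
    (hy : y ∉ box (N + 1)) (ω : Config) : rotation 0 (fun η => f (shift y η)) ω = 0 := by
  have h1 := rotation_comp_shift y (-y) f ω
  rw [add_neg_cancel] at h1
  rw [h1, hf.rotation_eq_zero le_rfl (mt neg_mem_box.1 hy)]

theorem Admissible.temperate_flipGrad (h : Admissible V T) {f : Config → ℝ}
    (hf : Temperate (gibbs V T) f) (z : ℤ) : Temperate (gibbs V T) (flipGrad z f) := by
  have := h.isProbabilityMeasure
  exact (hf.comp (h.measurePreserving_flip z)).sub hf

theorem MomTest.temperate_total_flipGrad (h : Admissible V T) {f : Config → ℝ}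
    (hf : MomTest (gibbs V T) f) (M : ℕ) : Temperate (gibbs V T) (total flipGrad M f) := by
  have := h.isProbabilityMeasure
  exact Temperate.sum _ fun y _ => h.temperate_flipGrad (hf.comp_shift y).mom.temp 0

theorem MomTest.temperate_total_rotation (h : Admissible V T) {f : Config → ℝ}
    (hf : MomTest (gibbs V T) f) (M : ℕ) : Temperate (gibbs V T) (total rotation M f) := by
  have := h.isProbabilityMeasure
  exact Temperate.sum _ fun y _ => h.temperate_rotation (hf.comp_shift y).mom 0

theorem flip_flip (z : ℤ) (ω : Config) : flip z (flip z ω) = ω := by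
  rw [← flipOn_singleton, flipOn_flipOn]

/-- The gradient `f(ω^z) - f(ω)` is odd under the flip at `z`, so only the odd part `-(1/2) flipGrad
z k` of `k` contributes. -/
theorem Admissible.integral_flipGrad_mul (h : Admissible V T) (z : ℤ) {f k : Config → ℝ}
    (hf : Temperate (gibbs V T) f) (hk : Temperate (gibbs V T) k) :
    ∫ ω, flipGrad z f ω * k ω ∂gibbs V T =
      -(1 / 2 * ∫ ω, flipGrad z f ω * flipGrad z k ω ∂gibbs V T) := by
  have := h.isProbabilityMeasure
  have tf := h.temperate_flipGrad hf z
  have tk := hk.comp (h.measurePreserving_flip z)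
  have h1 := h.integral_flip_mul z tf.meas hk.meas
  have h2 : ∀ ω, flipGrad z f (flip z ω) = -flipGrad z f ω := fun ω => by
    simp [flipGrad, flip_flip]
  have h3 : ∫ ω, flipGrad z f ω * flipGrad z k ω ∂gibbs V T =
      ∫ ω, flipGrad z f ω * k (flip z ω) ∂gibbs V T - ∫ ω, flipGrad z f ω * k ω ∂gibbs V T := by
    rw [← integral_sub (tf.mul tk).integrable (tf.mul hk).integrable]
    simp only [flipGrad, mul_sub]
  simp only [h2, neg_mul, integral_neg] at h1
  rw [h3, ← h1]; ring

theorem MomTest.sum_integral_flipNoise (h : Admissible V T) {N L : ℕ} {f k : Config → ℝ}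
    (hf : MomTest (gibbs V T) f) (hk : MomTest (gibbs V T) k) (hN : Loc N f) (hN' : Loc N k)
    (hL : 2 * N ≤ L) :
    ∑ x ∈ box L, ∫ ω, flipNoise f ω * k (shift x ω) ∂gibbs V T =
      -(1 / 2 * ∫ ω, total flipGrad N f ω * total flipGrad N k ω ∂gibbs V T) := by
  have := h.isProbabilityMeasure
  rw [← covariant_flipGrad.sum_integral_mul (L := N) le_rfl hL
    (fun y => h.temperate_flipGrad (hf.comp_shift y).mom.temp 0)
    (fun y => h.temperate_flipGrad (hk.comp_shift y).mom.temp 0)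
    (fun y hy => flipGrad_comp_shift_eq_zero hN hy)
    (fun y hy => flipGrad_comp_shift_eq_zero hN' hy), Finset.mul_sum, ← Finset.sum_neg_distrib]
  refine Finset.sum_congr rfl fun x _ => ?_
  rw [h.integral_flipNoise_mul le_rfl hN hf.mom.temp (hk.comp_shift x).mom.temp.tame,
    Finset.mul_sum, ← Finset.sum_neg_distrib]
  exact Finset.sum_congr rfl fun z _ =>
    h.integral_flipGrad_mul z hf.mom.temp (hk.comp_shift x).mom.temp

theorem MomTest.sum_integral_exchangeNoise (h : Admissible V T) {N L : ℕ} {f k : Config → ℝ}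
    (hf : MomTest (gibbs V T) f) (hk : MomTest (gibbs V T) k) (hN : Loc N f) (hN' : Loc N k)
    (hL : 2 * (N + 1) ≤ L) :
    ∑ x ∈ box L, ∫ ω, exchangeNoise f ω * k (shift x ω) ∂gibbs V T =
      -(1 / 2 * ∫ ω, total rotation (N + 1) f ω * total rotation (N + 1) k ω ∂gibbs V T) := by
  have := h.isProbabilityMeasure
  rw [← covariant_rotation.sum_integral_mul (L := N + 1) le_rfl hL
    (fun y => h.temperate_rotation (hf.comp_shift y).mom 0)
    (fun y => h.temperate_rotation (hk.comp_shift y).mom 0)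
    (fun y hy => rotation_comp_shift_eq_zero hN hy)
    (fun y hy => rotation_comp_shift_eq_zero hN' hy), Finset.mul_sum, ← Finset.sum_neg_distrib]
  refine Finset.sum_congr rfl fun x _ => ?_
  exact h.integral_exchangeNoise_mul le_rfl hN hf (hk.comp_shift x).mom.reg

/-! ### The three parts of the generator on local functions -/

/-- `𝔖 f` as a local function. -/
def MomTest.flipLocal (h : Admissible V T) {f : Config → ℝ} (hf : MomTest (gibbs V T) f) :
    LocalFun (siteMeasure V T) :=
  (hf.temperate_flipNoise h).toLocal (hf.loc.imp fun _ hN => hN.flipNoise)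

/-- `𝔖' f` as a local function. -/
def MomTest.exchangeLocal (h : Admissible V T) {f : Config → ℝ} (hf : MomTest (gibbs V T) f) :
    LocalFun (siteMeasure V T) :=
  (hf.temperate_exchangeNoise h).toLocal (hf.loc.elim fun _ hN => ⟨_, hN.exchangeNoise⟩)

/-- `𝔄 f` as a local function. -/
def TestLike.liouvilleLocal (h : Admissible V T) {f : Config → ℝ} (hf : TestLike (gibbs V T) f) :
    LocalFun (siteMeasure V T) :=
  (hf.temperate_liouville h).toLocal (hf.loc.elim fun _ hN => ⟨_, hN.liouville V⟩)

theorem exists_common_loc {ν : Measure (ℝ × ℝ)} (f g : LocalFun ν) :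
    ∃ N, Loc N f.fn ∧ Loc N g.fn := by
  obtain ⟨N, hN⟩ := f.exists_loc
  obtain ⟨M, hM⟩ := g.exists_loc
  exact ⟨max N M, hN.mono (le_max_left _ _), hM.mono (le_max_right _ _)⟩

variable {f k : LocalFun (siteMeasure V T)}

theorem inner_flipLocal (h : Admissible V T) (hf : MomTest (gibbs V T) f.fn)
    (hk : MomTest (gibbs V T) k.fn) {N : ℕ} (hN : Loc N f.fn) (hN' : Loc N k.fn) :
    inner ℝ (hf.flipLocal h) k =
      -(1 / 2 * ∫ ω, total flipGrad N f.fn ω * total flipGrad N k.fn ω ∂gibbs V T) := by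
  have := h.isProbabilityMeasure
  exact (semiInner_eq_sum_box (f := hf.flipLocal h) (g := k) (N := N) le_rfl hN.flipNoise hN'
    (Or.inl (hf.integral_flipNoise h))).trans (hf.sum_integral_flipNoise h hk hN hN' le_rfl)

theorem inner_exchangeLocal (h : Admissible V T) (hf : MomTest (gibbs V T) f.fn)
    (hk : MomTest (gibbs V T) k.fn) {N : ℕ} (hN : Loc N f.fn) (hN' : Loc N k.fn) :
    inner ℝ (hf.exchangeLocal h) k =
      -(1 / 2 * ∫ ω, total rotation (N + 1) f.fn ω * total rotation (N + 1) k.fn ω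
        ∂gibbs V T) := by
  have := h.isProbabilityMeasure
  exact (semiInner_eq_sum_box (f := hf.exchangeLocal h) (g := k) (N := N + 2) le_rfl
    hN.exchangeNoise (hN'.mono (by omega)) (Or.inl (hf.integral_exchangeNoise h))).trans
    (hf.sum_integral_exchangeNoise h hk hN hN' (by omega))

theorem inner_flipLocal_symm (h : Admissible V T) (hf : MomTest (gibbs V T) f.fn)
    (hk : MomTest (gibbs V T) k.fn) :
    inner ℝ (hf.flipLocal h) k = inner ℝ f (hk.flipLocal h) := by
  obtain ⟨N, hN, hN'⟩ := exists_common_loc f k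
  rw [real_inner_comm _ f, inner_flipLocal h hf hk hN hN', inner_flipLocal h hk hf hN' hN]
  simp only [mul_comm (total flipGrad N f.fn _)]

theorem inner_exchangeLocal_symm (h : Admissible V T) (hf : MomTest (gibbs V T) f.fn)
    (hk : MomTest (gibbs V T) k.fn) :
    inner ℝ (hf.exchangeLocal h) k = inner ℝ f (hk.exchangeLocal h) := by
  obtain ⟨N, hN, hN'⟩ := exists_common_loc f k
  rw [real_inner_comm _ f, inner_exchangeLocal h hf hk hN hN', inner_exchangeLocal h hk hf hN' hN]
  simp only [mul_comm (total rotation (N + 1) f.fn _)]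

/-- Antisymmetry of the Liouville operator, tested against a regular local function. -/
theorem inner_liouvilleLocal (h : Admissible V T) (hf : TestLike (gibbs V T) f.fn)
    (hkp : Reg (gibbs V T) false k.fn) (hkm : Reg (gibbs V T) true k.fn) {N L : ℕ}
    (hN : Loc N f.fn) (hN' : Loc N k.fn) (hL : 2 * (N + 2) ≤ L) :
    inner ℝ (hf.liouvilleLocal h) k =
      -∑ x ∈ box L, ∫ ω, f.fn ω * liouville V k.fn (shift x ω) ∂gibbs V T := by
  have := h.isProbabilityMeasure
  refine (semiInner_eq_sum_box (f := hf.liouvilleLocal h) (g := k) (N := N + 2) hL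
    (hN.liouville V) (hN'.mono (by omega)) (Or.inl (hf.integral_liouville h))).trans ?_
  rw [← Finset.sum_neg_distrib]
  refine Finset.sum_congr rfl fun x _ => ?_
  have h1 := h.integral_liouville_mul hf ⟨_, hN'.comp_shift x⟩ (hkp.comp_shift x)
    (hkm.comp_shift x)
  simp only [liouville_comp_shift] at h1
  exact h1

theorem inner_liouvilleLocal_antisymm (h : Admissible V T) (hf : TestLike (gibbs V T) f.fn)
    (hk : TestLike (gibbs V T) k.fn) :
    inner ℝ (hf.liouvilleLocal h) k = -inner ℝ f (hk.liouvilleLocal h) := by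
  have := h.isProbabilityMeasure
  obtain ⟨N, hN, hN'⟩ := exists_common_loc f k
  have e : inner ℝ f (hk.liouvilleLocal h) = _ :=
    semiInner_eq_sum_box (f := f) (g := hk.liouvilleLocal h) (N := N + 2) le_rfl
      (hN.mono (by omega)) (hN'.liouville V) (Or.inr (hk.integral_liouville h))
  rw [inner_liouvilleLocal h hf hk.pos.reg hk.mom.reg hN hN' le_rfl, e]
  rfl

/-! ### The spectral gap of the flip noise on odd functions -/

open Set in
/-- The operator `(1 - F_z)(1 - F_{<z})`, where `F_B` flips the momenta in `B`. -/
def halfGrad (z : ℤ) (f : Config → ℝ) (ω : Config) : ℝ :=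
  f ω - f (flip z ω) - f (flipOn (Iio z) ω) + f (flipOn (Iic z) ω)

theorem flip_flipOn_Iio (z : ℤ) (ω : Config) :
    flip z (flipOn (Set.Iio z) ω) = flipOn (Set.Iic z) ω := by
  rw [← flipOn_singleton, flipOn_flipOn_of_disjoint (by simp)]
  congr 1
  ext y; simp [le_iff_eq_or_lt]

theorem flipOn_Iio_flip (z : ℤ) (ω : Config) :
    flipOn (Set.Iio z) (flip z ω) = flipOn (Set.Iic z) ω := by
  rw [← flipOn_singleton, flipOn_flipOn_of_disjoint (by simp)]
  congr 1
  ext y; simp [le_iff_eq_or_lt]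

theorem flip_flipOn_Iic (z : ℤ) (ω : Config) :
    flip z (flipOn (Set.Iic z) ω) = flipOn (Set.Iio z) ω := by
  rw [← flip_flipOn_Iio, flip_flip]

theorem flipOn_Iic_flip (z : ℤ) (ω : Config) :
    flipOn (Set.Iic z) (flip z ω) = flipOn (Set.Iio z) ω := by
  rw [← flip_flipOn_Iio, flipOn_Iio_flip, flip_flipOn_Iic]

theorem flipOn_Iio_flipOn_Iic (z : ℤ) (ω : Config) :
    flipOn (Set.Iio z) (flipOn (Set.Iic z) ω) = flip z ω := by
  rw [← flipOn_Iio_flip, flipOn_flipOn]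

theorem flipOn_Iic_flipOn_Iio (z : ℤ) (ω : Config) :
    flipOn (Set.Iic z) (flipOn (Set.Iio z) ω) = flip z ω := by
  rw [← flip_flipOn_Iio, flipOn_flipOn]

theorem flipOn_Iio_shift (z : ℤ) (ω : Config) :
    flipOn (Set.Iio 0) (shift z ω) = shift z (flipOn (Set.Iio z) ω) := by
  rw [flipOn_shift]; simp

theorem flipOn_Iic_shift (z : ℤ) (ω : Config) :
    flipOn (Set.Iic 0) (shift z ω) = shift z (flipOn (Set.Iic z) ω) := by
  rw [flipOn_shift]; simp

/-- Half-lines are mapped to half-lines by translations. A finite interval with a fixed left end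
would break this covariance, on which the positivity argument depends. -/
theorem covariant_halfGrad : Covariant halfGrad := fun z f ω => by
  have h := flip_shift z 0 ω
  rw [add_zero] at h
  simp only [halfGrad, h, flipOn_Iio_shift, flipOn_Iic_shift]

theorem halfGrad_eq_flipGrad (z : ℤ) (f : Config → ℝ) (ω : Config) :
    halfGrad z f ω = flipGrad z f (flipOn (Set.Iio z) ω) - flipGrad z f ω := by
  simp only [halfGrad, flipGrad, flip_flipOn_Iio]; ring

theorem Admissible.temperate_halfGrad (h : Admissible V T) {f : Config → ℝ}
    (hf : Temperate (gibbs V T) f) (z : ℤ) : Temperate (gibbs V T) (halfGrad z f) := by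
  have := h.isProbabilityMeasure
  exact ((hf.sub (hf.comp (h.measurePreserving_flip z))).sub
    (hf.comp (h.measurePreserving_flipOn _))).add (hf.comp (h.measurePreserving_flipOn _))

/-- The flips of `{z}` and of `{y < z}` are commuting involutions preserving the measure, so `(1 -
F_z)/2` and `(1 - F_{<z})/2` are commuting orthogonal projections and `halfGrad z` is four times a
projection. -/
theorem Admissible.integral_halfGrad_mul (h : Admissible V T) (z : ℤ) {f k : Config → ℝ}
    (hf : Temperate (gibbs V T) f) (hk : Temperate (gibbs V T) k) :
    ∫ ω, halfGrad z f ω * k ω ∂gibbs V T =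
      1 / 4 * ∫ ω, halfGrad z f ω * halfGrad z k ω ∂gibbs V T := by
  have := h.isProbabilityMeasure
  have tf := h.temperate_halfGrad hf z
  have h1 := h.integral_flip_mul z tf.meas hk.meas
  have h2 := h.integral_flipOn_mul (Set.Iio z) tf.meas hk.meas
  have h3 := h.integral_flipOn_mul (Set.Iic z) tf.meas hk.meas
  have e1 : ∀ ω, halfGrad z f (flip z ω) = -halfGrad z f ω := fun ω => by
    simp only [halfGrad, flip_flip, flipOn_Iio_flip, flipOn_Iic_flip]; ring
  have e2 : ∀ ω, halfGrad z f (flipOn (Set.Iio z) ω) = -halfGrad z f ω := fun ω => by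
    simp only [halfGrad, flip_flipOn_Iio, flipOn_flipOn, flipOn_Iic_flipOn_Iio]; ring
  have e3 : ∀ ω, halfGrad z f (flipOn (Set.Iic z) ω) = halfGrad z f ω := fun ω => by
    simp only [halfGrad, flip_flipOn_Iic, flipOn_flipOn, flipOn_Iio_flipOn_Iic]; ring
  simp only [e1, e2, e3, neg_mul, integral_neg] at h1 h2 h3
  have i0 := (tf.mul hk).integrable
  have i1 := (tf.mul (hk.comp (h.measurePreserving_flip z))).integrable
  have i2 := (tf.mul (hk.comp (h.measurePreserving_flipOn (Set.Iio z)))).integrable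
  have i3 := (tf.mul (hk.comp (h.measurePreserving_flipOn (Set.Iic z)))).integrable
  have h4 : ∫ ω, halfGrad z f ω * halfGrad z k ω ∂gibbs V T =
      ∫ ω, halfGrad z f ω * k ω ∂gibbs V T - ∫ ω, halfGrad z f ω * k (flip z ω) ∂gibbs V T -
      ∫ ω, halfGrad z f ω * k (flipOn (Set.Iio z) ω) ∂gibbs V T +
      ∫ ω, halfGrad z f ω * k (flipOn (Set.Iic z) ω) ∂gibbs V T := by
    have i01 : Integrable (fun ω => halfGrad z f ω * k ω - halfGrad z f ω * k (flip z ω))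
      (gibbs V T) := i0.sub i1
    have i012 : Integrable (fun ω => halfGrad z f ω * k ω - halfGrad z f ω * k (flip z ω) -
      halfGrad z f ω * k (flipOn (Set.Iio z) ω)) (gibbs V T) := i01.sub i2
    rw [← integral_sub i0 i1, ← integral_sub i01 i2, ← integral_add i012 i3]
    refine integral_congr_ae (Eventually.of_forall fun ω => ?_)
    simp only [halfGrad]; ring
  rw [h4, ← h1, ← h2, ← h3]; ring

/-- Expanding the product gives `(1 - F_z) + (F_{≤z} - F_{<z})`. The first terms sum to `-𝔖 f`, and
the second telescope from no flip to the flip of every site in the support, that is, to `R f - f`.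
-/
theorem Loc.sum_halfGrad {N : ℕ} {f : Config → ℝ} (hf : Loc N f) (ω : Config) :
    ∑ z ∈ box N, halfGrad z f ω = -Chain.flipNoise f ω - (f ω - f (reverse ω)) := by
  have h1 : ∀ z, halfGrad z f ω = -(f (flip z ω) - f ω) +
      (f (flipOn (Set.Iio (z + 1)) ω) - f (flipOn (Set.Iio z) ω)) := fun z => by
    rw [show Set.Iio (z + 1) = Set.Iic z from Set.ext fun y => Int.lt_add_one_iff]
    simp only [halfGrad]; ring
  simp only [h1, Finset.sum_add_distrib, Finset.sum_neg_distrib, ← flipNoise_eq_sum le_rfl hf]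
  rw [sum_box_sub fun z => f (flipOn (Set.Iio z) ω)]
  have h2 : f (flipOn (Set.Iio (-(N : ℤ))) ω) = f ω :=
    hf.flipOn_eq (Set.disjoint_left.2 fun y h1 h2 => absurd h2.1 (not_le.2 h1)) ω
  have h3 : f (flipOn (Set.Iio ((N : ℤ) + 1)) ω) = f (reverse ω) := hf fun i hi => by
    have : i < (N : ℤ) + 1 := by have := hi.2; omega
    simp [flipOn, reverse, this]
  rw [h2, h3]; ring

theorem halfGrad_comp_shift_eq_zero {N : ℕ} {f : Config → ℝ} (hf : Loc N f) {y : ℤ}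
    (hy : y ∉ box N) (ω : Config) : halfGrad 0 (fun η => f (shift y η)) ω = 0 := by
  rw [halfGrad_eq_flipGrad, flipGrad_comp_shift_eq_zero hf hy, flipGrad_comp_shift_eq_zero hf hy,
    sub_zero]

/-- By `Loc.sum_halfGrad` the difference of the two sides is the form of `∑_z (1 - F_z)(1 -
F_{<z})`. Each summand is a nonnegative operator on `L²`; covariance makes the sum over translations
a quarter of the integral of the square of `total halfGrad N f.fn`. -/
theorem inner_sub_reverse_le (h : Admissible V T) (hf : MomTest (gibbs V T) f.fn) :
    inner ℝ (f - (have := h.isProbabilityMeasure;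
      reverseLin h.measurePreserving_neg_snd f)) f ≤ -inner ℝ (hf.flipLocal h) f := by
  have := h.isProbabilityMeasure
  obtain ⟨N, hN⟩ := f.exists_loc
  have hR : MeasurePreserving reverse (gibbs V T) (gibbs V T) :=
    h.measurePreserving_flipOn Set.univ
  set g := f - reverseLin h.measurePreserving_neg_snd f with hg
  have hgf : ∀ ω, g.fn ω = f.fn ω - f.fn (reverse ω) := fun ω => rfl
  have tg : Temperate (gibbs V T) g.fn := hf.mom.temp.sub (hf.mom.temp.comp hR)
  have hgl : Loc N g.fn := hN.sub (hN.comp_flipOn _)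
  have hg0 : ∫ ω, g.fn ω ∂gibbs V T = 0 := by
    simp only [hgf]
    rw [integral_sub hf.mom.temp.integrable (hf.mom.temp.comp hR).integrable]
    have := integral_comp_measurePreserving hR f.measurable
    exact sub_eq_zero.2 this.symm
  have h1 := covariant_halfGrad.sum_integral_mul (ν := siteMeasure V T) (L := N) (L' := 2 * N)
    le_rfl le_rfl
    (fun y => h.temperate_halfGrad (hf.comp_shift y).mom.temp 0)
    (fun y => h.temperate_halfGrad (hf.comp_shift y).mom.temp 0)
    (fun y hy => halfGrad_comp_shift_eq_zero hN hy)
    (fun y hy => halfGrad_comp_shift_eq_zero hN hy)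
  have h2 : 0 ≤ ∫ ω, total halfGrad N f.fn ω * total halfGrad N f.fn ω ∂gibbs V T :=
    integral_nonneg fun ω => mul_self_nonneg _
  rw [← h1] at h2
  have h3 : ∀ x, ∑ z ∈ box N, ∫ ω, halfGrad z f.fn ω * halfGrad z (fun η => f.fn (shift x η)) ω
      ∂gibbs V T = 4 * (-∫ ω, flipNoise f.fn ω * f.fn (shift x ω) ∂gibbs V T -
        ∫ ω, g.fn ω * f.fn (shift x ω) ∂gibbs V T) := by
    intro x
    have tx := (hf.comp_shift x).mom.temp
    have h4 : ∀ z, ∫ ω, halfGrad z f.fn ω * halfGrad z (fun η => f.fn (shift x η)) ω ∂gibbs V T =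
        4 * ∫ ω, halfGrad z f.fn ω * f.fn (shift x ω) ∂gibbs V T := fun z => by
      rw [h.integral_halfGrad_mul z hf.mom.temp tx]; ring
    simp only [h4, ← Finset.mul_sum]
    rw [← integral_finsetSum _ fun z _ =>
      ((h.temperate_halfGrad hf.mom.temp z).mul tx).integrable]
    simp only [← Finset.sum_mul, hN.sum_halfGrad, ← hgf, sub_mul, neg_mul]
    rw [integral_sub, integral_neg]
    · exact ((hf.temperate_flipNoise h).mul tx).integrable.neg
    · exact (tg.mul tx).integrable
  simp only [h3, ← Finset.mul_sum, Finset.sum_sub_distrib, Finset.sum_neg_distrib] at h2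
  have h5 : inner ℝ (hf.flipLocal h) f =
      ∑ x ∈ box (2 * N), ∫ ω, flipNoise f.fn ω * f.fn (shift x ω) ∂gibbs V T := by
    rw [inner_eq_semiInner]
    exact semiInner_eq_sum_box (N := N) le_rfl hN.flipNoise hN (Or.inl (hf.integral_flipNoise h))
  have h6 : inner ℝ g f = ∑ x ∈ box (2 * N), ∫ ω, g.fn ω * f.fn (shift x ω) ∂gibbs V T := by
    rw [inner_eq_semiInner]
    exact semiInner_eq_sum_box (N := N) le_rfl hgl hN (Or.inl hg0)
  change inner ℝ g f ≤ _
  rw [h5, h6]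
  linarith

end Forms

/-! ### Functions linear in the momenta -/

/-- Functions of the interparticle distances only. -/
def PosOnly (g : Config → ℝ) : Prop := ∀ ω η : Config, (∀ x, (ω x).1 = (η x).1) → g ω = g η

theorem posOnly_comp (g : ℝ → ℝ) (x : ℤ) : PosOnly fun ω => g (coord false x ω) :=
  fun _ _ h => congrArg g (h x)

theorem PosOnly.add {f g : Config → ℝ} (hf : PosOnly f) (hg : PosOnly g) :
    PosOnly fun ω => f ω + g ω := fun ω η h => by simp only [hf ω η h, hg ω η h]

theorem PosOnly.const_mul {g : Config → ℝ} (c : ℝ) (hg : PosOnly g) :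
    PosOnly fun ω => c * g ω := fun ω η h => by simp only [hg ω η h]

theorem PosOnly.line_eq {g : Config → ℝ} (hg : PosOnly g) (x : ℤ) (ω : Config) (t : ℝ) :
    g (line true x ω t) = g ω :=
  hg _ _ fun y => coord_line_of_dir_ne (d := true) (d' := false) (by simp) x y ω t

theorem PosOnly.flip_eq {g : Config → ℝ} (hg : PosOnly g) (x : ℤ) (ω : Config) :
    g (flip x ω) = g ω :=
  hg _ _ fun y => by
    by_cases h : y = x
    · subst h; simp [flip]
    · simp [flip, h]

theorem PosOnly.reverse_eq {g : Config → ℝ} (hg : PosOnly g) (ω : Config) :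
    g (reverse ω) = g ω := hg _ _ fun y => by rw [reverse_apply]

section Linear

variable {g : Config → ℝ}

theorem pd_coord_mul (hg : PosOnly g) (x y : ℤ) (ω : Config) :
    pd true y (fun ω => coord true x ω * g ω) ω = (if x = y then 1 else 0) * g ω := by
  simp only [pd, hg.line_eq]
  by_cases h : x = y
  · subst h; simp
  · simp [coord_line_of_ne true true h, h]

theorem rotation_coord_mul (hg : PosOnly g) (x y : ℤ) (ω : Config) :
    rotation y (fun ω => coord true x ω * g ω) ω =
      (coord true (y + 1) ω * (if x = y then 1 else 0) -
        coord true y ω * (if x = y + 1 then 1 else 0)) * g ω := by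
  rw [rotation_apply, pd_coord_mul hg, pd_coord_mul hg]; ring

/-- The field on the bond `(y, y+1)` acts on the plane spanned by `p_y`, `p_{y+1}` as an
infinitesimal rotation, whose square is `-1`. Only two bonds contain the site `x`. -/
theorem rotation_rotation_coord_mul (hg : PosOnly g) (x y : ℤ) (ω : Config) :
    rotation y (rotation y fun ω => coord true x ω * g ω) ω =
      if y = x ∨ y = x - 1 then -(coord true x ω * g ω) else 0 := by
  by_cases h1 : y = x
  · subst h1
    have e : rotation y (fun ω => coord true y ω * g ω) =
        fun ω => coord true (y + 1) ω * g ω := funext fun ω => by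
      rw [rotation_coord_mul hg]; simp
    rw [e, rotation_coord_mul hg]; simp
  · by_cases h2 : y = x - 1
    · obtain rfl : x = y + 1 := by omega
      have e : rotation y (fun ω => coord true (y + 1) ω * g ω) =
          fun ω => coord true y ω * (-1 * g ω) := funext fun ω => by
        rw [rotation_coord_mul hg]; simp
      rw [e, rotation_coord_mul (hg.const_mul _)]; simp
    · have e : rotation y (fun ω => coord true x ω * g ω) = fun _ => 0 := funext fun ω => by
        rw [rotation_coord_mul hg, if_neg (Ne.symm h1), if_neg (by omega)]; simp
      rw [e, rotation_zero]; simp [h1, h2]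

/-- Two bonds, each contributing `-1`, with the prefactor `1/2`. Together with the eigenvalue `-2`
of the flips this makes `-3`. -/
theorem exchangeNoise_coord_mul (hg : PosOnly g) (x : ℤ) (ω : Config) :
    exchangeNoise (fun ω => coord true x ω * g ω) ω = -(coord true x ω * g ω) := by
  have hne : x - 1 ≠ x := by omega
  unfold exchangeNoise
  rw [finsum_eq_sum_of_support_subset (s := {x - 1, x})]
  · rw [Finset.sum_pair hne, rotation_rotation_coord_mul hg, rotation_rotation_coord_mul hg,
      if_pos (Or.inr rfl), if_pos (Or.inl rfl)]
    ring
  · intro y hy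
    rw [Function.mem_support, rotation_rotation_coord_mul hg] at hy
    have : y = x ∨ y = x - 1 := by
      by_contra h
      exact hy (if_neg h)
    simp only [Finset.coe_insert, Finset.coe_singleton, Set.mem_insert_iff,
      Set.mem_singleton_iff]
    exact this.symm

theorem flipNoise_coord_mul (hg : PosOnly g) (x : ℤ) (ω : Config) :
    flipNoise (fun ω => coord true x ω * g ω) ω = -2 * (coord true x ω * g ω) := by
  unfold flipNoise
  rw [finsum_eq_single _ x]
  · simp only [hg.flip_eq]
    simp only [coord, flip, if_true, Function.update_self]; ring
  · intro y hy
    simp only [hg.flip_eq]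
    simp [coord, flip, Function.update_of_ne hy.symm]

theorem PosOnly.flipNoise_eq_zero (hg : PosOnly g) (ω : Config) : flipNoise g ω = 0 := by
  simp [flipNoise, hg.flip_eq]

theorem PosOnly.rotation_eq_zero (hg : PosOnly g) (x : ℤ) : rotation x g = fun _ => 0 := by
  funext ω
  rw [rotation_apply, pd_eq_zero_of_line (hg.line_eq x), pd_eq_zero_of_line (hg.line_eq _)]
  simp

theorem PosOnly.exchangeNoise_eq_zero (hg : PosOnly g) (ω : Config) : exchangeNoise g ω = 0 := by
  simp [exchangeNoise, hg.rotation_eq_zero, rotation_zero]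

end Linear

/-! ### The currents as eigenvectors of the noise -/

section Currents

variable {V : ℝ → ℝ} {T : ℝ}

theorem PosOnly.momTest {μ : Measure Config} [IsFiniteMeasure μ] {g : Config → ℝ}
    (hg : PosOnly g) (hl : ∃ N, Loc N g) (ht : Temperate μ g) : MomTest μ g := by
  refine ⟨hl, tReg_of_line ht hg.line_eq, fun x => ?_⟩
  rw [show pd true x g = fun _ => 0 from funext fun ω => pd_eq_zero_of_line (hg.line_eq x) ω]
  exact TReg.const 0

theorem Admissible.momTest_coord_mul (h : Admissible V T) {g : Config → ℝ} (hg : PosOnly g)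
    (hl : ∃ N, Loc N g) (ht : Temperate (gibbs V T) g) (x : ℤ) :
    MomTest (gibbs V T) fun ω => coord true x ω * g ω := by
  have := h.isProbabilityMeasure
  have hr := tReg_of_line ht hg.line_eq
  refine ⟨?_, (h.tReg_coord true x).mul hr, fun y => ?_⟩
  · obtain ⟨N, hN⟩ := hl
    exact ⟨max N x.natAbs, (loc_coord true (by simp only [Set.mem_Icc]; omega)).mul
      (hN.mono (le_max_left _ _))⟩
  · rw [show pd true y (fun ω => coord true x ω * g ω) = _ from funext (pd_coord_mul hg x y)]
    exact hr.const_mul _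

theorem loc_comp_coord (g : ℝ → ℝ) (d : Bool) (x : ℤ) :
    Loc x.natAbs fun ω => g (coord d x ω) :=
  (loc_coord d (by simp only [Set.mem_Icc]; omega)).comp_left g

theorem Admissible.momTest_coord_force (h : Admissible V T) (x y : ℤ) :
    MomTest (gibbs V T) fun ω => coord true x ω * deriv V (coord false y ω) :=
  h.momTest_coord_mul (posOnly_comp _ y) ⟨_, loc_comp_coord _ _ _⟩
    (h.temperate_comp_distance h.temperate_force y) x

/-- The local function `p_x V'(r_y)`. -/
def Admissible.momForce (h : Admissible V T) (x y : ℤ) : LocalFun (siteMeasure V T) :=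
  (h.momTest_coord_force x y).mom.temp.toLocal (h.momTest_coord_force x y).loc

theorem Admissible.fn_momForce (h : Admissible V T) (x y : ℤ) :
    (h.momForce x y).fn = fun ω => coord true x ω * deriv V (coord false y ω) := rfl

/-- The current `-p_0 V'(r_1)` as a local function. -/
def Admissible.currentLocal (h : Admissible V T) : LocalFun (siteMeasure V T) := -h.momForce 0 1

theorem Admissible.fn_currentLocal (h : Admissible V T) : h.currentLocal.fn = current V := rfl

/-- The current `-p_0 (V'(r_0) + V'(r_1)) / 2`. -/
def Admissible.siteCurrent (h : Admissible V T) : LocalFun (siteMeasure V T) :=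
  (-1 / 2 : ℝ) • h.momForce 0 0 + (1 / 2 : ℝ) • h.currentLocal

/-- The current `-(p_0 + p_1) V'(r_1) / 2`. -/
def Admissible.bondCurrent (h : Admissible V T) : LocalFun (siteMeasure V T) :=
  (-1 / 2 : ℝ) • h.momForce 1 1 + (1 / 2 : ℝ) • h.currentLocal

theorem Admissible.fn_siteCurrent (h : Admissible V T) : h.siteCurrent.fn = fun ω =>
    coord true 0 ω * (-1 / 2 * (deriv V (coord false 0 ω) + deriv V (coord false 1 ω))) := by
  funext ω
  change -1 / 2 * (coord true 0 ω * deriv V (coord false 0 ω)) +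
    1 / 2 * -(coord true 0 ω * deriv V (coord false 1 ω)) = _
  ring

theorem Admissible.fn_bondCurrent (h : Admissible V T) : h.bondCurrent.fn = fun ω =>
    -1 / 2 * (coord true 0 ω + coord true 1 ω) * deriv V (coord false 1 ω) := by
  funext ω
  change -1 / 2 * (coord true 1 ω * deriv V (coord false 1 ω)) +
    1 / 2 * -(coord true 0 ω * deriv V (coord false 1 ω)) = _
  ring

theorem Admissible.inner_momForce_one (h : Admissible V T) (f : LocalFun (siteMeasure V T)) :
    inner ℝ f (h.momForce 1 1) = inner ℝ f (h.momForce 0 0) := by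
  have := h.isProbabilityMeasure
  exact semiInner_comp_shift fun ω => by
    simp only [fn_momForce, coord_shift]; norm_num

/-- The two currents differ by a spatial gradient. The site form contains one momentum and is an
exact eigenfunction of the noise; the bond form contains one distance and suits the Liouville
operator. -/
theorem Admissible.inner_bondCurrent (h : Admissible V T) (f : LocalFun (siteMeasure V T)) :
    inner ℝ f h.bondCurrent = inner ℝ f h.siteCurrent := by
  simp only [bondCurrent, siteCurrent, inner_add_right, inner_smul_right, h.inner_momForce_one]

theorem Admissible.momTest_siteCurrent (h : Admissible V T) :
    MomTest (gibbs V T) h.siteCurrent.fn := by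
  have := h.isProbabilityMeasure
  have hF := h.temperate_comp_distance h.temperate_force
  rw [fn_siteCurrent]
  exact h.momTest_coord_mul (((posOnly_comp _ 0).add (posOnly_comp _ 1)).const_mul _)
    ⟨1, (((loc_comp_coord _ _ _).mono (by simp)).add (loc_comp_coord _ _ _)).const_mul _⟩
    (((hF 0).add (hF 1)).const_mul _) 0

theorem Admissible.flipLocal_siteCurrent (h : Admissible V T) :
    h.momTest_siteCurrent.flipLocal h = (-2 : ℝ) • h.siteCurrent :=
  LocalFun.ext_fn <| funext fun ω => by
    change flipNoise h.siteCurrent.fn ω = -2 * h.siteCurrent.fn ω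
    rw [fn_siteCurrent, flipNoise_coord_mul
      (((posOnly_comp _ 0).add (posOnly_comp _ 1)).const_mul _)]

theorem Admissible.exchangeLocal_siteCurrent (h : Admissible V T) :
    h.momTest_siteCurrent.exchangeLocal h = -h.siteCurrent :=
  LocalFun.ext_fn <| funext fun ω => by
    change exchangeNoise h.siteCurrent.fn ω = -h.siteCurrent.fn ω
    rw [fn_siteCurrent, exchangeNoise_coord_mul
      (((posOnly_comp _ 0).add (posOnly_comp _ 1)).const_mul _)]

/-! ### Second moments of the currents -/

theorem integral_mul_of_ne {ν : Measure (ℝ × ℝ)} [IsProbabilityMeasure ν] {F G : ℝ × ℝ → ℝ}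
    (hF : Measurable F) (hG : Measurable G) {x y : ℤ} (hxy : x ≠ y) :
    ∫ ω, F (ω x) * G (ω y) ∂productMeasure ν =
      (∫ ω, F (ω x) ∂productMeasure ν) * ∫ ω, G (ω y) ∂productMeasure ν := by
  have hFx : Measurable fun ω : Config => F (ω x) := hF.comp (measurable_pi_apply x)
  have hGy : Measurable fun ω : Config => G (ω y) := hG.comp (measurable_pi_apply y)
  have hind : IndepFun (fun ω : Config => F (ω x)) (fun ω => G (ω y)) (productMeasure ν) :=
    indepFun_of_dependsOn (s := {x}) (t := {y}) hFx hGy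
      (fun ω η h => congrArg F (h x (by simp))) (fun ω η h => congrArg G (h y (by simp)))
      (by simpa using hxy)
  exact hind.integral_fun_mul_eq_mul_integral hFx.aestronglyMeasurable hGy.aestronglyMeasurable

theorem Admissible.integral_site (h : Admissible V T) {F : ℝ × ℝ → ℝ} (hF : Measurable F) (x : ℤ) :
    ∫ ω, F (ω x) ∂gibbs V T = ∫ v, F v ∂siteMeasure V T := by
  have := h.isProbabilityMeasure
  exact integral_comp_measurePreserving (measurePreserving_eval x) hF

theorem Admissible.integral_mom_mul_distance (h : Admissible V T) {a b : ℝ → ℝ}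
    (ha : Measurable a) (hb : Measurable b) (x y : ℤ) :
    ∫ ω, a (coord true x ω) * b (coord false y ω) ∂gibbs V T =
      (∫ p, a p ∂gaussianReal 0 T.toNNReal) * ∫ r, b r ∂distanceMeasure V T := by
  have := h.isProbabilityMeasure
  have := h.isProbabilityMeasure_distance
  have ha' : Measurable fun v : ℝ × ℝ => a v.2 := ha.comp measurable_snd
  have hb' : Measurable fun v : ℝ × ℝ => b v.1 := hb.comp measurable_fst
  by_cases hxy : x = y
  · subst hxy
    refine (h.integral_site (ha'.mul hb') x).trans ?_
    simp only [Pi.mul_apply]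
    simp only [mul_comm (a _)]
    rw [mul_comm]
    exact integral_prod_mul (μ := distanceMeasure V T) b a
  · refine (integral_mul_of_ne ha' hb' hxy).trans ?_
    congr 1
    · refine (h.integral_site ha' x).trans ?_
      exact integral_comp_measurePreserving h.measurePreserving_snd ha
    · refine (h.integral_site hb' y).trans ?_
      exact integral_comp_measurePreserving h.measurePreserving_fst hb

theorem Admissible.integral_sq_gaussian (h : Admissible V T) :
    ∫ p, p * p ∂gaussianReal 0 T.toNNReal = T := by
  have h1 := variance_id_gaussianReal (μ := 0) (v := T.toNNReal)
  rw [variance_of_integral_eq_zero measurable_id.aemeasurable (by simp)] at h1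
  simpa [sq, Real.coe_toNNReal _ h.pos.le] using h1

theorem Admissible.integral_force (h : Admissible V T) :
    ∫ r, deriv V r ∂distanceMeasure V T = 0 := by
  have := h.isProbabilityMeasure_distance
  unfold distanceMeasure at *
  have h1 := integral_deriv_sub_eq_zero_tilted (g := fun _ => 1) h.pot.differentiable
    (differentiable_const 1) (integrable_const 1) (by
      simp only [deriv_const]
      simpa [distanceMeasure] using (h.temperate_force.integrable.div_const T).neg)
  simp only [deriv_const, zero_sub, mul_one, integral_neg, integral_div] at h1
  exact (div_eq_zero_iff.1 (neg_eq_zero.1 h1)).resolve_right h.pos.ne'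

/-- The mean square of the force at temperature `T`. -/
def forceSq (V : ℝ → ℝ) (T : ℝ) : ℝ := ∫ r, deriv V r * deriv V r ∂distanceMeasure V T

theorem forceSq_nonneg (V : ℝ → ℝ) (T : ℝ) : 0 ≤ forceSq V T :=
  integral_nonneg fun _ => mul_self_nonneg _

theorem measurable_force (V : ℝ → ℝ) : Measurable (deriv V) := measurable_deriv V

theorem Admissible.integral_momForce_mul (h : Admissible V T) (x y x' y' : ℤ) :
    ∫ ω, (h.momForce x y).fn ω * (h.momForce x' y').fn ω ∂gibbs V T =
      if x = x' ∧ y = y' then T * forceSq V T else 0 := by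
  have := h.isProbabilityMeasure
  have hm := measurable_force V
  simp only [fn_momForce]
  by_cases hx : x = x'
  · subst hx
    by_cases hy : y = y'
    · subst hy
      rw [if_pos ⟨rfl, rfl⟩]
      have h1 := h.integral_mom_mul_distance (a := fun p => p * p)
        (b := fun r => deriv V r * deriv V r) (measurable_id.mul measurable_id) (hm.mul hm) x y
      rw [h.integral_sq_gaussian] at h1
      refine Eq.trans ?_ h1
      refine integral_congr_ae (Eventually.of_forall fun ω => ?_)
      ring
    · rw [if_neg (by tauto)]
      -- The factor `V'(r_{y'})` has mean zero and is independent of the rest when no other factor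
      -- sits at the site `y'`. Of two distinct bonds at least one is not at the site `x` of the
      -- momentum.
      have key : ∀ {y y' : ℤ}, y ≠ y' → y' ≠ x →
          ∫ ω, coord true x ω * deriv V (coord false y ω) *
            (coord true x ω * deriv V (coord false y' ω)) ∂gibbs V T = 0 := by
        intro y y' hy hx
        have e : ∀ ω, coord true x ω * deriv V (coord false y ω) *
            (coord true x ω * deriv V (coord false y' ω)) =
            coord true x ω * (coord true x ω * deriv V (coord false y ω)) *
              deriv V (coord false y' ω) := fun ω => by ring
        simp only [e]
        have m1 : Measurable fun ω =>
            coord true x ω * (coord true x ω * deriv V (coord false y ω)) :=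
          (h.temperate_coord x).meas.mul (h.momTest_coord_force x y).mom.temp.meas
        have m2 := (h.temperate_comp_distance h.temperate_force y').meas
        have hind := indepFun_of_dependsOn (ν := siteMeasure V T) (s := {x, y}) (t := {y'}) m1 m2
          (fun ω η hω => by simp only [coord, hω x (by simp), hω y (by simp)])
          (fun ω η hω => by simp only [coord, hω y' (by simp)])
          (by simp [hx, Ne.symm hy])
        have h1 := h.integral_mom_mul_distance (a := fun _ => 1) measurable_const hm x y'
        rw [h.integral_force, mul_zero] at h1
        simp only [one_mul] at h1
        rw [hind.integral_fun_mul_eq_mul_integral m1.aestronglyMeasurable m2.aestronglyMeasurable,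
          h1, mul_zero]
      by_cases hy' : y' = x
      · have := key (Ne.symm hy) (by omega : y ≠ x)
        simpa only [mul_comm] using this
      · exact key hy hy'
  · rw [if_neg (by tauto)]
    have h1 := h.integral_coord_mul_eq_zero (x := x)
      (k := fun ω => deriv V (coord false y ω) * (coord true x' ω * deriv V (coord false y' ω)))
      (by
        have := (h.temperate_comp_distance h.temperate_force y).meas
        have := (h.momTest_coord_force x' y').mom.temp.meas
        fun_prop) (fun ω => by
          simp only [(posOnly_comp (deriv V) _).flip_eq]
          simp [coord, flip, Function.update_of_ne (Ne.symm hx)])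
    simpa only [mul_assoc] using h1

theorem Admissible.integral_momForce (h : Admissible V T) (x y : ℤ) :
    ∫ ω, (h.momForce x y).fn ω ∂gibbs V T = 0 := by
  have h1 := h.integral_mom_mul_distance (a := fun p => p) measurable_id (measurable_force V) x y
  rwa [h.integral_force, mul_zero] at h1

/-- Orthogonality leaves at most one translation in the sum, the one matching the momentum and the
bond simultaneously. -/
theorem Admissible.inner_momForce (h : Admissible V T) (x y x' y' : ℤ) :
    inner ℝ (h.momForce x y) (h.momForce x' y') =
      if x - x' = y - y' then T * forceSq V T else 0 := by
  have := h.isProbabilityMeasure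
  have hs : ∀ z ω, (h.momForce x' y').fn (shift z ω) = (h.momForce (z + x') (z + y')).fn ω :=
    fun z ω => by simp only [fn_momForce, coord_shift]
  have e : inner ℝ (h.momForce x y) (h.momForce x' y') =
      ∑' z : ℤ, if x = z + x' ∧ y = z + y' then T * forceSq V T else 0 :=
    tsum_congr fun z => by
      have h0 := h.integral_momForce x y
      have h1 := h.integral_momForce_mul x y (z + x') (z + y')
      rw [← h1]
      simp only [hs]
      rw [h0, zero_mul, sub_zero]
  rw [e]
  split_ifs with hxy
  · rw [tsum_eq_single (x - x') fun z hz => if_neg (by omega), if_pos (by omega)]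
  · rw [show (fun z : ℤ => if x = z + x' ∧ y = z + y' then T * forceSq V T else 0) = fun _ => 0
      from funext fun z => if_neg (by omega), tsum_zero]

theorem Admissible.inner_siteCurrent_self (h : Admissible V T) :
    inner ℝ h.siteCurrent h.siteCurrent = T * forceSq V T / 2 := by
  simp only [siteCurrent, currentLocal, inner_add_left, inner_add_right, inner_smul_left,
    inner_smul_right, inner_neg_left, inner_neg_right, h.inner_momForce]
  norm_num; ring

theorem Admissible.inner_currentLocal_bondCurrent (h : Admissible V T) :
    inner ℝ h.currentLocal h.bondCurrent = T * forceSq V T / 2 := by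
  simp only [bondCurrent, currentLocal, inner_add_right,
    inner_smul_right, inner_neg_left, inner_neg_right, h.inner_momForce]
  norm_num; ring

end Currents

/-! ### Time reversal, the Dirichlet form and the sector bound -/

section GeneratorForms

variable {V : ℝ → ℝ} {T : ℝ} {f k : LocalFun (siteMeasure V T)}

/-- Reversal of momenta as an operator on the local functions of the Gibbs measure. -/
def Admissible.rev (h : Admissible V T) : LocalFun (siteMeasure V T) →L[ℝ] LocalFun (siteMeasure V T) :=
  have := h.isProbabilityMeasure
  reverseCLM h.measurePreserving_neg_snd

theorem Admissible.inner_rev (h : Admissible V T) (f g : LocalFun (siteMeasure V T)) :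
    inner ℝ (h.rev f) (h.rev g) = inner ℝ f g := by
  have := h.isProbabilityMeasure
  exact inner_reverseLin h.measurePreserving_neg_snd f g

/-- `𝔏' f` as a local function. -/
def TestLike.genLocal (h : Admissible V T) (γ : ℝ) {f : Config → ℝ} (hf : TestLike (gibbs V T) f) :
    LocalFun (siteMeasure V T) :=
  hf.liouvilleLocal h + γ • (hf.flipLocal h + hf.exchangeLocal h)

theorem TestLike.rev (h : Admissible V T) (hf : TestLike (gibbs V T) f.fn) :
    TestLike (gibbs V T) (h.rev f).fn := by
  have := h.isProbabilityMeasure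
  exact hf.comp_reverse h.measurePreserving_neg_snd

/-- The Liouville operator is antisymmetric and anticommutes with reversal, while the noise is
symmetric and commutes with it. In both cases the two signs compensate. -/
theorem inner_genLocal_rev (h : Admissible V T) (γ : ℝ) (hf : TestLike (gibbs V T) f.fn)
    (hk : TestLike (gibbs V T) k.fn) :
    inner ℝ (hf.genLocal h γ) (h.rev k) = inner ℝ f (h.rev (hk.genLocal h γ)) := by
  have e1 : (hk.rev h).liouvilleLocal h = -h.rev (hk.liouvilleLocal h) :=
    LocalFun.ext_fn <| funext fun ω => liouville_comp_reverse V k.fn ω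
  have e2 : (hk.rev h).flipLocal h = h.rev (hk.flipLocal h) :=
    LocalFun.ext_fn <| funext fun ω => flipNoise_comp_reverse k.fn ω
  have e3 : (hk.rev h).exchangeLocal h = h.rev (hk.exchangeLocal h) :=
    LocalFun.ext_fn <| funext fun ω => exchangeNoise_comp_reverse k.fn ω
  simp only [TestLike.genLocal, map_add, map_smul, inner_add_left, inner_add_right,
    inner_smul_left, inner_smul_right]
  rw [inner_liouvilleLocal_antisymm h hf (hk.rev h), e1,
    inner_flipLocal_symm h hf.toMomTest (hk.rev h).toMomTest, e2,
    inner_exchangeLocal_symm h hf.toMomTest (hk.rev h).toMomTest, e3, inner_neg_right, neg_neg]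
  rfl

/-- The Dirichlet form of the generator. -/
theorem neg_inner_genLocal (h : Admissible V T) (γ : ℝ) (hf : TestLike (gibbs V T) f.fn) :
    -inner ℝ (hf.genLocal h γ) f =
      γ * (-inner ℝ (hf.flipLocal h) f + -inner ℝ (hf.exchangeLocal h) f) := by
  have h0 : inner ℝ (hf.liouvilleLocal h) f = 0 := by
    have h1 := inner_liouvilleLocal_antisymm h hf hf
    have h2 := real_inner_comm f (hf.liouvilleLocal h)
    linarith
  simp only [TestLike.genLocal, inner_add_left, inner_smul_left, h0]
  simp; ring

theorem neg_inner_flipLocal_nonneg (h : Admissible V T) (hf : MomTest (gibbs V T) f.fn) :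
    0 ≤ -inner ℝ (hf.flipLocal h) f := by
  obtain ⟨N, hN⟩ := f.exists_loc
  rw [inner_flipLocal h hf hf hN hN, neg_neg]
  exact mul_nonneg (by norm_num) (integral_nonneg fun _ => mul_self_nonneg _)

theorem neg_inner_exchangeLocal_nonneg (h : Admissible V T) (hf : MomTest (gibbs V T) f.fn) :
    0 ≤ -inner ℝ (hf.exchangeLocal h) f := by
  obtain ⟨N, hN⟩ := f.exists_loc
  rw [inner_exchangeLocal h hf hf hN hN, neg_neg]
  exact mul_nonneg (by norm_num) (integral_nonneg fun _ => mul_self_nonneg _)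

/-- Reversal is an isometry, so the squared norm is `2 ≪f - R f, f≫`, to which the gap of the flip
noise applies; the exchange noise only adds dissipation. -/
theorem norm_sub_rev_sq_le (h : Admissible V T) {γ : ℝ} (hγ : 0 < γ)
    (hf : TestLike (gibbs V T) f.fn) :
    γ * ‖f - h.rev f‖ ^ 2 ≤ 2 * -inner ℝ (hf.genLocal h γ) f := by
  have h1 : inner ℝ (f - h.rev f) f ≤ -inner ℝ (hf.flipLocal h) f :=
    inner_sub_reverse_le h hf.toMomTest
  have h2 : ‖f - h.rev f‖ ^ 2 = 2 * inner ℝ (f - h.rev f) f := by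
    have h3 := h.inner_rev f f
    rw [← real_inner_self_eq_norm_sq]
    simp only [inner_sub_left, inner_sub_right, h3, real_inner_comm f (h.rev f)]
    ring
  have h4 := neg_inner_exchangeLocal_nonneg h hf.toMomTest
  rw [h2, neg_inner_genLocal]
  nlinarith

/-- For the Dirichlet form `D` of `𝔖 + 𝔖'` the eigenvalue `-3` gives `D(f, s) = 3 ≪f, s≫` and `D(s,
s) = 3 ≪s, s≫` with `s` the site current. Then `D(f, s)² ≤ D(f, f) D(s, s)` is the claim, and the
Liouville part is absent from the energy. -/
theorem sector_bound (h : Admissible V T) {γ : ℝ} (hγ : 0 < γ) (hf : TestLike (gibbs V T) f.fn) :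
    3 * γ * inner ℝ f h.bondCurrent ^ 2 ≤
      T * forceSq V T / 2 * -inner ℝ (hf.genLocal h γ) f := by
  have := h.isProbabilityMeasure
  rw [h.inner_bondCurrent, neg_inner_genLocal]
  set s := h.siteCurrent with hs
  have ms := h.momTest_siteCurrent
  obtain ⟨N, hN, hN'⟩ := exists_common_loc f s
  have a1 := inner_flipLocal h ms hf.toMomTest hN' hN
  have a2 := inner_exchangeLocal h ms hf.toMomTest hN' hN
  have b1 := inner_flipLocal h ms ms hN' hN'
  have b2 := inner_exchangeLocal h ms ms hN' hN'
  have c1 := inner_flipLocal h hf.toMomTest hf.toMomTest hN hN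
  have c2 := inner_exchangeLocal h hf.toMomTest hf.toMomTest hN hN
  rw [h.flipLocal_siteCurrent, inner_smul_left] at a1 b1
  rw [h.exchangeLocal_siteCurrent, inner_neg_left] at a2 b2
  rw [h.inner_siteCurrent_self] at b1 b2
  rw [← hs] at a1 a2
  rw [real_inner_comm] at a1 a2
  simp only [conj_trivial] at a1 b1
  have cs := sq_integral_mul_add_le (ms.temperate_total_flipGrad h N).memLp_two
    (hf.temperate_total_flipGrad h N).memLp_two (ms.temperate_total_rotation h (N + 1)).memLp_two
    (hf.temperate_total_rotation h (N + 1)).memLp_two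
  rw [← hs] at *
  -- The `L²` representation carries a factor `1/2`, so the eigenvalues `2` and `1` appear as `4`
  -- and `2`, with sum `6`.
  have d1 : ∫ ω, total flipGrad N s.fn ω * total flipGrad N f.fn ω ∂gibbs V T +
      ∫ ω, total rotation (N + 1) s.fn ω * total rotation (N + 1) f.fn ω ∂gibbs V T =
      6 * inner ℝ f s := by linarith
  have d2 : ∫ ω, total flipGrad N s.fn ω * total flipGrad N s.fn ω ∂gibbs V T +
      ∫ ω, total rotation (N + 1) s.fn ω * total rotation (N + 1) s.fn ω ∂gibbs V T =
      3 * (T * forceSq V T) := by linarith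
  have d3 : ∫ ω, total flipGrad N f.fn ω * total flipGrad N f.fn ω ∂gibbs V T +
      ∫ ω, total rotation (N + 1) f.fn ω * total rotation (N + 1) f.fn ω ∂gibbs V T =
      2 * (-inner ℝ (hf.flipLocal h) f + -inner ℝ (hf.exchangeLocal h) f) := by linarith
  rw [d1, d2, d3] at cs
  nlinarith

/-! ### The potential energy of a bond -/

theorem Admissible.testLike_pot (h : Admissible V T) :
    TestLike (gibbs V T) fun ω => V (coord false 1 ω) := by
  have := h.isProbabilityMeasure
  refine ⟨(posOnly_comp V 1).momTest ⟨_, loc_comp_coord V false 1⟩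
    (h.temperate_comp_distance h.temperate_pot 1), h.temperate_comp_distance h.temperate_pot 1,
    fun x ω => differentiable_coord_comp h.pot.differentiable x 1 ω, fun x => ?_⟩
  by_cases hx : (1 : ℤ) = x
  · subst hx
    rw [show pd false 1 (fun ω => V (coord false 1 ω)) = fun ω => deriv V (coord false 1 ω) from
      funext (pd_coord_comp_self 1)]
    exact h.temperate_comp_distance h.temperate_force 1
  · rw [show pd false x (fun ω => V (coord false 1 ω)) = fun _ => 0 from
      funext (pd_coord_comp_of_ne hx)]
    exact Temperate.const 0

/-- The potential energy `V(r_1)` as a local function. -/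
def Admissible.potLocal (h : Admissible V T) : LocalFun (siteMeasure V T) :=
  h.testLike_pot.mom.temp.toLocal h.testLike_pot.loc

theorem liouville_pot (V : ℝ → ℝ) (ω : Config) :
    liouville V (fun ω => V (coord false 1 ω)) ω =
      (coord true 1 ω - coord true 0 ω) * deriv V (coord false 1 ω) := by
  unfold liouville
  rw [finsum_eq_single _ 1]
  · rw [partialR_eq_pd, partialP_eq_pd, pd_coord_comp_self,
      pd_eq_zero_of_line ((posOnly_comp V 1).line_eq 1)]
    simp [coord]
  · intro x hx
    rw [partialR_eq_pd, partialP_eq_pd, pd_coord_comp_of_ne hx.symm,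
      pd_eq_zero_of_line ((posOnly_comp V 1).line_eq x)]
    simp

/-- The part of the current which is a total derivative in time. -/
def Admissible.exactCurrent (h : Admissible V T) : LocalFun (siteMeasure V T) :=
  h.momForce 1 1 + h.currentLocal

theorem Admissible.liouvilleLocal_pot (h : Admissible V T) :
    TestLike.liouvilleLocal (f := h.potLocal.fn) h h.testLike_pot = h.exactCurrent :=
  LocalFun.ext_fn <| funext fun ω => by
    refine (liouville_pot V ω).trans ?_
    change _ = coord true 1 ω * deriv V (coord false 1 ω) +
      -(coord true 0 ω * deriv V (coord false 1 ω))
    ring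

theorem Admissible.currentLocal_eq (h : Admissible V T) :
    h.currentLocal = h.bondCurrent + (1 / 2 : ℝ) • h.exactCurrent := by
  simp only [bondCurrent, exactCurrent]
  module

/-- The noise annihilates `V(r_1)` and is symmetric, so in `≪V(r_1), 𝔏' f≫` only the Liouville part
survives; by antisymmetry it falls on `V(r_1)` and produces the exact current. -/
theorem inner_exactCurrent (h : Admissible V T) (γ : ℝ) (hf : TestLike (gibbs V T) f.fn) :
    inner ℝ h.exactCurrent f = -inner ℝ h.potLocal (hf.genLocal h γ) := by
  have hp : TestLike (gibbs V T) h.potLocal.fn := h.testLike_pot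
  have e1 : hp.flipLocal h = 0 :=
    LocalFun.ext_fn <| funext fun ω => (posOnly_comp V 1).flipNoise_eq_zero ω
  have e2 : hp.exchangeLocal h = 0 :=
    LocalFun.ext_fn <| funext fun ω => (posOnly_comp V 1).exchangeNoise_eq_zero ω
  have h1 := inner_liouvilleLocal_antisymm h hp hf
  have h2 := inner_flipLocal_symm h hp.toMomTest hf.toMomTest
  have h3 := inner_exchangeLocal_symm h hp.toMomTest hf.toMomTest
  rw [e1, inner_zero_left] at h2
  rw [e2, inner_zero_left] at h3
  rw [h.liouvilleLocal_pot] at h1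
  simp only [TestLike.genLocal, inner_add_right, inner_smul_right, ← h2, ← h3, h1]
  ring

theorem Admissible.rev_currentLocal (h : Admissible V T) : h.rev h.currentLocal = -h.currentLocal :=
  LocalFun.ext_fn <| funext fun ω => by
    change -(coord true 0 (reverse ω) * deriv V (coord false 1 (reverse ω))) =
      - -(coord true 0 ω * deriv V (coord false 1 ω))
    rw [coord_true_reverse, coord_false_reverse]; ring

/-- Parity: the potential energy is even and the current odd under reversal of momenta. -/
theorem Admissible.inner_potLocal_currentLocal (h : Admissible V T) :
    inner ℝ h.potLocal h.currentLocal = 0 := by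
  have h1 := h.inner_rev h.potLocal h.currentLocal
  have h2 : h.rev h.potLocal = h.potLocal :=
    LocalFun.ext_fn <| funext fun ω => (posOnly_comp V 1).reverse_eq ω
  rw [h2, h.rev_currentLocal, inner_neg_right] at h1
  linarith

end GeneratorForms

/-! ### The generator applied to the current -/

section Stiffness

variable {V : ℝ → ℝ} {T : ℝ} {f : LocalFun (siteMeasure V T)}

/-- The mean square of the second derivative of the potential at temperature `T`. -/
def stiffnessSq (V : ℝ → ℝ) (T : ℝ) : ℝ :=
  ∫ r, deriv (deriv V) r * deriv (deriv V) r ∂distanceMeasure V T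

/-- The function `p_0 p_1 V''(r_1)`. -/
def stiffness (V : ℝ → ℝ) (ω : Config) : ℝ :=
  coord true 0 ω * coord true 1 ω * deriv (deriv V) (coord false 1 ω)

/-- The function `V'(r_0) V'(r_1)`. -/
def forceProd (V : ℝ → ℝ) (ω : Config) : ℝ :=
  deriv V (coord false 0 ω) * deriv V (coord false 1 ω)

theorem Admissible.reg_distance_mom (h : Admissible V T) {g : ℝ → ℝ} (hm : Measurable g)
    (hg : MemLp g 2 (distanceMeasure V T)) (y : ℤ) :
    Reg (gibbs V T) true fun ω => g (coord false y ω) := by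
  have := h.isProbabilityMeasure
  refine ⟨h.tame_comp_distance hm hg y, fun x ω => by
    simp only [(posOnly_comp g y).line_eq]; exact differentiable_const _, fun x => ?_⟩
  rw [show pd true x (fun ω => g (coord false y ω)) = fun _ => 0 from
    funext fun ω => pd_eq_zero_of_line ((posOnly_comp g y).line_eq x) ω]
  exact (Temperate.const 0).tame

theorem Admissible.reg_stiffness (h : Admissible V T)
    (h2 : MemLp (deriv (deriv V)) 2 (distanceMeasure V T)) :
    Reg (gibbs V T) true (stiffness V) :=
  ((h.tReg_coord true 0).mul (h.tReg_coord true 1)).mul_reg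
    (h.reg_distance_mom (measurable_deriv _) h2 1)

theorem Admissible.integral_stiffness_sq (h : Admissible V T) :
    ∫ ω, stiffness V ω * stiffness V ω ∂gibbs V T = T ^ 2 * stiffnessSq V T := by
  have := h.isProbabilityMeasure
  have hm : Measurable (deriv (deriv V)) := measurable_deriv _
  have hF : Measurable fun v : ℝ × ℝ => v.2 * v.2 := by fun_prop
  have hG : Measurable fun v : ℝ × ℝ =>
      v.2 * v.2 * (deriv (deriv V) v.1 * deriv (deriv V) v.1) := by fun_prop
  have h1 := integral_mul_of_ne (ν := siteMeasure V T) hF hG (zero_ne_one (α := ℤ))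
  have h2 := h.integral_mom_mul_distance (a := fun p => p * p)
    (b := fun r => deriv (deriv V) r * deriv (deriv V) r)
    (measurable_id.mul measurable_id) (hm.mul hm) 1 1
  have h3 := h.integral_mom_mul_distance (a := fun p => p * p)
    (b := fun r => 1) (measurable_id.mul measurable_id) measurable_const 0 0
  have := h.isProbabilityMeasure_distance
  rw [h.integral_sq_gaussian] at h2 h3
  simp only [mul_one, integral_const, probReal_univ, smul_eq_mul] at h3
  refine Eq.trans ?_ (h1.trans ((congrArg₂ (· * ·) h3 h2).trans ?_))
  · refine integral_congr_ae (Eventually.of_forall fun ω => ?_)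
    simp only [stiffness, coord, if_true]
    simp; ring
  · simp only [stiffnessSq]; ring

theorem Admissible.memLp_stiffness (h : Admissible V T)
    (h2 : MemLp (deriv (deriv V)) 2 (distanceMeasure V T)) :
    MemLp (stiffness V) 2 (gibbs V T) := by
  have := h.isProbabilityMeasure
  have hm : Measurable (deriv (deriv V)) := measurable_deriv _
  have hmeas : Measurable (stiffness V) := (h.reg_stiffness h2).tame.meas
  rw [memLp_two_iff_integrable_sq hmeas.aestronglyMeasurable]
  have hb : Integrable (fun v : ℝ × ℝ => deriv (deriv V) v.1 ^ 2 * v.2 ^ 2) (siteMeasure V T) := by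
    have := h.isProbabilityMeasure_distance
    refine Integrable.mul_prod (μ := distanceMeasure V T) (f := fun r => deriv (deriv V) r ^ 2)
      (g := fun p => p ^ 2) ?_ ?_
    · exact (memLp_two_iff_integrable_sq hm.aestronglyMeasurable).1 h2
    · have := (temperate_gaussian (T := T)).moments 2
      simpa using this
  have hb1 : Integrable (fun ω : Config => deriv (deriv V) (ω 1).1 ^ 2 * (ω 1).2 ^ 2)
      (gibbs V T) := (measurePreserving_eval (ν := siteMeasure V T) 1).integrable_comp_of_integrable hb
  have hb0 : Integrable (fun ω : Config => (ω 0).2 ^ 2) (gibbs V T) := by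
    have := (h.temperate_coord 0).moments 2
    simpa [coord] using this
  have hind : IndepFun (fun ω : Config => (ω 0).2 ^ 2)
      (fun ω => deriv (deriv V) (ω 1).1 ^ 2 * (ω 1).2 ^ 2) (gibbs V T) :=
    indepFun_of_dependsOn (s := {0}) (t := {1}) (by fun_prop) (by fun_prop)
      (fun ω η hω => by simp only [hω 0 (by simp)]) (fun ω η hω => by simp only [hω 1 (by simp)])
      (by simp)
  refine (hind.integrable_mul hb0 hb1).congr (Eventually.of_forall fun ω => ?_)
  simp only [stiffness, coord, Pi.mul_apply]
  simp; ring

/-- Differentiating `V'(r_1)` produces `-(p_1² - p_0²) V''(r_1) / 2`, and `(p_1² - p_0²) V''(r_1)`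
is the rotation field of the bond `(0, 1)` applied to `p_0 p_1 V''(r_1)`. Differentiating the
momenta produces a discrete gradient of `V'(r_0) V'(r_1)`, which does not count in `𝓗`. -/
theorem liouville_bondCurrent (h : Admissible V T) (ω : Config) :
    liouville V h.bondCurrent.fn ω =
      -1 / 2 * rotation 0 (stiffness V) ω -
        1 / 2 * (forceProd V (shift 1 ω) - forceProd V ω) := by
  have := h.isProbabilityMeasure
  have hd := h.pot.differentiable_deriv
  have hp : ∀ x ω, pd true x h.bondCurrent.fn ω =
      -1 / 2 * ((if 0 = x then 1 else 0) + (if 1 = x then 1 else 0)) *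
        deriv V (coord false 1 ω) := fun x ω => by
    have e : h.bondCurrent.fn = fun ω => -1 / 2 * (coord true 0 ω * deriv V (coord false 1 ω)) +
        -1 / 2 * (coord true 1 ω * deriv V (coord false 1 ω)) := by
      rw [h.fn_bondCurrent]; funext ω; ring
    have m0 := ((h.momTest_coord_force 0 1).mom.const_mul (-1 / 2)).diff
    have m1 := ((h.momTest_coord_force 1 1).mom.const_mul (-1 / 2)).diff
    rw [e, pd_add m0 m1, pd_const_mul, pd_const_mul, pd_coord_mul (posOnly_comp _ _),
      pd_coord_mul (posOnly_comp _ _)]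
    ring
  have hr : ∀ x ω, pd false x h.bondCurrent.fn ω =
      -1 / 2 * (coord true 0 ω + coord true 1 ω) *
        (if 1 = x then deriv (deriv V) (coord false 1 ω) else 0) := fun x ω => by
    have c : ∀ y t, coord true y (line false x ω t) = coord true y ω := fun y t =>
      coord_line_of_dir_ne (by simp) x y ω t
    by_cases hx : (1 : ℤ) = x
    · subst hx
      rw [h.fn_bondCurrent, if_pos rfl]
      simp only [pd, c, coord_line]
      rw [deriv_const_mul _ (hd _)]
    · rw [h.fn_bondCurrent, if_neg hx]
      simp only [pd, c, coord_line_of_ne false false hx, deriv_const, mul_zero]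
  have hs : rotation 0 (stiffness V) ω = (coord true 1 ω * coord true 1 ω -
      coord true 0 ω * coord true 0 ω) * deriv (deriv V) (coord false 1 ω) := by
    have e0 : rotation 0 (stiffness V) ω = coord true 1 ω * pd true 0 (stiffness V) ω -
      coord true 0 ω * pd true 1 (stiffness V) ω := rfl
    have l1 : ∀ t, stiffness V (line true 0 ω t) =
        t * (coord true 1 ω * deriv (deriv V) (coord false 1 ω)) := fun t => by
      simp only [stiffness, coord_line]
      rw [coord_line_of_ne true true (by norm_num), coord_line_of_dir_ne (by simp)]; ring
    have l2 : ∀ t, stiffness V (line true 1 ω t) =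
        t * (coord true 0 ω * deriv (deriv V) (coord false 1 ω)) := fun t => by
      simp only [stiffness, coord_line]
      rw [coord_line_of_ne true true (by norm_num), coord_line_of_dir_ne (by simp)]; ring
    rw [e0]
    simp only [pd, l1, l2, deriv_mul_const_field, deriv_id'']
    ring
  have hl : liouville V h.bondCurrent.fn ω = ∑ x ∈ box 1,
      ((coord true x ω - coord true (x - 1) ω) * pd false x h.bondCurrent.fn ω +
        (deriv V (coord false (x + 1) ω) - deriv V (coord false x ω)) *
          pd true x h.bondCurrent.fn ω) := by
    refine finsum_eq_sum_box fun x hx => ?_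
    rw [partialR_eq_pd, partialP_eq_pd, hp, hr, if_neg, if_neg, if_neg]
    · simp
    all_goals rintro rfl; simp [box] at hx
  rw [hl, show box 1 = {-1, 0, 1} from rfl]
  simp only [hp, hr, hs, forceProd, coord_shift]
  norm_num
  ring

/-- Gradients vanish in the form: both ends of the telescoping sum are so far out that they equal
the product of the means. -/
theorem Admissible.sum_integral_telescope (h : Admissible V T) {f c : Config → ℝ}
    (hf : Temperate (gibbs V T) f) (hc : Temperate (gibbs V T) c) {N L : ℕ} (hN : Loc N f)
    (hN' : Loc N c) (hL : 2 * N < L) :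
    ∑ x ∈ box L, ∫ ω, f ω * (c (shift (x + 1) ω) - c (shift x ω)) ∂gibbs V T = 0 := by
  have := h.isProbabilityMeasure
  have hi : ∀ x, Integrable (fun ω => f ω * c (shift x ω)) (gibbs V T) := fun x =>
    (hf.mul (hc.comp (measurePreserving_shift x))).integrable
  have e : ∀ x : ℤ, ∫ ω, f ω * (c (shift (x + 1) ω) - c (shift x ω)) ∂gibbs V T =
      ∫ ω, f ω * c (shift (x + 1) ω) ∂gibbs V T - ∫ ω, f ω * c (shift x ω) ∂gibbs V T := fun x => by
    rw [← integral_sub (hi _) (hi _)]; simp only [mul_sub]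
  simp only [e]
  rw [sum_box_sub fun x => ∫ ω, f ω * c (shift x ω) ∂gibbs V T,
    integral_mul_shift_of_far hf.meas hc.meas hN hN',
    integral_mul_shift_of_far hf.meas hc.meas hN hN', sub_self]
  · rw [abs_neg, abs_of_nonneg (by omega)]; omega
  · rw [abs_of_nonneg (by omega)]; omega

/-- As `bondCurrent` has eigenvalue `-3` under the noise, the left side is `≪𝔄 f, j_s≫² = ≪f, 𝔄
j_s≫²`. Moving the rotation from `p_0 p_1 V''(r_1)` to `f` leaves half the pairing of this function
with the total rotation of `f`, which the exchange part of the Dirichlet form controls. -/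
theorem stiffness_bound (h : Admissible V T) {γ : ℝ} (hγ : 0 < γ)
    (h2 : MemLp (deriv (deriv V)) 2 (distanceMeasure V T)) (hf : TestLike (gibbs V T) f.fn) :
    (inner ℝ (hf.genLocal h γ) h.bondCurrent + 3 * γ * inner ℝ f h.bondCurrent) ^ 2 ≤
      T ^ 2 * stiffnessSq V T / (2 * γ) * -inner ℝ (hf.genLocal h γ) f := by
  have := h.isProbabilityMeasure
  obtain ⟨N, hNf, hNb⟩ := exists_common_loc f h.bondCurrent
  have hF := h.temperate_force
  -- the symmetric part cancels
  have e1 : inner ℝ (hf.genLocal h γ) h.bondCurrent + 3 * γ * inner ℝ f h.bondCurrent =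
      inner ℝ (hf.liouvilleLocal h) h.bondCurrent := by
    have ms := h.momTest_siteCurrent
    have a1 := inner_flipLocal_symm h hf.toMomTest ms
    have a2 := inner_exchangeLocal_symm h hf.toMomTest ms
    rw [h.flipLocal_siteCurrent, inner_smul_right] at a1
    rw [h.exchangeLocal_siteCurrent, inner_neg_right] at a2
    simp only [TestLike.genLocal, inner_add_left, inner_smul_left, conj_trivial]
    rw [h.inner_bondCurrent f, h.inner_bondCurrent (hf.flipLocal h),
      h.inner_bondCurrent (hf.exchangeLocal h), a1, a2]
    ring
  have rb : Reg (gibbs V T) false h.bondCurrent.fn := by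
    rw [h.fn_bondCurrent]
    exact (((h.tReg_coord false 0).add (h.tReg_coord false 1)).const_mul _).mul_reg
      (h.reg_distance_pos h.pot.differentiable_deriv hF.memLp_two h2 1)
  have rb' : Reg (gibbs V T) true h.bondCurrent.fn := by
    rw [h.fn_bondCurrent]
    exact (((h.tReg_coord true 0).add (h.tReg_coord true 1)).const_mul _).mul_reg
      (h.reg_distance_mom (measurable_deriv V) hF.memLp_two 1)
  set L := 2 * (N + 2) with hLdef
  have e2 := inner_liouvilleLocal h hf rb rb' hNf hNb (L := L) le_rfl
  set Ψ := total rotation (N + 1) f.fn with hΨ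
  have hc : Temperate (gibbs V T) (forceProd V) :=
    (h.temperate_comp_distance hF 0).mul (h.temperate_comp_distance hF 1)
  have rk := h.reg_stiffness h2
  have e3 : ∀ x, ∫ ω, f.fn ω * liouville V h.bondCurrent.fn (shift x ω) ∂gibbs V T =
      1 / 2 * ∫ ω, rotation x f.fn ω * stiffness V (shift x ω) ∂gibbs V T -
      1 / 2 * ∫ ω, f.fn ω * (forceProd V (shift (x + 1) ω) - forceProd V (shift x ω)) ∂gibbs V T := by
    intro x
    have hr := h.integral_rotation_mul hf.mom (rk.comp_shift x) x
    have e4 : ∀ ω, rotation x (fun η => stiffness V (shift x η)) ω =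
        rotation 0 (stiffness V) (shift x ω) := fun ω => covariant_rotation x _ ω
    simp only [e4] at hr
    have i1 : Integrable (fun ω => f.fn ω * rotation 0 (stiffness V) (shift x ω)) (gibbs V T) := by
      have := (hf.mom.temp.mul_tame (h.tame_rotation (rk.comp_shift x) x)).integrable
      simpa only [e4] using this
    have i2 : Integrable (fun ω => f.fn ω * (forceProd V (shift (x + 1) ω) -
        forceProd V (shift x ω))) (gibbs V T) :=
      (hf.mom.temp.mul ((hc.comp (measurePreserving_shift (x + 1))).sub
        (hc.comp (measurePreserving_shift x)))).integrable
    have i3 : Integrable (fun ω => -(1 / 2 * (f.fn ω * rotation 0 (stiffness V) (shift x ω))))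
      (gibbs V T) := (i1.const_mul _).neg
    rw [hr, mul_neg, ← integral_const_mul, ← integral_const_mul, ← integral_neg,
      ← integral_sub i3 (i2.const_mul _)]
    refine integral_congr_ae (Eventually.of_forall fun ω => ?_)
    simp only [liouville_bondCurrent, shift_shift, add_comm (1 : ℤ)]
    ring
  have e5 := covariant_rotation.sum_integral_mul_shift (M := N + 1) (L := L) (by omega)
    (fun y => h.temperate_rotation (hf.mom.comp_shift y) 0) rk.tame
    (fun y hy => rotation_comp_shift_eq_zero hNf hy)
  have hlc : Loc (N + 1) (forceProd V) :=
    ((loc_comp_coord _ _ _).mono (by simp)).mul ((loc_comp_coord _ _ _).mono (by simp))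
  have e6 := h.sum_integral_telescope hf.mom.temp hc (hNf.mono (Nat.le_succ N)) hlc
    (L := L) (by omega)
  simp only [e3, Finset.sum_sub_distrib, ← Finset.mul_sum] at e2
  rw [e5, e6] at e2
  have cs := sq_integral_mul_le (hf.temperate_total_rotation h (N + 1)).memLp_two
    (h.memLp_stiffness h2)
  rw [h.integral_stiffness_sq] at cs
  have d1 := inner_exchangeLocal h hf.toMomTest hf.toMomTest hNf hNf
  have d2 := neg_inner_flipLocal_nonneg h hf.toMomTest
  have hn : 0 ≤ T ^ 2 * stiffnessSq V T :=
    mul_nonneg (sq_nonneg _) (integral_nonneg fun _ => mul_self_nonneg _)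
  rw [e1, e2, neg_inner_genLocal, d1]
  -- The exchange part alone matches the Cauchy-Schwarz bound, including the factor `1/4 = (1/2)²`;
  -- the flip part is discarded as nonnegative.
  have d3 : T ^ 2 * stiffnessSq V T / (2 * γ) * (γ * (-inner ℝ (hf.flipLocal h) f +
      - -(1 / 2 * ∫ ω, Ψ ω * Ψ ω ∂gibbs V T))) =
      T ^ 2 * stiffnessSq V T / 2 * -inner ℝ (hf.flipLocal h) f +
      1 / 4 * ((∫ ω, Ψ ω * Ψ ω ∂gibbs V T) * (T ^ 2 * stiffnessSq V T)) := by
    field_simp; ring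
  rw [d3]
  have := mul_nonneg hn d2
  nlinarith

end Stiffness

/-! ### The conductivity at a fixed temperature -/

section Conductivity

variable {V : ℝ → ℝ} {γ T : ℝ}

theorem exists_testLike_of_mem_coreGraph (h : Admissible V T)
    {z : HilbertH (siteMeasure V T) × HilbertH (siteMeasure V T)} (hz : z ∈ coreGraph V γ T) :
    ∃ (f : LocalFun (siteMeasure V T)) (hf : TestLike (gibbs V T) f.fn),
      z = ((f : HilbertH (siteMeasure V T)), (hf.genLocal h γ : HilbertH (siteMeasure V T))) := by
  have := h.isProbabilityMeasure
  obtain ⟨f, g, hf, hg, rfl⟩ := hz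
  have hf' := testLike_of_mem_testFunctions (μ := gibbs V T) hf
  refine ⟨f, hf', ?_⟩
  rw [show g = hf'.genLocal h γ from LocalFun.ext_fn hg]

/-- Existence of the conductivity at temperature `T`, with bounds. -/
theorem Admissible.exists_conductivity (h : Admissible V T) (hγ : 0 < γ)
    (hd : GeneratesDynamics V γ T) :
    ∃ k, IsConductivity V γ T (γ + (T ^ 2)⁻¹ * k) ∧ 0 ≤ k ∧ k ≤ T * forceSq V T / 2 / (3 * γ) ∧
      (MemLp (deriv (deriv V)) 2 (distanceMeasure V T) →
        (3 * γ * k - T * forceSq V T / 2) ^ 2 ≤ T ^ 2 * stiffnessSq V T / (2 * γ) * k) := by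
  obtain ⟨P, hP, hG⟩ := hd
  set H := HilbertH (siteMeasure V T)
  set G := infinitesimalGraph P with hGdef
  -- All identities and inequalities required of the generator are closed conditions on its graph,
  -- so they pass from test functions to the closure.
  have hclosed : ∀ {p : H × H → Prop}, IsClosed {z | p z} →
      (∀ (f : LocalFun (siteMeasure V T)) (hf : TestLike (gibbs V T) f.fn),
        p ((f : H), (hf.genLocal h γ : H))) → ∀ z ∈ G, p z := by
    intro p hp hc z hz
    rw [hG] at hz
    refine closure_minimal (t := {z | p z}) (fun w hw => ?_) hp hz
    obtain ⟨f, hf, rfl⟩ := exists_testLike_of_mem_coreGraph h hw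
    exact hc f hf
  obtain ⟨u, hu⟩ : ∃ u : ℝ → H, ∀ l, 0 < l → (u l, l • u l - (h.currentLocal : H)) ∈ G := by
    choose! u hu using fun (l : ℝ) (hl : 0 < l) => hP.exists_resolvent (h.currentLocal : H) hl
    exact ⟨u, hu⟩
  have hsub : ∀ z ∈ G, ∀ w ∈ G, z - w ∈ G := fun z hz w hw => by
    have := Tendsto.sub (show Tendsto _ _ _ from hz) (show Tendsto _ _ _ from hw)
    refine this.congr fun t => ?_
    simp only [Prod.fst_sub, map_sub, ← smul_sub]
    congr 1
    abel
  set R : H →L[ℝ] H := h.rev.completion with hR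
  have hRc : ∀ f : LocalFun (siteMeasure V T), R (f : H) = (h.rev f : H) := fun f =>
    ContinuousLinearMap.completion_apply_coe _ f
  -- A condition on two points of the graph: the closure is taken in one variable at a time.
  have hsymm : ∀ z ∈ G, ∀ w ∈ G, inner ℝ z.2 (R w.1) = inner ℝ z.1 (R w.2) := fun z hz =>
    hclosed (p := fun w => inner ℝ z.2 (R w.1) = inner ℝ z.1 (R w.2))
      (isClosed_eq (by fun_prop) (by fun_prop)) fun k hk => by
        refine hclosed (p := fun z => inner ℝ z.2 (R (k : H)) =
          inner ℝ z.1 (R (hk.genLocal h γ : H)))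
          (isClosed_eq (by fun_prop) (by fun_prop)) (fun f hf => ?_) z hz
        simp only [hRc]
        exact (UniformSpace.Completion.inner_coe _ _).trans
          ((inner_genLocal_rev h γ hf hk).trans (UniformSpace.Completion.inner_coe _ _).symm)
  obtain ⟨k, hk, hk0, hkJ, hkM⟩ := exists_conductivity_limit (G := G) (R := R)
    (j := (h.currentLocal : H)) (js := (h.bondCurrent : H)) (e := (h.exactCurrent : H))
    (h := (h.potLocal : H)) (γ := γ) (J := T * forceSq V T / 2) hγ
    (div_nonneg (mul_nonneg h.pos.le (forceSq_nonneg V T)) two_pos.le) hsub hsymm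
    (by rw [hRc, h.rev_currentLocal, UniformSpace.Completion.coe_neg])
    (hclosed (isClosed_le (by fun_prop) (by fun_prop)) fun f hf => by
      simp only [UniformSpace.Completion.inner_coe]
      exact sector_bound h hγ hf)
    (hclosed (isClosed_le (by fun_prop) (by fun_prop)) fun f hf => by
      simp only [UniformSpace.Completion.inner_coe, hRc]
      rw [← UniformSpace.Completion.coe_sub, UniformSpace.Completion.norm_coe]
      exact norm_sub_rev_sq_le h hγ hf)
    (hclosed (isClosed_eq (by fun_prop) (by fun_prop)) fun f hf => by
      simp only [UniformSpace.Completion.inner_coe]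
      exact inner_exactCurrent h γ hf)
    (by
      rw [← UniformSpace.Completion.coe_smul, ← UniformSpace.Completion.coe_add,
        ← h.currentLocal_eq])
    (by rw [UniformSpace.Completion.inner_coe, h.inner_potLocal_currentLocal])
    (by rw [UniformSpace.Completion.inner_coe, h.inner_currentLocal_bondCurrent]) hu
  refine ⟨k, ⟨h.currentLocal, h.fn_currentLocal, u, fun l hl => hG ▸ hu l hl, ?_⟩, hk0, hkJ,
    fun h2 => hkM _ ?_ ?_⟩
  · exact (hk.const_mul _).const_add _
  · exact div_nonneg (mul_nonneg (sq_nonneg _) (integral_nonneg fun _ => mul_self_nonneg _))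
      (by positivity)
  · exact hclosed (isClosed_le (by fun_prop) (by fun_prop)) fun f hf => by
      simp only [UniformSpace.Completion.inner_coe]
      exact stiffness_bound h hγ h2 hf

end Conductivity

/-! ### Potentials with a power tail -/

theorem integral_eq_of_even {F : ℝ → ℝ} (hF : ∀ r, F (-r) = F r) :
    ∫ r, F r = 2 * ∫ r in Set.Ioi 0, F r := by
  rw [← integral_comp_abs]
  refine integral_congr_ae (Eventually.of_forall fun r => ?_)
  rcases abs_choice r with h | h <;> simp only [h, hF]

theorem integrable_of_even {F : ℝ → ℝ} (hF : ∀ r, F (-r) = F r)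
    (hi : IntegrableOn F (Set.Ioi 0)) : Integrable F := by
  have h1 : IntegrableOn F (Set.Iic 0) := by
    rw [integrableOn_Iic_iff_integrableOn_Iio]
    have := (Measure.measurePreserving_neg (volume : Measure ℝ)).integrableOn_comp_preimage
      (MeasurableEquiv.neg ℝ).measurableEmbedding (f := F) (s := Set.Ioi 0)
    have h2 := this.2 hi
    simp only [Set.neg_preimage, Set.neg_Ioi, neg_zero] at h2
    exact h2.congr_fun (fun r _ => hF r) measurableSet_Iio
  rw [← integrableOn_univ, ← Set.Iic_union_Ioi (a := (0 : ℝ))]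
  exact h1.union hi

section Tail

variable {V W : ℝ → ℝ} {A α T : ℝ}

theorem IsChainPotential.continuous (h : IsChainPotential V) : Continuous V := h.smooth.continuous

theorem IsChainPotential.continuous_deriv (h : IsChainPotential V) : Continuous (deriv V) :=
  h.contDiff_deriv.continuous

theorem IsChainPotential.continuous_deriv_deriv (h : IsChainPotential V) :
    Continuous (deriv (deriv V)) := h.contDiff_deriv_deriv.continuous

theorem IsChainPotential.deriv_neg (h : IsChainPotential V) (r : ℝ) :
    deriv V (-r) = -deriv V r := by
  have h1 : (fun r => V (-r)) = V := funext h.even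
  have h2 := deriv_comp_neg V r
  rw [h1] at h2
  linarith

theorem IsChainPotential.deriv_deriv_neg (h : IsChainPotential V) (r : ℝ) :
    deriv (deriv V) (-r) = deriv (deriv V) r := by
  have h1 : (fun r => deriv V (-r)) = fun r => -deriv V r := funext h.deriv_neg
  have h2 := deriv_comp_neg (deriv V) r
  rw [h1, deriv.fun_neg] at h2
  linarith

/-- The integral of `φ exp(-V/T)` over the half-line. -/
def gibbsInt (V : ℝ → ℝ) (T : ℝ) (φ : ℝ → ℝ) : ℝ :=
  ∫ r in Set.Ioi 0, φ r * Real.exp (-V r / T)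

theorem integral_distanceMeasure_of_even (h : IsChainPotential V) {φ : ℝ → ℝ}
    (hφ : ∀ r, φ (-r) = φ r) :
    ∫ r, φ r ∂distanceMeasure V T = gibbsInt V T φ / gibbsInt V T fun _ => 1 := by
  have e1 : ∫ r, φ r * Real.exp (-V r / T) = 2 * gibbsInt V T φ :=
    integral_eq_of_even fun r => by rw [hφ, h.even]
  have e2 : ∫ r, Real.exp (-V r / T) = 2 * gibbsInt V T fun _ => 1 := by
    simp only [gibbsInt, one_mul]
    exact integral_eq_of_even fun r => by rw [h.even]
  rw [distanceMeasure, integral_tilted, e2]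
  have e3 : ∀ r, (Real.exp (-V r / T) / (2 * gibbsInt V T fun _ => 1)) • φ r =
      (2 * gibbsInt V T fun _ => 1)⁻¹ * (φ r * Real.exp (-V r / T)) := fun r => by
    rw [smul_eq_mul, div_eq_inv_mul]; ring
  simp only [e3]
  rw [integral_const_mul, e1, mul_inv, div_eq_inv_mul]
  ring

theorem HasPowerTail.eventuallyEq (hW : HasPowerTail V W A α) {r : ℝ} (hr : 1 < r) :
    V =ᶠ[𝓝 r] fun r => A * r ^ α + W r := by
  filter_upwards [lt_mem_nhds hr] with s hs using hW.eq s hs.le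

theorem HasPowerTail.deriv_eq (hW : HasPowerTail V W A α) {r : ℝ} (hr : 1 < r) :
    deriv V r = A * α * r ^ (α - 1) + deriv W r := by
  have hr0 : r ≠ 0 := by linarith
  have hd : DifferentiableAt ℝ W r := hW.smooth.differentiable (by simp) r
  rw [(hW.eventuallyEq hr).deriv_eq]
  have h1 := ((Real.hasDerivAt_rpow_const (p := α) (Or.inl hr0)).const_mul A).add hd.hasDerivAt
  rw [show (fun r => A * r ^ α + W r) = (fun r => A * r ^ α) + W from rfl, h1.deriv]
  ring

theorem HasPowerTail.deriv_deriv_eq (hW : HasPowerTail V W A α) {r : ℝ} (hr : 1 < r) :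
    deriv (deriv V) r = A * α * (α - 1) * r ^ (α - 2) + deriv (deriv W) r := by
  have hr0 : r ≠ 0 := by linarith
  have hd : DifferentiableAt ℝ (deriv W) r :=
    ((contDiff_infty_iff_deriv.1 hW.smooth).2).differentiable (by simp) r
  have he : deriv V =ᶠ[𝓝 r] fun r => A * α * r ^ (α - 1) + deriv W r := by
    filter_upwards [lt_mem_nhds hr] with s hs using hW.deriv_eq hs
  rw [he.deriv_eq]
  have h1 := ((Real.hasDerivAt_rpow_const (p := α - 1) (Or.inl hr0)).const_mul (A * α)).add
    hd.hasDerivAt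
  rw [show (fun r => A * α * r ^ (α - 1) + deriv W r) =
    (fun r => A * α * r ^ (α - 1)) + deriv W from rfl, h1.deriv]
  rw [show α - 1 - 1 = α - 2 by ring]
  ring

theorem HasPowerTail.exists_le (h : IsChainPotential V) (hW : HasPowerTail V W A α) (hα : 0 < α)
    (hA : 0 < A) : ∃ M, 0 ≤ M ∧ ∀ r, 0 ≤ r → A * r ^ α ≤ V r + M := by
  obtain ⟨M, hM⟩ := hW.bounded
  have hM0 : 0 ≤ M := (abs_nonneg _).trans (hM 1 le_rfl).1
  refine ⟨M + A, by positivity, fun r hr => ?_⟩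
  rcases le_total 1 r with h1 | h1
  · have := (abs_le.1 (hM r h1).1).1
    rw [hW.eq r h1]; linarith
  · have h2 : r ^ α ≤ 1 := Real.rpow_le_one hr h1 hα.le
    have := h.nonneg r
    nlinarith

theorem exists_abs_le_of_continuous {f : ℝ → ℝ} (hf : Continuous f) :
    ∃ C, 0 ≤ C ∧ ∀ r, 0 ≤ r → r ≤ 1 → |f r| ≤ C := by
  obtain ⟨C, hC⟩ := (isCompact_Icc (a := (0 : ℝ)) (b := 1)).exists_bound_of_continuousOn
    hf.continuousOn
  exact ⟨C, (norm_nonneg _).trans (hC 0 (by simp)), fun r h0 h1 => hC r ⟨h0, h1⟩⟩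

theorem HasPowerTail.exists_abs_deriv_le (h : IsChainPotential V) (hW : HasPowerTail V W A α)
    (hα : 0 < α) (hA : 0 < A) :
    ∃ D, 0 ≤ D ∧ ∀ r, 0 ≤ r → |deriv V r| ≤ D * (1 + r ^ (α - 1)) := by
  obtain ⟨M, hM⟩ := hW.bounded
  have hM0 : 0 ≤ M := (abs_nonneg _).trans (hM 1 le_rfl).1
  obtain ⟨C, hC0, hC⟩ := exists_abs_le_of_continuous h.continuous_deriv
  have hAα : 0 < A * α := mul_pos hA hα
  refine ⟨C + M + A * α, by positivity, fun r hr => ?_⟩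
  have hp : 0 ≤ r ^ (α - 1) := Real.rpow_nonneg hr _
  have hs : 0 ≤ C * r ^ (α - 1) := mul_nonneg hC0 hp
  have hs' : 0 ≤ M * r ^ (α - 1) := mul_nonneg hM0 hp
  have hs'' : 0 ≤ A * α * r ^ (α - 1) := mul_nonneg hAα.le hp
  rcases le_or_gt r 1 with h1 | h1
  · have := hC r hr h1
    linarith
  · rw [hW.deriv_eq h1]
    refine (abs_add_le _ _).trans ?_
    have := (hM r h1.le).2
    rw [abs_of_nonneg hs'']
    linarith

/-- On the tail `r^{α-1} ≤ r^α`, and `A r^α` is at most `V` plus a constant. All moments of `V'`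
thereby reduce to moments of `1 + V`. -/
theorem HasPowerTail.exists_abs_deriv_le_pot (h : IsChainPotential V) (hW : HasPowerTail V W A α)
    (hα : 0 < α) (hA : 0 < A) : ∃ D, 0 ≤ D ∧ ∀ r, |deriv V r| ≤ D * (1 + V r) := by
  obtain ⟨M, hM⟩ := hW.bounded
  obtain ⟨M', hM0', hM'⟩ := hW.exists_le h hα hA
  have hM0 : 0 ≤ M := (abs_nonneg _).trans (hM 1 le_rfl).1
  obtain ⟨C, hC0, hC⟩ := exists_abs_le_of_continuous h.continuous_deriv
  have key : ∀ r, 0 ≤ r → |deriv V r| ≤ (C + M + α * (1 + M')) * (1 + V r) := by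
    intro r hr
    have hV := h.nonneg r
    have h1V : 1 ≤ 1 + V r := by linarith
    have t1 : C ≤ C * (1 + V r) := le_mul_of_one_le_right hC0 h1V
    have t2 : M ≤ M * (1 + V r) := le_mul_of_one_le_right hM0 h1V
    have t3 : V r + M' ≤ (1 + M') * (1 + V r) := by nlinarith
    rcases le_or_gt r 1 with h1 | h1
    · have := hC r hr h1
      have : 0 ≤ α * (1 + M') * (1 + V r) := by positivity
      nlinarith
    · rw [hW.deriv_eq h1]
      refine (abs_add_le _ _).trans ?_
      have h2 := (hM r h1.le).2
      have h3 : r ^ (α - 1) ≤ r ^ α := Real.rpow_le_rpow_of_exponent_le h1.le (by linarith)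
      have h4 := hM' r hr
      have h5 : A * α * r ^ (α - 1) ≤ α * (V r + M') := by
        calc A * α * r ^ (α - 1) ≤ A * α * r ^ α := by gcongr
          _ = α * (A * r ^ α) := by ring
          _ ≤ _ := by gcongr
      have h6 : α * (V r + M') ≤ α * ((1 + M') * (1 + V r)) := by gcongr
      rw [abs_of_nonneg (by positivity)]
      nlinarith
  refine ⟨C + M + α * (1 + M'), by positivity, fun r => ?_⟩
  rcases le_total 0 r with hr | hr
  · exact key r hr
  · have := key (-r) (by linarith)
    rwa [h.deriv_neg, abs_neg, h.even] at this

theorem HasPowerTail.integrable_exp (h : IsChainPotential V) (hW : HasPowerTail V W A α)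
    (hα : 0 < α) (hA : 0 < A) (hT : 0 < T) : Integrable fun r => Real.exp (-V r / T) := by
  obtain ⟨M, hM0, hM⟩ := hW.exists_le h hα hA
  refine integrable_of_even (fun r => by rw [h.even]) ?_
  have h1 := integrableOn_rpow_mul_exp_neg_mul_rpow (s := 0) (by norm_num) hα (div_pos hA hT)
  refine (h1.const_mul (Real.exp (M / T))).mono' ?_ ?_
  · have := h.continuous
    exact (by fun_prop : Continuous fun r => Real.exp (-V r / T)).aestronglyMeasurable
  · filter_upwards [ae_restrict_mem measurableSet_Ioi] with r hr
    rw [Real.norm_of_nonneg (Real.exp_nonneg _), Real.rpow_zero, one_mul, ← Real.exp_add,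
      Real.exp_le_exp]
    have := hM r (le_of_lt hr)
    rw [show M / T + -(A / T) * r ^ α = (M - A * r ^ α) / T by ring]
    gcongr
    linarith

/-- Half of the exponent absorbs the polynomial, by `y^n / n! ≤ e^y` with `y = (1 + x) / (2T)`. The
price is a doubled temperature. -/
theorem exists_pow_mul_exp_neg_le (hT : 0 < T) (n : ℕ) :
    ∃ C, ∀ x : ℝ, 0 ≤ x → (1 + x) ^ n * Real.exp (-x / T) ≤ C * Real.exp (-x / (2 * T)) := by
  refine ⟨(2 * T) ^ n * n.factorial * Real.exp (1 / (2 * T)), fun x hx => ?_⟩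
  have h1 := Real.pow_div_factorial_le_exp ((1 + x) / (2 * T)) (by positivity) n
  have hf : (0 : ℝ) < n.factorial := by positivity
  rw [div_pow, div_div, div_le_iff₀ (by positivity)] at h1
  have h2 : Real.exp (-x / T) = Real.exp (-x / (2 * T)) * Real.exp (-x / (2 * T)) := by
    rw [← Real.exp_add]; congr 1; field_simp; ring
  have h3 : Real.exp ((1 + x) / (2 * T)) * Real.exp (-x / (2 * T)) = Real.exp (1 / (2 * T)) := by
    rw [← Real.exp_add]; congr 1; field_simp; ring
  calc (1 + x) ^ n * Real.exp (-x / T)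
      ≤ (Real.exp ((1 + x) / (2 * T)) * ((2 * T) ^ n * n.factorial)) * Real.exp (-x / T) := by
        gcongr
    _ = (2 * T) ^ n * n.factorial * (Real.exp ((1 + x) / (2 * T)) * Real.exp (-x / (2 * T))) *
          Real.exp (-x / (2 * T)) := by rw [h2]; ring
    _ = _ := by rw [h3]

/-- Potentials with a power tail have all moments. -/
theorem HasPowerTail.admissible (h : IsChainPotential V) (hW : HasPowerTail V W A α)
    (hα : 0 < α) (hA : 0 < A) (hT : 0 < T) : Admissible V T := by
  obtain ⟨D, hD0, hD⟩ := hW.exists_abs_deriv_le_pot h hα hA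
  have hi := hW.integrable_exp h hα hA (T := 2 * T) (by positivity)
  have key : ∀ {g : ℝ → ℝ} (E : ℝ), Continuous g → (∀ r, |g r| ≤ E * (1 + V r)) → ∀ n : ℕ,
      Integrable fun r => |g r| ^ n * Real.exp (-V r / T) := by
    intro g E hg hE n
    obtain ⟨C, hC⟩ := exists_pow_mul_exp_neg_le hT n
    refine (hi.const_mul (|E| ^ n * C)).mono' ?_ (Eventually.of_forall fun r => ?_)
    · have := h.continuous
      exact (by fun_prop : Continuous fun r => |g r| ^ n *
        Real.exp (-V r / T)).aestronglyMeasurable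
    · have hV := h.nonneg r
      rw [Real.norm_of_nonneg (by positivity)]
      have h1 : |g r| ≤ |E| * (1 + V r) :=
        (hE r).trans (mul_le_mul_of_nonneg_right (le_abs_self E) (by linarith))
      calc |g r| ^ n * Real.exp (-V r / T)
          ≤ (|E| * (1 + V r)) ^ n * Real.exp (-V r / T) := by gcongr
        _ = |E| ^ n * ((1 + V r) ^ n * Real.exp (-V r / T)) := by rw [mul_pow]; ring
        _ ≤ |E| ^ n * (C * Real.exp (-V r / (2 * T))) :=
          mul_le_mul_of_nonneg_left (hC _ hV) (by positivity)
        _ = _ := by ring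
  exact ⟨h, hT, key 1 h.continuous fun r => by rw [abs_of_nonneg (h.nonneg r)]; linarith,
    key D h.continuous_deriv hD⟩

end Tail

/-! ### Laplace asymptotics by scaling -/

section Scaling

/-- The integral `∫_0^∞ s^β exp(-A s^α) ds`. -/
def powInt (A α β : ℝ) : ℝ := ∫ s in Set.Ioi (0 : ℝ), s ^ β * Real.exp (-(A * s ^ α))

theorem integrableOn_powInt {A α β : ℝ} (hA : 0 < A) (hα : 0 < α) (hβ : 0 ≤ β) :
    IntegrableOn (fun s : ℝ => s ^ β * Real.exp (-(A * s ^ α))) (Set.Ioi 0) := by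
  simpa only [neg_mul] using
    integrableOn_rpow_mul_exp_neg_mul_rpow (by linarith : (-1 : ℝ) < β) hα hA

theorem powInt_pos {A α β : ℝ} (hA : 0 < A) (hα : 0 < α) (hβ : 0 ≤ β) : 0 < powInt A α β := by
  have h := integral_rpow_mul_exp_neg_mul_rpow hα (by linarith : (-1 : ℝ) < β) hA
  simp only [neg_mul] at h
  rw [powInt, h]
  have : 0 < Real.Gamma ((β + 1) / α) := Real.Gamma_pos_of_pos (by positivity)
  positivity

/-- Laplace-type asymptotics of Gibbs integrals of asymptotically homogeneous functions. -/
theorem tendsto_gibbsInt_div {l : Filter ℝ} [l.IsCountablyGenerated] (hl : ∀ᶠ ε in l, 0 < ε)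
    (hls : ∀ s : ℝ, 0 < s → Tendsto (fun ε => ε * s) l l) {V φ : ℝ → ℝ} (hVm : Measurable V)
    (hφm : Measurable φ) {α β A c D a M : ℝ} (hα : 0 < α) (hβ : 0 ≤ β) (ha : 0 < a) (hD : 0 ≤ D)
    (hφ : Tendsto (fun r => φ r / r ^ β) l (𝓝 c)) (hV : Tendsto (fun r => V r / r ^ α) l (𝓝 A))
    (hdom : ∀ᶠ ε in l, ∀ r, 0 < r → φ r ≠ 0 →
      |φ r| ≤ D * (ε ^ β + r ^ β) ∧ a * r ^ α ≤ V r + M * ε ^ α) :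
    Tendsto (fun ε => gibbsInt V (ε ^ α) φ / ε ^ (1 + β)) l (𝓝 (c * powInt A α β)) := by
  -- The integrand after `r = ε s`, at temperature `ε ^ α`; it converges pointwise to `c s^β exp (-A
  -- s^α)`.
  set F : ℝ → ℝ → ℝ := fun ε s => φ (ε * s) / ε ^ β * Real.exp (-V (ε * s) / ε ^ α) with hF
  have e1 : ∀ᶠ ε in l, gibbsInt V (ε ^ α) φ / ε ^ (1 + β) = ∫ s in Set.Ioi 0, F ε s := by
    filter_upwards [hl] with ε hε
    have h1 := integral_comp_mul_left_Ioi (fun r => φ r * Real.exp (-V r / ε ^ α)) 0 hε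
    simp only [mul_zero, smul_eq_mul] at h1
    have h2 : ∀ s, F ε s = (ε ^ β)⁻¹ * (φ (ε * s) * Real.exp (-V (ε * s) / ε ^ α)) := fun s => by
      simp only [hF]; ring
    simp only [h2]
    rw [integral_const_mul, h1, gibbsInt, Real.rpow_add hε, Real.rpow_one]
    field_simp
  have e2 : c * powInt A α β =
      ∫ s in Set.Ioi (0 : ℝ), c * s ^ β * Real.exp (-(A * s ^ α)) := by
    simp only [mul_assoc, powInt]
    rw [integral_const_mul]
  rw [e2]
  refine Tendsto.congr' (EventuallyEq.symm e1) ?_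
  refine tendsto_integral_filter_of_dominated_convergence
    (fun s => D * Real.exp M * (Real.exp (-(a * s ^ α)) + s ^ β * Real.exp (-(a * s ^ α))))
    ?_ ?_ ?_ ?_
  · exact Eventually.of_forall fun ε =>
      (by fun_prop : Measurable (F ε)).aestronglyMeasurable
  · filter_upwards [hl, hdom] with ε hε hd
    filter_upwards [ae_restrict_mem measurableSet_Ioi] with s hs
    have hs0 : 0 < s := hs
    have hεα : 0 < ε ^ α := Real.rpow_pos_of_pos hε _
    have hεβ : 0 < ε ^ β := Real.rpow_pos_of_pos hε _
    have hsβ : 0 ≤ s ^ β := Real.rpow_nonneg hs0.le _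
    -- The lower bound on `V` is only assumed where `φ` does not vanish, so truncations of `φ` near
    -- the origin are allowed although `V` need not dominate `r^α` far away.
    by_cases h0 : φ (ε * s) = 0
    · simp only [hF, h0, zero_div, zero_mul, norm_zero]
      positivity
    · obtain ⟨h1, h2⟩ := hd (ε * s) (mul_pos hε hs0) h0
      rw [Real.mul_rpow hε.le hs0.le] at h1 h2
      have h3 : |φ (ε * s)| / ε ^ β ≤ D * (1 + s ^ β) := by
        rw [div_le_iff₀ hεβ]
        linarith
      have h4 : -V (ε * s) / ε ^ α ≤ M + -(a * s ^ α) := by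
        rw [div_le_iff₀ hεα]
        nlinarith
      rw [Real.norm_eq_abs, abs_mul, abs_div, abs_of_pos hεβ, abs_of_pos (Real.exp_pos _)]
      calc |φ (ε * s)| / ε ^ β * Real.exp (-V (ε * s) / ε ^ α)
          ≤ D * (1 + s ^ β) * Real.exp (M + -(a * s ^ α)) := by gcongr
        _ = _ := by rw [Real.exp_add]; ring
  · have h0 := integrableOn_powInt ha hα le_rfl
    simp only [Real.rpow_zero, one_mul] at h0
    exact (h0.add (integrableOn_powInt ha hα hβ)).const_mul _
  · filter_upwards [ae_restrict_mem measurableSet_Ioi] with s hs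
    have hs0 : 0 < s := hs
    have key : ∀ {g : ℝ → ℝ} {b d : ℝ}, Tendsto (fun r => g r / r ^ b) l (𝓝 d) →
        Tendsto (fun ε => g (ε * s) / ε ^ b) l (𝓝 (d * s ^ b)) := by
      intro g b d hg
      refine ((hg.comp (hls s hs0)).mul_const (s ^ b)).congr' ?_
      filter_upwards [hl] with ε hε
      have : 0 < s ^ b := Real.rpow_pos_of_pos hs0 _
      simp only [Function.comp_apply, Real.mul_rpow hε.le hs0.le]
      field_simp
    refine (key hφ).mul ?_
    have := (key hV).neg
    simp only [← neg_div] at this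
    exact (Real.continuous_exp.tendsto _).comp this

theorem tailConst_eq (A α : ℝ) :
    tailConst A α = A ^ 2 * α ^ 2 * powInt A α (2 * α - 2) / powInt A α 0 := by
  simp [tailConst, powInt]

theorem tailConst_pos {A α : ℝ} (hA : 0 < A) (hα : 1 ≤ α) : 0 < tailConst A α := by
  have hα0 : 0 < α := by linarith
  rw [tailConst_eq]
  have h1 := powInt_pos hA hα0 (β := 2 * α - 2) (by linarith)
  have h2 := powInt_pos hA hα0 (β := 0) le_rfl
  positivity

theorem forceSq_eq {V : ℝ → ℝ} (h : IsChainPotential V) (T : ℝ) :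
    forceSq V T = gibbsInt V T (fun r => deriv V r ^ 2) / gibbsInt V T fun _ => 1 := by
  rw [← integral_distanceMeasure_of_even h fun r => by rw [h.deriv_neg, neg_sq]]
  simp only [forceSq, sq]

theorem stiffnessSq_eq {V : ℝ → ℝ} (h : IsChainPotential V) (T : ℝ) :
    stiffnessSq V T = gibbsInt V T (fun r => deriv (deriv V) r ^ 2) / gibbsInt V T fun _ => 1 := by
  rw [← integral_distanceMeasure_of_even h fun r => by rw [h.deriv_deriv_neg]]
  simp only [stiffnessSq, sq]

/-- The mean square force, given the asymptotics of the two Gibbs integrals which define it. -/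
theorem tendsto_forceSq_div {l : Filter ℝ} (hl : ∀ᶠ ε in l, 0 < ε) {V : ℝ → ℝ}
    (h : IsChainPotential V) {A α : ℝ} (hA : 0 < A) (hα : 1 ≤ α)
    (h1 : Tendsto (fun ε => gibbsInt V (ε ^ α) (fun r => deriv V r ^ 2) / ε ^ (1 + (2 * α - 2))) l
      (𝓝 ((A * α) ^ 2 * powInt A α (2 * α - 2))))
    (h0 : Tendsto (fun ε => gibbsInt V (ε ^ α) (fun _ => 1) / ε ^ (1 + (0 : ℝ))) l
      (𝓝 (1 * powInt A α 0))) :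
    Tendsto (fun ε => forceSq V (ε ^ α) / ε ^ (2 * α - 2)) l (𝓝 (tailConst A α)) := by
  have hp := powInt_pos hA (by linarith) (β := 0) le_rfl (α := α)
  have h2 := h1.div h0 (by rw [one_mul]; exact hp.ne')
  rw [tailConst_eq, ← mul_pow]
  rw [one_mul] at h2
  refine h2.congr' ?_
  filter_upwards [hl] with ε hε
  simp only [Pi.div_apply]
  rw [forceSq_eq h, Real.rpow_add hε, Real.rpow_add hε, Real.rpow_one, Real.rpow_zero]
  have : 0 < ε ^ (2 * α - 2) := Real.rpow_pos_of_pos hε _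
  -- If the denominator were zero, both sides would be `0` by the convention for division, so its
  -- positivity need not be proved.
  by_cases hz : gibbsInt V (ε ^ α) (fun _ => 1) = 0
  · simp [hz]
  · field_simp

end Scaling

/-! ### Mean square force at high temperature -/

section HighTemperature

variable {V W : ℝ → ℝ} {A α T : ℝ}

theorem HasPowerTail.tendsto_pot (hW : HasPowerTail V W A α) (hα : 0 < α) :
    Tendsto (fun r => V r / r ^ α) atTop (𝓝 A) := by
  obtain ⟨M, hM⟩ := hW.bounded
  have h1 : Tendsto (fun r : ℝ => W r / r ^ α) atTop (𝓝 0) := by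
    refine squeeze_zero_norm' (a := fun r : ℝ => M / r ^ α) ?_
      ((tendsto_rpow_atTop hα).const_div_atTop M)
    filter_upwards [eventually_ge_atTop 1] with r hr
    have : 0 < r ^ α := Real.rpow_pos_of_pos (by linarith) _
    rw [Real.norm_eq_abs, abs_div, abs_of_pos this]
    gcongr
    exact (hM r hr).1
  have h2 := h1.const_add A
  rw [add_zero] at h2
  refine h2.congr' ?_
  filter_upwards [eventually_ge_atTop 1] with r hr
  have : 0 < r ^ α := Real.rpow_pos_of_pos (by linarith) _
  rw [hW.eq r hr]
  field_simp

/-- Here `α > 1` is essential: it makes the bounded function `W'` negligible against `r^{α-1}`. -/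
theorem HasPowerTail.tendsto_force (hW : HasPowerTail V W A α) (hα : 1 < α) :
    Tendsto (fun r => deriv V r / r ^ (α - 1)) atTop (𝓝 (A * α)) := by
  obtain ⟨M, hM⟩ := hW.bounded
  have h1 : Tendsto (fun r : ℝ => deriv W r / r ^ (α - 1)) atTop (𝓝 0) := by
    refine squeeze_zero_norm' (a := fun r : ℝ => M / r ^ (α - 1)) ?_
      ((tendsto_rpow_atTop (by linarith)).const_div_atTop M)
    filter_upwards [eventually_ge_atTop 1] with r hr
    have : 0 < r ^ (α - 1) := Real.rpow_pos_of_pos (by linarith) _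
    rw [Real.norm_eq_abs, abs_div, abs_of_pos this]
    gcongr
    exact (hM r hr).2
  have h2 := h1.const_add (A * α)
  rw [add_zero] at h2
  refine h2.congr' ?_
  filter_upwards [eventually_gt_atTop 1] with r hr
  have : 0 < r ^ (α - 1) := Real.rpow_pos_of_pos (by linarith) _
  rw [hW.deriv_eq hr]
  field_simp

theorem sq_div_rpow {x r β : ℝ} (hr : 0 < r) : x ^ 2 / r ^ (2 * β) = (x / r ^ β) ^ 2 := by
  rw [div_pow, ← Real.rpow_natCast (r ^ β), ← Real.rpow_mul hr.le]
  norm_num [mul_comm]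

theorem HasPowerTail.tendsto_gibbsInt_one (h : IsChainPotential V) (hW : HasPowerTail V W A α)
    (hα : 0 < α) (hA : 0 < A) :
    Tendsto (fun ε => gibbsInt V (ε ^ α) (fun _ => 1) / ε ^ (1 + (0 : ℝ))) atTop
      (𝓝 (1 * powInt A α 0)) := by
  obtain ⟨M, hM0, hM⟩ := hW.exists_le h hα hA
  refine tendsto_gibbsInt_div (eventually_gt_atTop 0) (fun s hs => tendsto_id.atTop_mul_const hs)
    h.continuous.measurable measurable_const hα le_rfl hA zero_le_one (M := M) (by simp)
    (hW.tendsto_pot hα) ?_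
  filter_upwards [eventually_ge_atTop 1] with ε hε r hr _
  refine ⟨by simp, (hM r hr.le).trans ?_⟩
  have := Real.one_le_rpow hε hα.le
  nlinarith

theorem HasPowerTail.tendsto_forceSq (h : IsChainPotential V) (hW : HasPowerTail V W A α)
    (hα : 1 < α) (hA : 0 < A) :
    Tendsto (fun ε => forceSq V (ε ^ α) / ε ^ (2 * α - 2)) atTop (𝓝 (tailConst A α)) := by
  have hα0 : 0 < α := by linarith
  obtain ⟨M, hM0, hM⟩ := hW.exists_le h hα0 hA
  obtain ⟨D, hD0, hD⟩ := hW.exists_abs_deriv_le h hα0 hA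
  refine tendsto_forceSq_div (eventually_gt_atTop 0) h hA hα.le ?_
    (hW.tendsto_gibbsInt_one h hα0 hA)
  refine tendsto_gibbsInt_div (eventually_gt_atTop 0) (fun s hs => tendsto_id.atTop_mul_const hs)
    h.continuous.measurable (h.continuous_deriv.measurable.pow_const 2) hα0 (by linarith) hA
    (D := 2 * D ^ 2) (by positivity) (M := M) ?_ (hW.tendsto_pot hα0) ?_
  · refine ((hW.tendsto_force hα).pow 2).congr' ?_
    filter_upwards [eventually_gt_atTop 0] with r hr
    rw [show 2 * α - 2 = 2 * (α - 1) by ring, sq_div_rpow hr]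
  · filter_upwards [eventually_ge_atTop 1] with ε hε r hr _
    have h1 := Real.one_le_rpow hε hα0.le
    have h2 := Real.one_le_rpow hε (by linarith : 0 ≤ 2 * α - 2)
    refine ⟨?_, (hM r hr.le).trans (by nlinarith)⟩
    have hrp : 0 < r ^ (α - 1) := Real.rpow_pos_of_pos hr _
    have h3 : r ^ (2 * α - 2) = r ^ (α - 1) * r ^ (α - 1) := by
      rw [← Real.rpow_add hr]; congr 1; ring
    rw [abs_of_nonneg (sq_nonneg _), ← sq_abs]
    calc |deriv V r| ^ 2 ≤ (D * (1 + r ^ (α - 1))) ^ 2 := by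
          gcongr; exact hD r hr.le
      _ ≤ 2 * D ^ 2 * (1 + r ^ (2 * α - 2)) := by
          rw [h3]
          nlinarith [mul_nonneg (sq_nonneg D) (sq_nonneg (1 - r ^ (α - 1)))]
      _ ≤ _ := by gcongr

end HighTemperature

/-! ### Laplace integrals controlled by the growth of a primitive -/

section Layer

/-- Integration by layers: growth of the primitive controls the Laplace integral. -/
theorem lintegral_mul_exp_neg_le {ψ : ℝ → ℝ} (hψc : Continuous ψ) (hψ : ∀ r, 0 ≤ ψ r)
    {α p η C b : ℝ} (hα : 0 < α) (hp : 0 ≤ p) (hη : 0 ≤ η) (hC : 0 ≤ C) (hb : 0 < b)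
    (hG : ∀ R, 0 ≤ R → ∫ r in (0 : ℝ)..R, ψ r ≤ η * R ^ p + C) :
    ∫⁻ r in Set.Ioi 0, ENNReal.ofReal (ψ r * Real.exp (-(b * r ^ α))) ≤
      ENNReal.ofReal (η * b⁻¹ ^ (p / α) * Real.Gamma (p / α + 1) + C) := by
  -- Since `exp (-b r^α)` is the integral of `exp (-u)` over `u > b r^α`, the integral over `r`
  -- becomes a double integral, whose order Tonelli exchanges.
  set f : ℝ → ℝ → ENNReal := fun r u =>
    if b * r ^ α < u then ENNReal.ofReal (ψ r * Real.exp (-u)) else 0 with hf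
  have hfm : Measurable (Function.uncurry f) := by
    refine Measurable.ite (measurableSet_lt (by fun_prop) measurable_snd) ?_ measurable_const
    fun_prop
  have h1 : ∀ r ∈ Set.Ioi (0 : ℝ), ENNReal.ofReal (ψ r * Real.exp (-(b * r ^ α))) =
      ∫⁻ u in Set.Ioi 0, f r u := by
    intro r hr
    have hr0 : 0 ≤ b * r ^ α := mul_nonneg hb.le (Real.rpow_nonneg (le_of_lt hr) _)
    have e1 : f r = (Set.Ioi (b * r ^ α)).indicator
        fun u => ENNReal.ofReal (ψ r * Real.exp (-u)) := by
      funext u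
      simp [hf, Set.indicator_apply]
    rw [e1, lintegral_indicator measurableSet_Ioi, Measure.restrict_restrict measurableSet_Ioi,
      Set.inter_eq_left.2 (Set.Ioi_subset_Ioi hr0), ← ofReal_integral_eq_lintegral_ofReal,
      integral_const_mul, integral_exp_neg_Ioi]
    · exact (exp_neg_integrableOn_Ioi (b * r ^ α) zero_lt_one |>.congr_fun
        (fun u _ => by simp) measurableSet_Ioi).const_mul _
    · exact Eventually.of_forall fun u => mul_nonneg (hψ r) (Real.exp_nonneg _)
  have h2 : ∀ u ∈ Set.Ioi (0 : ℝ), ∫⁻ r in Set.Ioi 0, f r u ≤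
      ENNReal.ofReal (η * b⁻¹ ^ (p / α) * (Real.exp (-u) * u ^ (p / α + 1 - 1)) +
        C * Real.exp (-u)) := by
    intro u hu
    have hu0 : 0 < u := hu
    -- The radius at which `b r^α` reaches the level `u`; the inner integral is at most the
    -- primitive of `ψ` at `ρ` times `exp (-u)`.
    set ρ := (b⁻¹ * u) ^ α⁻¹ with hρ
    have hρ0 : 0 ≤ ρ := Real.rpow_nonneg (by positivity) _
    have hle : ∀ r ∈ Set.Ioi (0 : ℝ), f r u ≤ (Set.Ioc 0 ρ).indicator
        (fun r => ENNReal.ofReal (ψ r * Real.exp (-u))) r := by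
      intro r hr
      by_cases hlt : b * r ^ α < u
      · have hr' : r ∈ Set.Ioc 0 ρ := by
          refine ⟨hr, ?_⟩
          have h3 : r ^ α ≤ b⁻¹ * u := by
            rw [inv_mul_eq_div, le_div_iff₀ hb]; linarith
          have h4 := Real.rpow_le_rpow (Real.rpow_nonneg (le_of_lt hr) _) h3
            (inv_nonneg.2 hα.le)
          rwa [← Real.rpow_mul (le_of_lt hr), mul_inv_cancel₀ hα.ne', Real.rpow_one] at h4
        simp [hf, hlt, Set.indicator_of_mem hr']
      · simp [hf, hlt]
    calc ∫⁻ r in Set.Ioi 0, f r u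
        ≤ ∫⁻ r in Set.Ioi 0, (Set.Ioc 0 ρ).indicator
            (fun r => ENNReal.ofReal (ψ r * Real.exp (-u))) r :=
          setLIntegral_mono' measurableSet_Ioi hle
      _ = ENNReal.ofReal (∫ r in Set.Ioc 0 ρ, ψ r * Real.exp (-u)) := by
          rw [lintegral_indicator measurableSet_Ioc, Measure.restrict_restrict measurableSet_Ioc,
            Set.inter_eq_left.2 fun r hr => hr.1, ofReal_integral_eq_lintegral_ofReal]
          · exact ((hψc.mul continuous_const).integrableOn_Icc).mono_set Set.Ioc_subset_Icc_self
          · exact Eventually.of_forall fun r => mul_nonneg (hψ r) (Real.exp_nonneg _)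
      _ ≤ _ := by
          refine ENNReal.ofReal_le_ofReal ?_
          rw [integral_mul_const, ← intervalIntegral.integral_of_le hρ0]
          have h5 := hG ρ hρ0
          -- The exponent is left as `p / α + 1 - 1` to match the Gamma integral at `p / α + 1`.
          have h6 : ρ ^ p = b⁻¹ ^ (p / α) * u ^ (p / α + 1 - 1) := by
            rw [hρ, ← Real.rpow_mul (by positivity), Real.mul_rpow (by positivity) hu0.le,
              add_sub_cancel_right, inv_mul_eq_div]
          rw [h6] at h5
          have := mul_le_mul_of_nonneg_right h5 (Real.exp_nonneg (-u))
          linarith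
  have hΓ := Real.GammaIntegral_convergent (s := p / α + 1) (by positivity)
  have hexp : IntegrableOn (fun u : ℝ => Real.exp (-u)) (Set.Ioi 0) := integrableOn_exp_neg_Ioi 0
  calc ∫⁻ r in Set.Ioi 0, ENNReal.ofReal (ψ r * Real.exp (-(b * r ^ α)))
      = ∫⁻ r in Set.Ioi 0, ∫⁻ u in Set.Ioi 0, f r u := setLIntegral_congr_fun measurableSet_Ioi h1
    _ = ∫⁻ u in Set.Ioi 0, ∫⁻ r in Set.Ioi 0, f r u := lintegral_lintegral_swap hfm.aemeasurable
    _ ≤ ∫⁻ u in Set.Ioi 0, ENNReal.ofReal (η * b⁻¹ ^ (p / α) *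
          (Real.exp (-u) * u ^ (p / α + 1 - 1)) + C * Real.exp (-u)) :=
        setLIntegral_mono' measurableSet_Ioi h2
    _ = _ := by
        rw [← ofReal_integral_eq_lintegral_ofReal, integral_add, integral_const_mul,
          integral_const_mul, integral_exp_neg_Ioi_zero, ← Real.Gamma_eq_integral (by positivity),
          mul_one]
        · exact hΓ.const_mul _
        · exact hexp.const_mul _
        · exact (hΓ.const_mul _).add (hexp.const_mul _)
        · filter_upwards [ae_restrict_mem measurableSet_Ioi] with u hu
          have : 0 ≤ u ^ (p / α + 1 - 1) := Real.rpow_nonneg (le_of_lt hu) _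
          have : 0 ≤ b⁻¹ ^ (p / α) := Real.rpow_nonneg (by positivity) _
          simp only [Pi.zero_apply]
          positivity

/-- The bound `V ≥ A r^α - M` compares the Gibbs weight with `exp (-(A / T) r^α)` at the cost of the
factor `exp (M / T)`. Finiteness of the layer integral gives integrability at the same time as the
estimate. -/
theorem integrableOn_and_gibbsInt_le {V ψ : ℝ → ℝ} (hV : Continuous V) (hψc : Continuous ψ)
    (hψ : ∀ r, 0 ≤ ψ r) {A M α p η C T : ℝ} (hA : 0 < A) (hα : 0 < α) (hp : 0 ≤ p) (hη : 0 ≤ η)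
    (hC : 0 ≤ C) (hT : 0 < T) (hM : ∀ r, 0 ≤ r → A * r ^ α ≤ V r + M)
    (hG : ∀ R, 0 ≤ R → ∫ r in (0 : ℝ)..R, ψ r ≤ η * R ^ p + C) :
    IntegrableOn (fun r => ψ r * Real.exp (-V r / T)) (Set.Ioi 0) ∧
      gibbsInt V T ψ ≤ Real.exp (M / T) *
        (η * (T / A) ^ (p / α) * Real.Gamma (p / α + 1) + C) := by
  have h1 := lintegral_mul_exp_neg_le hψc hψ hα hp hη hC (div_pos hA hT) hG
  rw [inv_div] at h1
  have hnn : ∀ r, 0 ≤ ψ r * Real.exp (-(A / T * r ^ α)) := fun r =>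
    mul_nonneg (hψ r) (Real.exp_nonneg _)
  have hm : AEStronglyMeasurable (fun r => ψ r * Real.exp (-(A / T * r ^ α)))
      (volume.restrict (Set.Ioi 0)) := by
    have := hψc.measurable
    exact (by fun_prop : Measurable fun r => ψ r * Real.exp (-(A / T * r ^ α))).aestronglyMeasurable
  have hi : IntegrableOn (fun r => ψ r * Real.exp (-(A / T * r ^ α))) (Set.Ioi 0) :=
    ⟨hm, (hasFiniteIntegral_iff_ofReal (Eventually.of_forall hnn)).2
      (h1.trans_lt ENNReal.ofReal_lt_top)⟩
  have hle : ∀ r ∈ Set.Ioi (0 : ℝ), ψ r * Real.exp (-V r / T) ≤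
      Real.exp (M / T) * (ψ r * Real.exp (-(A / T * r ^ α))) := by
    intro r hr
    rw [mul_left_comm, ← Real.exp_add]
    refine mul_le_mul_of_nonneg_left (Real.exp_le_exp.2 ?_) (hψ r)
    rw [show M / T + -(A / T * r ^ α) = (M - A * r ^ α) / T by ring]
    have := hM r (le_of_lt hr)
    gcongr
    linarith
  have hiV : IntegrableOn (fun r => ψ r * Real.exp (-V r / T)) (Set.Ioi 0) := by
    refine (hi.const_mul (Real.exp (M / T))).mono' ?_ ?_
    · exact (by fun_prop : Continuous fun r => ψ r * Real.exp (-V r / T)).aestronglyMeasurable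
    · filter_upwards [ae_restrict_mem measurableSet_Ioi] with r hr
      rw [Real.norm_of_nonneg (mul_nonneg (hψ r) (Real.exp_nonneg _))]
      exact hle r hr
  refine ⟨hiV, ?_⟩
  calc gibbsInt V T ψ
      ≤ ∫ r in Set.Ioi 0, Real.exp (M / T) * (ψ r * Real.exp (-(A / T * r ^ α))) :=
        setIntegral_mono_on hiV (hi.const_mul _) measurableSet_Ioi hle
    _ ≤ _ := by
        rw [integral_const_mul]
        refine mul_le_mul_of_nonneg_left ?_ (Real.exp_nonneg _)
        rw [integral_eq_lintegral_of_nonneg_ae (Eventually.of_forall hnn) hm]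
        refine ENNReal.toReal_le_of_le_ofReal ?_ h1
        have := Real.Gamma_nonneg_of_nonneg (s := p / α + 1) (by positivity)
        have : 0 ≤ (T / A) ^ (p / α) := Real.rpow_nonneg (by positivity) _
        positivity

end Layer

/-! ### Mean square of the second derivative at high temperature -/

section Stiff

variable {V W : ℝ → ℝ} {A α T : ℝ}

theorem memLp_two_distance_of_even {g : ℝ → ℝ} (h : Admissible V T) (hg : Continuous g)
    (he : ∀ r, g (-r) ^ 2 = g r ^ 2)
    (hi : IntegrableOn (fun r => g r ^ 2 * Real.exp (-V r / T)) (Set.Ioi 0)) :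
    MemLp g 2 (distanceMeasure V T) := by
  rw [memLp_two_iff_integrable_sq hg.aestronglyMeasurable, h.integrable_distance_iff]
  exact integrable_of_even (fun r => by rw [he, h.pot.even]) hi

/-- The little-o bound only holds beyond some radius; below it monotonicity replaces `g` by a
constant. -/
theorem exists_le_of_isLittleO {g : ℝ → ℝ} {p : ℝ} (hg : MonotoneOn g (Set.Ici 1))
    (h1 : 0 ≤ g 1) (ho : g =o[atTop] fun R : ℝ => R ^ p) {η : ℝ} (hη : 0 < η) :
    ∃ C, 0 ≤ C ∧ ∀ R, 1 ≤ R → g R ≤ η * R ^ p + C := by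
  obtain ⟨R₀, hR₀⟩ := eventually_atTop.1 (ho.def hη)
  set R₁ := max R₀ 1
  have hR₁ : 1 ≤ R₁ := le_max_right _ _
  refine ⟨g R₁, h1.trans (hg (by simp) hR₁ hR₁), fun R hR => ?_⟩
  have hp : 0 ≤ R ^ p := Real.rpow_nonneg (by linarith) _
  rcases le_total R R₁ with h | h
  · have := hg hR hR₁ h
    have := mul_nonneg hη.le hp
    linarith
  · have h2 := hR₀ R ((le_max_left _ _).trans h)
    rw [Real.norm_eq_abs, Real.norm_of_nonneg hp] at h2
    have := le_abs_self (g R)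
    have := h1.trans (hg (by simp) hR₁ hR₁)
    linarith

/-- On the tail `V''²` is at most twice the square of the power term plus twice `W''²`. The second
part is controlled by hypothesis. The first has a primitive of order `o(R^{α-1})` because `2α - 4 <
α - 2` and `-1 < α - 2`. -/
theorem HasPowerTail.exists_integral_stiffness_le (h : IsChainPotential V)
    (hW : HasPowerTail V W A α) (hα1 : 1 < α) (hα2 : α < 2)
    (ho : (fun R : ℝ => ∫ r in (1 : ℝ)..R, (deriv (deriv W) r) ^ 2) =o[atTop]
      fun R : ℝ => R ^ (α - 1)) {η : ℝ} (hη : 0 < η) :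
    ∃ C, 0 ≤ C ∧ ∀ R, 0 ≤ R →
      ∫ r in (0 : ℝ)..R, deriv (deriv V) r ^ 2 ≤ η * R ^ (α - 1) + C := by
  have hcV : Continuous fun r => deriv (deriv V) r ^ 2 := h.continuous_deriv_deriv.pow 2
  have hcW : Continuous fun r => deriv (deriv W) r ^ 2 :=
    (contDiff_infty_iff_deriv.1 (contDiff_infty_iff_deriv.1 hW.smooth).2).2.continuous.pow 2
  -- Raising the exponent `2α - 4` to some `q > -1` avoids distinguishing bounded, logarithmic and
  -- power growth of the primitive; `q < α - 2` keeps it `o(R^{α-1})`.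
  obtain ⟨q, hq1, hq2⟩ : ∃ q, max (2 * α - 4) (-1) < q ∧ q < α - 2 :=
    exists_between (max_lt (by linarith) (by linarith))
  have hq3 : -1 < q := (le_max_right _ _).trans_lt hq1
  have hq4 : 2 * α - 4 < q := (le_max_left _ _).trans_lt hq1
  set K := (A * α * (α - 1)) ^ 2 with hK
  have hK0 : 0 ≤ K := sq_nonneg _
  set g : ℝ → ℝ := fun R => 2 * K * ((q + 1)⁻¹ * R ^ (q + 1)) +
    2 * ∫ r in (1 : ℝ)..R, (deriv (deriv W) r) ^ 2 with hg
  have hpow : (fun R : ℝ => R ^ (q + 1)) =o[atTop] fun R : ℝ => R ^ (α - 1) := by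
    refine isLittleO_of_tendsto' ?_ ((tendsto_rpow_neg_atTop
      (by linarith : 0 < α - 2 - q)).congr' ?_)
    · filter_upwards [eventually_gt_atTop 0] with R hR h0
      exact absurd h0 (Real.rpow_pos_of_pos hR _).ne'
    · filter_upwards [eventually_gt_atTop 0] with R hR
      rw [← Real.rpow_sub hR]; congr 1; ring
  have hgo : g =o[atTop] fun R : ℝ => R ^ (α - 1) :=
    (((hpow.const_mul_left _).const_mul_left _).add
      (ho.const_mul_left 2))
  have hgm : MonotoneOn g (Set.Ici 1) := by
    intro a ha b hb hab
    have ha1 : (1 : ℝ) ≤ a := ha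
    have h1 : a ^ (q + 1) ≤ b ^ (q + 1) := Real.rpow_le_rpow (by linarith) hab (by linarith)
    have h2 : ∫ r in (1 : ℝ)..a, (deriv (deriv W) r) ^ 2 ≤
        ∫ r in (1 : ℝ)..b, (deriv (deriv W) r) ^ 2 :=
      intervalIntegral.integral_mono_interval le_rfl ha1 hab
        (Eventually.of_forall fun r => sq_nonneg _) (hcW.intervalIntegrable _ _)
    have h3 : 0 ≤ (q + 1)⁻¹ := inv_nonneg.2 (by linarith)
    simp only [hg]
    gcongr
  have hg1 : 0 ≤ g 1 := by
    have : 0 ≤ (q + 1)⁻¹ := inv_nonneg.2 (by linarith)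
    simp only [hg, Real.one_rpow, intervalIntegral.integral_same]
    positivity
  obtain ⟨C, hC0, hC⟩ := exists_le_of_isLittleO hgm hg1 hgo hη
  have hI0 : 0 ≤ ∫ r in (0 : ℝ)..1, deriv (deriv V) r ^ 2 :=
    intervalIntegral.integral_nonneg zero_le_one fun r _ => sq_nonneg _
  refine ⟨(∫ r in (0 : ℝ)..1, deriv (deriv V) r ^ 2) + C, by positivity, fun R hR => ?_⟩
  have hp : 0 ≤ R ^ (α - 1) := Real.rpow_nonneg hR _
  have hηp := mul_nonneg hη.le hp
  rcases le_total R 1 with h1 | h1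
  · have := intervalIntegral.integral_mono_interval le_rfl hR h1
      (Eventually.of_forall fun r => sq_nonneg (deriv (deriv V) r))
      (hcV.intervalIntegrable (μ := volume) _ _)
    linarith
  · rw [← intervalIntegral.integral_add_adjacent_intervals (hcV.intervalIntegrable 0 1)
      (hcV.intervalIntegrable 1 R)]
    have hqi : IntervalIntegrable (fun r : ℝ => r ^ q) volume 1 R :=
      intervalIntegral.intervalIntegrable_rpow' hq3
    have h2 : ∫ r in (1 : ℝ)..R, deriv (deriv V) r ^ 2 ≤
        ∫ r in (1 : ℝ)..R, (2 * K * r ^ q + 2 * deriv (deriv W) r ^ 2) := by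
      refine intervalIntegral.integral_mono_on_of_le_Ioo h1 (hcV.intervalIntegrable 1 R)
        ((hqi.const_mul _).add ((hcW.intervalIntegrable 1 R).const_mul 2)) fun r hr => ?_
      rw [hW.deriv_deriv_eq hr.1]
      have hr0 : (0 : ℝ) < r := by linarith [hr.1]
      have h3 : r ^ (2 * (α - 2)) ≤ r ^ q :=
        Real.rpow_le_rpow_of_exponent_le hr.1.le (by linarith)
      have h4 : r ^ (2 * (α - 2)) = (r ^ (α - 2)) ^ 2 := by
        rw [sq, ← Real.rpow_add hr0]; congr 1; ring
      rw [h4] at h3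
      have h5 : K * (r ^ (α - 2)) ^ 2 ≤ K * r ^ q := mul_le_mul_of_nonneg_left h3 hK0
      rw [hK, ← mul_pow] at h5
      nlinarith [sq_nonneg (A * α * (α - 1) * r ^ (α - 2) - deriv (deriv W) r)]
    rw [intervalIntegral.integral_add (hqi.const_mul _) ((hcW.intervalIntegrable 1 R).const_mul 2),
      intervalIntegral.integral_const_mul, intervalIntegral.integral_const_mul,
      integral_rpow (Or.inl hq3), Real.one_rpow] at h2
    have h6 := hC R h1
    simp only [hg] at h6
    have h7 : 2 * K * ((R ^ (q + 1) - 1) / (q + 1)) ≤ 2 * K * ((q + 1)⁻¹ * R ^ (q + 1)) := by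
      rw [div_eq_inv_mul]
      have : 0 ≤ (q + 1)⁻¹ := inv_nonneg.2 (by linarith)
      gcongr
      linarith
    linarith

theorem HasPowerTail.memLp_stiffness (h : IsChainPotential V) (hW : HasPowerTail V W A α)
    (hα1 : 1 < α) (hα2 : α < 2) (hA : 0 < A) (hT : 0 < T)
    (ho : (fun R : ℝ => ∫ r in (1 : ℝ)..R, (deriv (deriv W) r) ^ 2) =o[atTop]
      fun R : ℝ => R ^ (α - 1)) :
    MemLp (deriv (deriv V)) 2 (distanceMeasure V T) := by
  have hα : 0 < α := by linarith
  obtain ⟨M, hM0, hM⟩ := hW.exists_le h hα hA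
  obtain ⟨C, hC0, hC⟩ := hW.exists_integral_stiffness_le h hα1 hα2 ho one_pos
  exact memLp_two_distance_of_even (hW.admissible h hα hA hT) h.continuous_deriv_deriv
    (fun r => by rw [h.deriv_deriv_neg])
    (integrableOn_and_gibbsInt_le h.continuous (h.continuous_deriv_deriv.pow 2)
      (fun r => sq_nonneg _) hA hα (by linarith) zero_le_one hC0 hT hM hC).1

theorem HasPowerTail.tendsto_stiffnessSq (h : IsChainPotential V) (hW : HasPowerTail V W A α)
    (hα1 : 1 < α) (hα2 : α < 2) (hA : 0 < A)
    (ho : (fun R : ℝ => ∫ r in (1 : ℝ)..R, (deriv (deriv W) r) ^ 2) =o[atTop]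
      fun R : ℝ => R ^ (α - 1)) :
    Tendsto (fun ε => stiffnessSq V (ε ^ α) / ε ^ (α - 2)) atTop (𝓝 0) := by
  have hα : 0 < α := by linarith
  obtain ⟨M, hM0, hM⟩ := hW.exists_le h hα hA
  have h0 := hW.tendsto_gibbsInt_one h hα hA
  have hp := powInt_pos hA hα (β := 0) le_rfl
  rw [one_mul] at h0
  have hI : Tendsto (fun ε => gibbsInt V (ε ^ α) (fun r => deriv (deriv V) r ^ 2) / ε ^ (α - 1))
      atTop (𝓝 0) := by
    set B := Real.exp M * (A⁻¹ ^ ((α - 1) / α) * Real.Gamma ((α - 1) / α + 1)) with hB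
    have hB0 : 0 < B := by
      have : 0 < Real.Gamma ((α - 1) / α + 1) :=
        Real.Gamma_pos_of_pos (add_pos (div_pos (by linarith) hα) one_pos)
      have : 0 < A⁻¹ ^ ((α - 1) / α) := Real.rpow_pos_of_pos (by positivity) _
      positivity
    rw [Metric.tendsto_nhds]
    intro e he
    -- With `η = e / (2B)` the leading term is `(e/2) ε^{α-1}`; the constant `C`, divided by
    -- `ε^{α-1}`, uses less than the other half for large `ε`.
    obtain ⟨C, hC0, hC⟩ := hW.exists_integral_stiffness_le h hα1 hα2 ho
      (show 0 < e / (2 * B) by positivity)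
    have hlim : Tendsto (fun ε : ℝ => Real.exp M * C / ε ^ (α - 1)) atTop (𝓝 0) :=
      (tendsto_rpow_atTop (by linarith)).const_div_atTop _
    filter_upwards [eventually_ge_atTop 1, hlim.eventually_lt_const (half_pos he)] with ε hε hlt
    have hε0 : 0 < ε := by linarith
    have hεα : 1 ≤ ε ^ α := Real.one_le_rpow hε hα.le
    have hεp : 0 < ε ^ (α - 1) := Real.rpow_pos_of_pos hε0 _
    have h1 := (integrableOn_and_gibbsInt_le h.continuous (h.continuous_deriv_deriv.pow 2)
      (fun r => sq_nonneg _) hA hα (by linarith : 0 ≤ α - 1)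
      (show 0 ≤ e / (2 * B) by positivity) hC0 (by positivity : 0 < ε ^ α) hM hC).2
    have h2 : (ε ^ α / A) ^ ((α - 1) / α) = ε ^ (α - 1) * A⁻¹ ^ ((α - 1) / α) := by
      rw [div_eq_mul_inv, Real.mul_rpow (by positivity) (by positivity), ← Real.rpow_mul hε0.le]
      congr 2; field_simp
    have h3 : Real.exp (M / ε ^ α) ≤ Real.exp M := Real.exp_le_exp.2 (div_le_self hM0 hεα)
    have h4 : 0 ≤ gibbsInt V (ε ^ α) fun r => deriv (deriv V) r ^ 2 :=
      integral_nonneg fun r => mul_nonneg (sq_nonneg _) (Real.exp_nonneg _)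
    have hΓ : 0 < Real.Gamma ((α - 1) / α + 1) :=
      Real.Gamma_pos_of_pos (add_pos (div_pos (by linarith) hα) one_pos)
    have hAp : 0 < A⁻¹ ^ ((α - 1) / α) := Real.rpow_pos_of_pos (by positivity) _
    rw [h2] at h1
    have h5 : gibbsInt V (ε ^ α) (fun r => deriv (deriv V) r ^ 2) ≤
        e / 2 * ε ^ (α - 1) + Real.exp M * C := by
      calc _ ≤ _ := h1
        _ ≤ Real.exp M * (e / (2 * B) * (ε ^ (α - 1) * A⁻¹ ^ ((α - 1) / α)) *
              Real.Gamma ((α - 1) / α + 1) + C) := by gcongr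
        _ = e / (2 * B) * B * ε ^ (α - 1) + Real.exp M * C := by rw [hB]; ring
        _ = _ := by congr 2; field_simp
    rw [Real.dist_eq, sub_zero, abs_of_nonneg (div_nonneg h4 hεp.le), div_lt_iff₀ hεp]
    rw [div_lt_iff₀ hεp] at hlt
    linarith
  have h1 := hI.div h0 hp.ne'
  rw [zero_div] at h1
  refine h1.congr' ?_
  filter_upwards [eventually_gt_atTop 0] with ε hε
  simp only [Pi.div_apply]
  have e1 : ε ^ (α - 1) = ε ^ (α - 2) * ε := by
    rw [← Real.rpow_add_one hε.ne']; congr 1; ring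
  have : 0 < ε ^ (α - 2) := Real.rpow_pos_of_pos hε _
  rw [stiffnessSq_eq h, e1, add_zero, Real.rpow_one]
  by_cases hz : gibbsInt V (ε ^ α) (fun _ => 1) = 0
  · simp [hz]
  · field_simp

end Stiff

/-! ### From moment asymptotics to the conductivity -/

section FromMoments

variable {V : ℝ → ℝ} {γ : ℝ}

theorem tendsto_div_rpow_of_comp {l : Filter ℝ} (hl : ∀ᶠ T in l, 0 < T) {F : ℝ → ℝ}
    {α q c : ℝ} (hα : 0 < α) (hlα : Tendsto (fun T : ℝ => T ^ α⁻¹) l l)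
    (h : Tendsto (fun ε => F (ε ^ α) / ε ^ q) l (𝓝 c)) :
    Tendsto (fun T => F T / T ^ (q / α)) l (𝓝 c) := by
  refine (h.comp hlα).congr' ?_
  filter_upwards [hl] with T hT
  simp only [Function.comp_apply]
  rw [← Real.rpow_mul hT.le, ← Real.rpow_mul hT.le, inv_mul_cancel₀ hα.ne', Real.rpow_one,
    inv_mul_eq_div]

theorem rpow_two_sub {T : ℝ} (hT : 0 < T) (α : ℝ) :
    T ^ (2 - 2 / α) = T * T ^ (1 - 2 / α) := by
  rw [show 2 - 2 / α = 1 + (1 - 2 / α) by ring, Real.rpow_add hT, Real.rpow_one]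

/-- Bounds on the correction to the conductivity at temperature `T`. -/
structure ConductivityBounds (V : ℝ → ℝ) (γ T k : ℝ) : Prop where
  nonneg : 0 ≤ k
  le : k ≤ T * forceSq V T / 2 / (3 * γ)
  sq_le : MemLp (deriv (deriv V)) 2 (distanceMeasure V T) →
    (3 * γ * k - T * forceSq V T / 2) ^ 2 ≤ T ^ 2 * stiffnessSq V T / (2 * γ) * k

theorem exists_conductivity_function (hγ : 0 < γ) (had : ∀ T, 0 < T → Admissible V T)
    (hd : ∀ T, 0 < T → GeneratesDynamics V γ T) :
    ∃ k : ℝ → ℝ, ∀ T, 0 < T → IsConductivity V γ T (γ + (T ^ 2)⁻¹ * k T) ∧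
      ConductivityBounds V γ T (k T) := by
  choose! k hk using fun T (hT : 0 < T) => (had T hT).exists_conductivity hγ (hd T hT)
  exact ⟨k, fun T hT => ⟨(hk T hT).1, (hk T hT).2.1, (hk T hT).2.2.1, (hk T hT).2.2.2⟩⟩

theorem ConductivityBounds.correction_le {T k : ℝ} (h : ConductivityBounds V γ T k) (hT : 0 < T)
    (hγ : 0 < γ) {α : ℝ} :
    (T ^ 2)⁻¹ * k ≤ 1 / (6 * γ) * (forceSq V T / T ^ (2 - 2 / α)) * T ^ (1 - 2 / α) := by
  have h1 := mul_le_mul_of_nonneg_left h.le (inv_nonneg.2 (sq_nonneg T))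
  refine h1.trans (le_of_eq ?_)
  have e := rpow_two_sub hT α
  have : 0 < T ^ (1 - 2 / α) := Real.rpow_pos_of_pos hT _
  rw [e]
  field_simp
  ring

variable {l : Filter ℝ} {k : ℝ → ℝ} {α c : ℝ}

/-- Both sides tend to `γ > 0`: the correction lies between `0` and a constant multiple of
`T^{1-2/α}`. Nothing about `V''` is needed. -/
theorem conductivity_isEquivalent (hγ : 0 < γ) (hl : ∀ᶠ T in l, 0 < T)
    (hk : ∀ T, 0 < T → ConductivityBounds V γ T (k T))
    (hm : Tendsto (fun T => forceSq V T / T ^ (2 - 2 / α)) l (𝓝 c))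
    (h0 : Tendsto (fun T : ℝ => T ^ (1 - 2 / α)) l (𝓝 0)) :
    (fun T => γ + (T ^ 2)⁻¹ * k T) ~[l] fun T => γ + c / (6 * γ) * T ^ (1 - 2 / α) := by
  have h1 : Tendsto (fun T => (T ^ 2)⁻¹ * k T) l (𝓝 0) := by
    have h2 : Tendsto (fun T => 1 / (6 * γ) * (forceSq V T / T ^ (2 - 2 / α)) * T ^ (1 - 2 / α)) l
        (𝓝 0) := by simpa using (hm.const_mul (1 / (6 * γ))).mul h0
    refine squeeze_zero' ?_ ?_ h2
    · filter_upwards [hl] with T hT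
      exact mul_nonneg (by positivity) (hk T hT).nonneg
    · filter_upwards [hl] with T hT
      exact (hk T hT).correction_le hT hγ
  have e1 := (isEquivalent_const_iff_tendsto hγ.ne').2 (by simpa using h1.const_add γ)
  have e2 := (isEquivalent_const_iff_tendsto hγ.ne').2
    (by simpa using (h0.const_mul (c / (6 * γ))).const_add γ)
  exact e1.trans e2.symm

/-- With `x = 6γ k / (T ⟨V'²⟩)`, the ratio of the correction to its upper bound, inserting `k ≤ T
⟨V'²⟩ / (6γ)` into `sq_le` gives `(x - 1)² ≤ T ⟨V''²⟩ / (3γ² ⟨V'²⟩)`. The hypotheses on the two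
moments make the right side vanish. -/
theorem conductivity_sub_isEquivalent (hγ : 0 < γ) (hc : 0 < c) (hl : ∀ᶠ T in l, 0 < T)
    (hk : ∀ T, 0 < T → ConductivityBounds V γ T (k T))
    (h2 : ∀ᶠ T in l, MemLp (deriv (deriv V)) 2 (distanceMeasure V T))
    (hm : Tendsto (fun T => forceSq V T / T ^ (2 - 2 / α)) l (𝓝 c))
    (hn : Tendsto (fun T => stiffnessSq V T / T ^ (1 - 2 / α)) l (𝓝 0)) :
    (fun T => γ + (T ^ 2)⁻¹ * k T - γ) ~[l] fun T => c / (6 * γ) * T ^ (1 - 2 / α) := by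
  have hpow : ∀ T : ℝ, 0 < T → T ^ (2 - 2 / α) = T * T ^ (1 - 2 / α) := fun T hT =>
    rpow_two_sub hT α
  have hmpos : ∀ᶠ T in l, 0 < forceSq V T := by
    filter_upwards [hl, hm.eventually_const_lt hc] with T hT h
    have : 0 < T ^ (2 - 2 / α) := Real.rpow_pos_of_pos hT _
    exact (div_pos_iff_of_pos_right this).1 h
  set x : ℝ → ℝ := fun T => 6 * γ * k T / (T * forceSq V T) with hx
  have hx1 : Tendsto x l (𝓝 1) := by
    have hq : Tendsto (fun T => (x T - 1) ^ 2) l (𝓝 0) := by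
      have hq' : Tendsto (fun T => 1 / (3 * γ ^ 2) * (stiffnessSq V T / T ^ (1 - 2 / α) /
          (forceSq V T / T ^ (2 - 2 / α)))) l (𝓝 0) := by
        have h3 := (hn.div hm hc.ne').const_mul (1 / (3 * γ ^ 2))
        rwa [zero_div, mul_zero] at h3
      refine squeeze_zero' (Eventually.of_forall fun T => sq_nonneg _) ?_ hq'
      filter_upwards [hl, hmpos, h2] with T hT hmT h2T
      have hb := (hk T hT).sq_le h2T
      have hn0 : 0 ≤ stiffnessSq V T := integral_nonneg fun _ => mul_self_nonneg _
      have hp : 0 < T ^ (1 - 2 / α) := Real.rpow_pos_of_pos hT _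
      have h3 : T ^ 2 * stiffnessSq V T / (2 * γ) * k T ≤
          T ^ 2 * stiffnessSq V T / (2 * γ) * (T * forceSq V T / 2 / (3 * γ)) :=
        mul_le_mul_of_nonneg_left (hk T hT).le (by positivity)
      have h4 : (x T - 1) ^ 2 = (3 * γ * k T - T * forceSq V T / 2) ^ 2 *
          (4 / (T * forceSq V T) ^ 2) := by
        simp only [hx]; field_simp; ring
      rw [h4]
      calc _ ≤ T ^ 2 * stiffnessSq V T / (2 * γ) * (T * forceSq V T / 2 / (3 * γ)) *
            (4 / (T * forceSq V T) ^ 2) :=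
            mul_le_mul_of_nonneg_right (hb.trans h3) (by positivity)
        _ = _ := by
            rw [hpow T hT]; field_simp; ring
    have h5 := (Real.continuous_sqrt.tendsto 0).comp hq
    simp only [Function.comp_def, Real.sqrt_sq_eq_abs, Real.sqrt_zero] at h5
    have h6 := (tendsto_zero_iff_abs_tendsto_zero _).2 h5
    simpa using h6.add_const 1
  refine isEquivalent_of_tendsto_one ?_
  have h7 := hx1.mul (hm.div_const c)
  rw [div_self hc.ne', one_mul] at h7
  refine h7.congr' ?_
  filter_upwards [hl, hmpos] with T hT hmT
  have hp : 0 < T ^ (1 - 2 / α) := Real.rpow_pos_of_pos hT _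
  simp only [hx, Pi.div_apply]
  rw [hpow T hT]
  field_simp
  ring

/-- The lower bound is the contribution `γ` of the noise. Above, the normalized mean square force is
eventually below `6c`, so the resulting constant involves only `γ` and the limit `c`; the dependence
on `V` is confined to the threshold. -/
theorem eventually_conductivity_le (hγ : 0 < γ) (hl : ∀ᶠ T in l, 0 < T)
    (hk : ∀ T, 0 < T → ConductivityBounds V γ T (k T)) (hc : 0 < c)
    (hm : Tendsto (fun T => forceSq V T / T ^ (2 - 2 / α)) l (𝓝 c))
    (h1 : ∀ᶠ T : ℝ in l, 1 ≤ T ^ (1 - 2 / α)) :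
    ∀ᶠ T in l, γ ≤ γ + (T ^ 2)⁻¹ * k T ∧
      γ + (T ^ 2)⁻¹ * k T ≤ (γ + c / γ) * T ^ (1 - 2 / α) := by
  filter_upwards [hl, h1, hm.eventually_lt_const (show c < 6 * c by linarith)] with T hT h1T h2T
  have h3 := (hk T hT).correction_le hT hγ (α := α)
  have h4 : 0 ≤ (T ^ 2)⁻¹ * k T := mul_nonneg (by positivity) (hk T hT).nonneg
  refine ⟨by linarith, ?_⟩
  have h5 : 1 / (6 * γ) * (forceSq V T / T ^ (2 - 2 / α)) * T ^ (1 - 2 / α) ≤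
      1 / (6 * γ) * (6 * c) * T ^ (1 - 2 / α) := by gcongr
  have h6 : 1 / (6 * γ) * (6 * c) = c / γ := by field_simp
  rw [h6] at h5
  have h7 : γ ≤ γ * T ^ (1 - 2 / α) := le_mul_of_one_le_right hγ.le h1T
  linarith

end FromMoments

/-! ### Order of vanishing of a smooth potential at the origin -/

section Order

/-- The leading term of the Taylor expansion at `0` of a smooth function. -/
theorem tendsto_div_pow_of_iteratedDeriv_eq_zero {k : ℕ} {f : ℝ → ℝ}
    (hf : ContDiff ℝ ((⊤ : ℕ∞) : WithTop ℕ∞) f) (h : ∀ i < k, iteratedDeriv i f 0 = 0) :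
    Tendsto (fun r => f r / r ^ k) (𝓝[>] 0) (𝓝 (iteratedDeriv k f 0 / k.factorial)) := by
  induction k generalizing f with
  | zero =>
    simp only [pow_zero, div_one, iteratedDeriv_zero, Nat.factorial_zero, Nat.cast_one]
    exact (hf.continuous.tendsto 0).mono_left nhdsWithin_le_nhds
  | succ k ih =>
    have hf' := (contDiff_infty_iff_deriv.1 hf).2
    have h1 := ih hf' fun i hi => by
      rw [← iteratedDeriv_succ']; exact h (i + 1) (by omega)
    rw [← iteratedDeriv_succ'] at h1
    -- L'Hôpital's rule: the induction hypothesis applied to `f'` gives the quotient of derivatives,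
    -- and the extra factor `k + 1` completes the factorial.
    refine deriv.lhopital_zero_nhdsGT (Eventually.of_forall fun r =>
      hf.differentiable (by simp) r) ?_ ?_ ?_ ?_
    · filter_upwards [self_mem_nhdsWithin] with r hr
      have : (0 : ℝ) < r := hr
      simp only [deriv_pow_field]
      positivity
    · have := (hf.continuous.tendsto 0).mono_left (nhdsWithin_le_nhds (s := Set.Ioi 0))
      rwa [show f 0 = 0 by simpa using h 0 (by omega)] at this
    · have : Tendsto (fun r : ℝ => r ^ (k + 1)) (𝓝 0) (𝓝 (0 ^ (k + 1))) :=
        (continuous_pow (k + 1)).tendsto 0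
      rw [zero_pow (by omega)] at this
      exact this.mono_left nhdsWithin_le_nhds
    · have h2 := h1.div_const ((k : ℝ) + 1)
      rw [div_div] at h2
      rw [Nat.factorial_succ, Nat.cast_mul, mul_comm ((k + 1 : ℕ) : ℝ), Nat.cast_succ]
      refine h2.congr fun r => ?_
      simp only [deriv_pow_field, Nat.add_sub_cancel, Nat.cast_succ]
      rw [div_div, mul_comm (r ^ k)]

theorem tendsto_rpow_nhdsGT_zero {y : ℝ} (hy : 0 < y) :
    Tendsto (fun r : ℝ => r ^ y) (𝓝[>] 0) (𝓝 0) := by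
  have h := (Real.continuousAt_rpow_const 0 y (Or.inr hy.le)).tendsto
  rw [Real.zero_rpow hy.ne'] at h
  exact h.mono_left nhdsWithin_le_nhds

theorem tendsto_rpow_neg_nhdsGT_zero' {y : ℝ} (hy : 0 < y) :
    Tendsto (fun r : ℝ => r ^ (-y)) (𝓝[>] 0) atTop := by
  refine ((tendsto_rpow_atTop hy).comp tendsto_inv_nhdsGT_zero).congr' ?_
  filter_upwards [self_mem_nhdsWithin] with r hr
  have : (0 : ℝ) < r := hr
  rw [Function.comp_apply, Real.inv_rpow this.le, Real.rpow_neg this.le]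

/-- A smooth function equivalent to a power at the origin is equivalent to its Taylor monomial,
and the equivalence can be differentiated. -/
theorem tendsto_derivs_of_isEquivalent {V : ℝ → ℝ} (hV : ContDiff ℝ ((⊤ : ℕ∞) : WithTop ℕ∞) V)
    {A δ : ℝ} (hA : 0 < A) (hδ : 2 < δ) (h : V ~[𝓝[>] 0] fun r => A * r ^ δ) :
    Tendsto (fun r => V r / r ^ δ) (𝓝[>] 0) (𝓝 A) ∧
    Tendsto (fun r => deriv V r / r ^ (δ - 1)) (𝓝[>] 0) (𝓝 (A * δ)) ∧
    Tendsto (fun r => deriv (deriv V) r / r ^ (δ - 2)) (𝓝[>] 0) (𝓝 (A * δ * (δ - 1))) := by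
  have hpos : ∀ᶠ r : ℝ in 𝓝[>] 0, 0 < r := self_mem_nhdsWithin
  have h0 : Tendsto (fun r => V r / r ^ δ) (𝓝[>] 0) (𝓝 A) := by
    have h1 := (isEquivalent_iff_tendsto_one (by
      filter_upwards [hpos] with r hr
      have := Real.rpow_pos_of_pos hr δ
      positivity)).1 h
    have h2 := h1.const_mul A
    rw [mul_one] at h2
    refine h2.congr' ?_
    filter_upwards [hpos] with r hr
    have := Real.rpow_pos_of_pos hr δ
    simp only [Pi.div_apply]
    field_simp
  -- Comparing two scalings of `V`: a limit of `V / r^k` forces `r^{δ-k}` to converge, which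
  -- constrains `k`.
  have hratio : ∀ {k : ℕ} {c : ℝ}, Tendsto (fun r => V r / r ^ k) (𝓝[>] 0) (𝓝 c) →
      Tendsto (fun r : ℝ => r ^ (δ - k)) (𝓝[>] 0) (𝓝 (c / A)) := by
    intro k c hc
    refine (hc.div h0 hA.ne').congr' ?_
    have hne : ∀ᶠ r in 𝓝[>] (0 : ℝ), V r / r ^ δ ≠ 0 := h0.eventually_ne hA.ne'
    filter_upwards [hpos, hne] with r hr hr'
    have h3 := Real.rpow_pos_of_pos hr δ
    have h4 : V r ≠ 0 := fun h => hr' (by simp [h])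
    simp only [Pi.div_apply]
    rw [Real.rpow_sub hr, Real.rpow_natCast]
    field_simp
  -- If every derivative vanished, `V / r^N` would have a limit for some `N > δ`, although `r^{δ-N}`
  -- diverges.
  have hex : ∃ k, iteratedDeriv k V 0 ≠ 0 := by
    by_contra hcon
    push Not at hcon
    obtain ⟨N, hN⟩ := exists_nat_gt δ
    have h1 := hratio (tendsto_div_pow_of_iteratedDeriv_eq_zero hV (k := N) fun i _ => hcon i)
    rw [show δ - N = -(N - δ) by ring] at h1
    exact not_tendsto_nhds_of_tendsto_atTop
      (tendsto_rpow_neg_nhdsGT_zero' (by linarith : 0 < (N : ℝ) - δ)) _ h1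
  classical
  set k := Nat.find hex with hk
  have hk0 : iteratedDeriv k V 0 ≠ 0 := Nat.find_spec hex
  have hkm : ∀ i < k, iteratedDeriv i V 0 = 0 := fun i hi => not_not.1 (Nat.find_min hex hi)
  have h1 := tendsto_div_pow_of_iteratedDeriv_eq_zero hV hkm
  -- For `k < δ` the limit of `r^{δ-k}` is zero, contradicting the nonzero Taylor coefficient; for
  -- `k > δ` there is no finite limit. So `δ` is an integer, and Taylor expansion gives `V'` and
  -- `V''`.
  have hkδ : (k : ℝ) = δ := by
    have h2 := hratio h1
    rcases lt_trichotomy (k : ℝ) δ with hlt | heq | hgt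
    · have h3 := tendsto_nhds_unique h2 (tendsto_rpow_nhdsGT_zero (by linarith : 0 < δ - k))
      exact absurd h3 (div_ne_zero (div_ne_zero hk0 (by positivity)) hA.ne')
    · exact heq
    · rw [show δ - k = -(k - δ) by ring] at h2
      exact absurd h2 (not_tendsto_nhds_of_tendsto_atTop
        (tendsto_rpow_neg_nhdsGT_zero' (by linarith : 0 < (k : ℝ) - δ)) _)
  obtain ⟨m, hm⟩ : ∃ m, k = m + 2 := ⟨k - 2, by
    have : (2 : ℝ) < k := by rw [hkδ]; exact hδ
    have : 2 < k := by exact_mod_cast this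
    omega⟩
  have hAk : iteratedDeriv k V 0 = A * k.factorial := by
    have h2 : Tendsto (fun r => V r / r ^ k) (𝓝[>] 0) (𝓝 A) := by
      simpa only [← hkδ, Real.rpow_natCast] using h0
    have h3 := tendsto_nhds_unique h1 h2
    rwa [div_eq_iff (by positivity)] at h3
  have hV' := (contDiff_infty_iff_deriv.1 hV).2
  have hV'' := (contDiff_infty_iff_deriv.1 hV').2
  rw [hm] at hkm hAk hkδ
  have hf2 : ((m + 2).factorial : ℝ) = (m + 2) * (m + 1) * m.factorial := by
    rw [Nat.factorial_succ, Nat.factorial_succ]; push_cast; ring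
  have hf1 : ((m + 1).factorial : ℝ) = (m + 1) * m.factorial := by
    rw [Nat.factorial_succ]; push_cast; ring
  have hmf : (m.factorial : ℝ) ≠ 0 := by positivity
  have hm1 : (m : ℝ) + 1 ≠ 0 := by positivity
  push_cast at hkδ
  refine ⟨h0, ?_, ?_⟩
  · have h2 := tendsto_div_pow_of_iteratedDeriv_eq_zero hV' (k := m + 1) fun i hi => by
      rw [← iteratedDeriv_succ']; exact hkm _ (by omega)
    rw [← iteratedDeriv_succ', hAk, hf2, hf1] at h2
    have e : A * ((m + 2) * (m + 1) * m.factorial) / ((m + 1) * m.factorial) = A * δ := by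
      rw [← hkδ]; field_simp
    rw [e] at h2
    refine h2.congr fun r => ?_
    rw [show δ - 1 = ((m + 1 : ℕ) : ℝ) by push_cast; linarith, Real.rpow_natCast]
  · have h2 := tendsto_div_pow_of_iteratedDeriv_eq_zero hV'' (k := m) fun i hi => by
      rw [← iteratedDeriv_succ', ← iteratedDeriv_succ']; exact hkm _ (by omega)
    rw [← iteratedDeriv_succ', ← iteratedDeriv_succ', hAk, hf2] at h2
    have e : A * ((m + 2) * (m + 1) * m.factorial) / m.factorial = A * δ * (δ - 1) := by
      rw [← hkδ]; field_simp; ring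
    rw [e] at h2
    refine h2.congr fun r => ?_
    rw [show δ - 2 = (m : ℝ) by linarith, Real.rpow_natCast]

end Order

/-! ### Gibbs integrals and moments at low temperature -/

section LowTemperature

variable {V W : ℝ → ℝ} {A B α δ : ℝ}

/-- Growth handles large `r`, and on the remaining compact interval, which avoids the origin, `V` is
continuous and strictly positive. -/
theorem HasPowerTail.exists_pos_le (h : IsChainPotential V) (hW : HasPowerTail V W B α)
    (hα : 0 < α) (hB : 0 < B) {r₀ : ℝ} (hr₀ : 0 < r₀) :
    ∃ v, 0 < v ∧ ∀ r, r₀ ≤ r → v ≤ V r := by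
  obtain ⟨M, hM0, hM⟩ := hW.exists_le h hα hB
  have hlim : Tendsto (fun r : ℝ => B * r ^ α) atTop atTop :=
    (tendsto_rpow_atTop hα).const_mul_atTop hB
  obtain ⟨R, hR⟩ := eventually_atTop.1 (hlim.eventually_ge_atTop (M + 1))
  obtain ⟨x, hx, hmin⟩ := (isCompact_Icc (a := r₀) (b := max r₀ R)).exists_isMinOn
    ⟨r₀, by simp⟩ h.continuous.continuousOn
  refine ⟨min (V x) 1, lt_min (h.pos x (by linarith [hx.1])) one_pos, fun r hr => ?_⟩
  rcases le_total r (max r₀ R) with h1 | h1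
  · exact (min_le_left _ _).trans (hmin ⟨hr, h1⟩)
  · have h2 := hR r ((le_max_right _ _).trans h1)
    have h3 := hM r (by linarith)
    exact (min_le_right _ _).trans (by linarith)

theorem tendsto_mul_nhdsGT_zero {s : ℝ} (hs : 0 < s) :
    Tendsto (fun ε => ε * s) (𝓝[>] 0) (𝓝[>] 0) := by
  refine tendsto_nhdsWithin_iff.2 ⟨?_, ?_⟩
  · have : Tendsto (fun ε : ℝ => ε * s) (𝓝 0) (𝓝 (0 * s)) :=
      (continuous_mul_const s).tendsto 0
    rw [zero_mul] at this
    exact this.mono_left nhdsWithin_le_nhds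
  · filter_upwards [self_mem_nhdsWithin] with ε hε using mul_pos hε hs

/-- Laplace asymptotics at low temperature: only a neighbourhood of the origin contributes. -/
theorem HasPowerTail.tendsto_gibbsInt_low (h : IsChainPotential V) (hW : HasPowerTail V W B α)
    (hα : 0 < α) (hB : 0 < B) (hA : 0 < A) (hδ : 0 < δ)
    (hV : Tendsto (fun r => V r / r ^ δ) (𝓝[>] 0) (𝓝 A)) {φ : ℝ → ℝ} (hφc : Continuous φ)
    {β c : ℝ} (hβ : 0 ≤ β) (hφ : Tendsto (fun r => φ r / r ^ β) (𝓝[>] 0) (𝓝 c)) {T₁ : ℝ}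
    (hT₁ : 0 < T₁) (hi : IntegrableOn (fun r => φ r * Real.exp (-V r / T₁)) (Set.Ioi 0)) :
    Tendsto (fun ε => gibbsInt V (ε ^ δ) φ / ε ^ (1 + β)) (𝓝[>] 0) (𝓝 (c * powInt A δ β)) := by
  have hpos : ∀ᶠ ε : ℝ in 𝓝[>] 0, 0 < ε := self_mem_nhdsWithin
  obtain ⟨r₀, hr₀, hnear⟩ : ∃ r₀ > 0, ∀ r, 0 < r → r < r₀ →
      |φ r| ≤ (|c| + 1) * r ^ β ∧ A / 2 * r ^ δ ≤ V r := by
    have h1 : ∀ᶠ r in 𝓝[>] (0 : ℝ), |φ r / r ^ β| < |c| + 1 :=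
      hφ.abs.eventually_lt_const (by linarith)
    have h2 : ∀ᶠ r in 𝓝[>] (0 : ℝ), A / 2 < V r / r ^ δ := hV.eventually_const_lt (by linarith)
    obtain ⟨r₀, hr₀, hs⟩ := mem_nhdsGT_iff_exists_Ioo_subset.1 (h1.and h2)
    refine ⟨r₀, hr₀, fun r hr hr' => ?_⟩
    obtain ⟨h3, h4⟩ := hs ⟨hr, hr'⟩
    have h5 := Real.rpow_pos_of_pos hr β
    have h6 := Real.rpow_pos_of_pos hr δ
    rw [abs_div, abs_of_pos h5, div_lt_iff₀ h5] at h3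
    rw [lt_div_iff₀ h6] at h4
    exact ⟨h3.le, h4.le⟩
  obtain ⟨v, hv, hvV⟩ := hW.exists_pos_le h hα hB hr₀
  -- The truncated integrand has the full limit by scaling; the remainder will be exponentially
  -- small.
  set φ₁ : ℝ → ℝ := (Set.Iio r₀).indicator φ with hφ₁
  have hlimnear : Tendsto (fun ε => gibbsInt V (ε ^ δ) φ₁ / ε ^ (1 + β)) (𝓝[>] 0)
      (𝓝 (c * powInt A δ β)) := by
    refine tendsto_gibbsInt_div (D := |c| + 1) (a := A / 2) (M := 0) hpos
      (fun s hs => tendsto_mul_nhdsGT_zero hs) h.continuous.measurable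
      (hφc.measurable.indicator measurableSet_Iio) hδ hβ (by linarith) (by positivity) ?_ hV ?_
    · refine hφ.congr' ?_
      have : ∀ᶠ r in 𝓝[>] (0 : ℝ), r < r₀ := nhdsWithin_le_nhds (gt_mem_nhds hr₀)
      filter_upwards [this] with r hr
      rw [Set.indicator_of_mem (show r ∈ Set.Iio r₀ from hr)]
    · filter_upwards [hpos] with ε hε r hr hne
      have hr' : r < r₀ := by
        by_contra hcon
        exact hne (Set.indicator_of_notMem (show r ∉ Set.Iio r₀ from hcon) _)
      obtain ⟨h1, h2⟩ := hnear r hr hr'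
      rw [Set.indicator_of_mem (show r ∈ Set.Iio r₀ from hr')]
      refine ⟨h1.trans ?_, by linarith⟩
      have := Real.rpow_pos_of_pos hε β
      gcongr
      linarith
  set I : ℝ := ∫ r in Set.Ioi 0, |φ r * Real.exp (-V r / T₁)| with hI
  -- For `r ≥ r₀` the exponent `-V / ε^δ` is `-V / T₁` minus `V (ε^{-δ} - 1/T₁)`, and `V ≥ v` there.
  -- Integrability at the single temperature `T₁` therefore suffices, with the gain `exp (-v
  -- ε^{-δ})`.
  have hfar : ∀ᶠ ε in 𝓝[>] (0 : ℝ),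
      |gibbsInt V (ε ^ δ) φ / ε ^ (1 + β) - gibbsInt V (ε ^ δ) φ₁ / ε ^ (1 + β)| ≤
        I * Real.exp (v / T₁) * ((ε ^ (-δ)) ^ ((1 + β) / δ) * Real.exp (-v * ε ^ (-δ))) := by
    have hsmall : ∀ᶠ ε in 𝓝[>] (0 : ℝ), ε ^ δ < T₁ :=
      (tendsto_rpow_nhdsGT_zero hδ).eventually_lt_const hT₁
    filter_upwards [hpos, hsmall] with ε hε hεT
    have hεδ := Real.rpow_pos_of_pos hε δ
    have hεβ := Real.rpow_pos_of_pos hε (1 + β)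
    have hcmp : ∀ r, Real.exp (-V r / ε ^ δ) ≤ Real.exp (-V r / T₁) := fun r => by
      refine Real.exp_le_exp.2 ?_
      rw [neg_div, neg_div, neg_le_neg_iff]
      exact div_le_div_of_nonneg_left (h.nonneg r) hεδ hεT.le
    have hVc := h.continuous
    have i0 : IntegrableOn (fun r => φ r * Real.exp (-V r / ε ^ δ)) (Set.Ioi 0) := by
      refine hi.abs.mono' (by fun_prop : Continuous fun r =>
        φ r * Real.exp (-V r / ε ^ δ)).aestronglyMeasurable (Eventually.of_forall fun r => ?_)
      rw [Real.norm_eq_abs, abs_mul, abs_mul, Real.abs_exp, Real.abs_exp]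
      exact mul_le_mul_of_nonneg_left (hcmp r) (abs_nonneg _)
    have e1 : ∀ r, φ₁ r * Real.exp (-V r / ε ^ δ) =
        (Set.Iio r₀).indicator (fun r => φ r * Real.exp (-V r / ε ^ δ)) r := fun r => by
      by_cases hr : r ∈ Set.Iio r₀
      · rw [hφ₁, Set.indicator_of_mem hr, Set.indicator_of_mem hr]
      · rw [hφ₁, Set.indicator_of_notMem hr, Set.indicator_of_notMem hr, zero_mul]
    have i1 : IntegrableOn (fun r => φ₁ r * Real.exp (-V r / ε ^ δ)) (Set.Ioi 0) := by
      simp only [e1]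
      exact i0.indicator measurableSet_Iio
    have e2 : (ε ^ (-δ)) ^ ((1 + β) / δ) = (ε ^ (1 + β))⁻¹ := by
      rw [← Real.rpow_mul hε.le, ← Real.rpow_neg hε.le]; congr 1; field_simp
    rw [← sub_div, abs_div, abs_of_pos hεβ, e2, div_eq_mul_inv, gibbsInt, gibbsInt,
      ← integral_sub i0 i1]
    have hb : ∀ r, |φ r * Real.exp (-V r / ε ^ δ) - φ₁ r * Real.exp (-V r / ε ^ δ)| ≤
        Real.exp (v / T₁) * Real.exp (-v * ε ^ (-δ)) * |φ r * Real.exp (-V r / T₁)| := by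
      intro r
      rw [e1]
      by_cases hr : r ∈ Set.Iio r₀
      · rw [Set.indicator_of_mem hr, sub_self, abs_zero]; positivity
      · rw [Set.indicator_of_notMem hr, sub_zero, abs_mul, abs_mul, Real.abs_exp, Real.abs_exp,
          mul_left_comm, ← Real.exp_add, ← Real.exp_add]
        refine mul_le_mul_of_nonneg_left (Real.exp_le_exp.2 ?_) (abs_nonneg _)
        have h1 := hvV r (not_lt.1 hr)
        have h2 : 0 ≤ (ε ^ δ)⁻¹ - T₁⁻¹ := sub_nonneg.2 (inv_anti₀ hεδ hεT.le)
        rw [Real.rpow_neg hε.le]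
        have h3 := mul_le_mul_of_nonneg_right h1 h2
        simp only [div_eq_mul_inv]
        linarith
    have hle : |∫ r in Set.Ioi 0, (φ r * Real.exp (-V r / ε ^ δ) -
        φ₁ r * Real.exp (-V r / ε ^ δ))| ≤
        Real.exp (v / T₁) * Real.exp (-v * ε ^ (-δ)) * I := by
      rw [hI, ← integral_const_mul]
      exact norm_integral_le_of_norm_le
        (f := fun r => φ r * Real.exp (-V r / ε ^ δ) - φ₁ r * Real.exp (-V r / ε ^ δ))
        (hi.abs.const_mul _) (Eventually.of_forall hb)
    calc _ ≤ Real.exp (v / T₁) * Real.exp (-v * ε ^ (-δ)) * I * (ε ^ (1 + β))⁻¹ :=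
          mul_le_mul_of_nonneg_right hle (inv_nonneg.2 hεβ.le)
      _ = _ := by ring
  have hz : Tendsto (fun ε : ℝ => I * Real.exp (v / T₁) *
      ((ε ^ (-δ)) ^ ((1 + β) / δ) * Real.exp (-v * ε ^ (-δ)))) (𝓝[>] 0) (𝓝 0) := by
    have h1 := (tendsto_rpow_mul_exp_neg_mul_atTop_nhds_zero ((1 + β) / δ) v hv).comp
      (tendsto_rpow_neg_nhdsGT_zero' hδ)
    simpa using h1.const_mul (I * Real.exp (v / T₁))
  have hdiff := squeeze_zero_norm' (f := fun ε => gibbsInt V (ε ^ δ) φ / ε ^ (1 + β) -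
    gibbsInt V (ε ^ δ) φ₁ / ε ^ (1 + β)) hfar hz
  simpa using hdiff.add hlimnear

theorem HasPowerTail.tendsto_gibbsInt_one_low (h : IsChainPotential V)
    (hW : HasPowerTail V W B α) (hα : 0 < α) (hB : 0 < B) (hA : 0 < A) (hδ : 0 < δ)
    (hV : Tendsto (fun r => V r / r ^ δ) (𝓝[>] 0) (𝓝 A)) :
    Tendsto (fun ε => gibbsInt V (ε ^ δ) (fun _ => 1) / ε ^ (1 + (0 : ℝ))) (𝓝[>] 0)
      (𝓝 (1 * powInt A δ 0)) :=
  hW.tendsto_gibbsInt_low h hα hB hA hδ hV continuous_const le_rfl (by simp) one_pos (by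
    simpa using (hW.integrable_exp h hα hB one_pos).integrableOn)

theorem HasPowerTail.tendsto_forceSq_low (h : IsChainPotential V)
    (hW : HasPowerTail V W B α) (hα : 0 < α) (hB : 0 < B) (hA : 0 < A) (hδ : 2 < δ)
    (hV : V ~[𝓝[>] 0] fun r => A * r ^ δ) :
    Tendsto (fun ε => forceSq V (ε ^ δ) / ε ^ (2 * δ - 2)) (𝓝[>] 0) (𝓝 (tailConst A δ)) := by
  obtain ⟨h0, h1, -⟩ := tendsto_derivs_of_isEquivalent h.smooth hA hδ hV
  have hδ0 : 0 < δ := by linarith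
  refine tendsto_forceSq_div self_mem_nhdsWithin h hA (by linarith) ?_
    (hW.tendsto_gibbsInt_one_low h hα hB hA hδ0 h0)
  refine hW.tendsto_gibbsInt_low h hα hB hA hδ0 h0 (φ := fun r => deriv V r ^ 2)
    (h.continuous_deriv.pow 2) (by linarith) ?_
    one_pos ?_
  · refine (h1.pow 2).congr' ?_
    filter_upwards [self_mem_nhdsWithin] with r hr
    rw [show 2 * δ - 2 = 2 * (δ - 1) by ring, sq_div_rpow hr]
  · have := (hW.admissible h hα hB one_pos).force_moments 2
    simp only [sq_abs] at this
    exact this.integrableOn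

/-- Near the origin `V''²` is of order `r^{2(δ-2)}`, so its mean at temperature `ε^δ` is of order
`ε^{2(δ-2)}`; a spare factor `ε^{δ-2}` tends to zero because `δ > 2`. -/
theorem HasPowerTail.tendsto_stiffnessSq_low (h : IsChainPotential V)
    (hW : HasPowerTail V W B α) (hα : 0 < α) (hB : 0 < B) (hA : 0 < A) (hδ : 2 < δ)
    (hV : V ~[𝓝[>] 0] fun r => A * r ^ δ) {T₀ : ℝ} (hT₀ : 0 < T₀)
    (hi : Integrable fun r => deriv (deriv V) r ^ 2 * Real.exp (-V r / T₀)) :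
    Tendsto (fun ε => stiffnessSq V (ε ^ δ) / ε ^ (δ - 2)) (𝓝[>] 0) (𝓝 0) := by
  obtain ⟨h0, -, h2⟩ := tendsto_derivs_of_isEquivalent h.smooth hA hδ hV
  have hδ0 : 0 < δ := by linarith
  have hp := powInt_pos hA hδ0 (β := 0) le_rfl
  have hone := hW.tendsto_gibbsInt_one_low h hα hB hA hδ0 h0
  rw [one_mul] at hone
  have hst := hW.tendsto_gibbsInt_low h hα hB hA hδ0 h0
    (φ := fun r => deriv (deriv V) r ^ 2) (h.continuous_deriv_deriv.pow 2) (β := 2 * (δ - 2)) (by linarith) (c := (A * δ * (δ - 1)) ^ 2) (by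
      refine (h2.pow 2).congr' ?_
      filter_upwards [self_mem_nhdsWithin] with r hr
      rw [sq_div_rpow hr]) hT₀ hi.integrableOn
  have h3 := (hst.div hone hp.ne').mul (tendsto_rpow_nhdsGT_zero (by linarith : 0 < δ - 2))
  rw [mul_zero] at h3
  refine h3.congr' ?_
  filter_upwards [self_mem_nhdsWithin] with ε hε
  have hε0 : (0 : ℝ) < ε := hε
  have hq : 0 < ε ^ (δ - 2) := Real.rpow_pos_of_pos hε0 _
  simp only [Pi.div_apply]
  rw [stiffnessSq_eq h, Real.rpow_add hε0, add_zero, Real.rpow_one, two_mul, Real.rpow_add hε0]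
  by_cases hz : gibbsInt V (ε ^ δ) (fun _ => 1) = 0
  · simp [hz]
  · field_simp

theorem eventually_memLp_stiffness_low (h : IsChainPotential V)
    (had : ∀ T, 0 < T → Admissible V T) {T₀ : ℝ} (hT₀ : 0 < T₀)
    (hi : Integrable fun r => deriv (deriv V) r ^ 2 * Real.exp (-V r / T₀)) :
    ∀ᶠ T in 𝓝[>] (0 : ℝ), MemLp (deriv (deriv V)) 2 (distanceMeasure V T) := by
  have hsmall : ∀ᶠ T in 𝓝[>] (0 : ℝ), T < T₀ := nhdsWithin_le_nhds (gt_mem_nhds hT₀)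
  filter_upwards [self_mem_nhdsWithin, hsmall] with T hT hlt
  have hT0 : (0 : ℝ) < T := hT
  have hc := h.continuous_deriv_deriv
  have hVc := h.continuous
  rw [memLp_two_iff_integrable_sq hc.aestronglyMeasurable, (had T hT).integrable_distance_iff]
  refine hi.mono' (by fun_prop : Continuous fun r =>
    deriv (deriv V) r ^ 2 * Real.exp (-V r / T)).aestronglyMeasurable
    (Eventually.of_forall fun r => ?_)
  rw [Real.norm_of_nonneg (by positivity)]
  refine mul_le_mul_of_nonneg_left (Real.exp_le_exp.2 ?_) (sq_nonneg _)
  rw [neg_div, neg_div, neg_le_neg_iff]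
  exact div_le_div_of_nonneg_left (h.nonneg r) hT0 hlt.le

end LowTemperature

end Chain

end

/-! ### Return to the temperature variable and proof of the theorem -/

theorem Chain.tendsto_forceSq_high {V W : ℝ → ℝ} {A α : ℝ} (h : Chain.IsChainPotential V)
    (hW : Chain.HasPowerTail V W A α) (hα : 1 < α) (hA : 0 < A) :
    Tendsto (fun T => Chain.forceSq V T / T ^ (2 - 2 / α)) atTop (𝓝 (Chain.tailConst A α)) := by
  have hα0 : 0 < α := by linarith
  have h1 := Chain.tendsto_div_rpow_of_comp (eventually_gt_atTop 0) hα0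
    (tendsto_rpow_atTop (inv_pos.2 hα0)) (hW.tendsto_forceSq h hα hA)
  rwa [show (2 * α - 2) / α = 2 - 2 / α by field_simp] at h1

theorem Chain.tendsto_rpow_inv_nhdsGT_zero {α : ℝ} (hα : 0 < α) :
    Tendsto (fun T : ℝ => T ^ α⁻¹) (𝓝[>] 0) (𝓝[>] 0) := by
  refine tendsto_nhdsWithin_iff.2 ⟨Chain.tendsto_rpow_nhdsGT_zero (inv_pos.2 hα), ?_⟩
  filter_upwards [self_mem_nhdsWithin] with T hT using Real.rpow_pos_of_pos hT _

theorem corollary6p2 (γ : ℝ) (hγ : 0 < γ) :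
    -- high temperature, subharmonic at infinity
    (∀ (α A : ℝ) (V W : ℝ → ℝ), 1 < α → α < 2 → 0 < A →
      Chain.IsChainPotential V → Chain.HasPowerTail V W A α →
      (∀ T : ℝ, 0 < T → Chain.GeneratesDynamics V γ T) →
      ∃ κ : ℝ → ℝ, (∀ T : ℝ, 0 < T → Chain.IsConductivity V γ T (κ T)) ∧
        κ ~[atTop] (fun T => γ + Chain.tailConst A α / (6 * γ) * T ^ (1 - 2 / α)) ∧
        ((fun R : ℝ => ∫ r in (1 : ℝ)..R, (deriv (deriv W) r) ^ 2) =o[atTop]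
            (fun R : ℝ => R ^ (α - 1)) →
          (fun T => κ T - γ) ~[atTop]
            (fun T => Chain.tailConst A α / (6 * γ) * T ^ (1 - 2 / α)))) ∧
    -- high temperature, superharmonic at infinity
    (∀ α A : ℝ, 2 < α → 0 < A → ∃ C : ℝ, 0 < C ∧ ∀ V W : ℝ → ℝ,
      Chain.IsChainPotential V → Chain.HasPowerTail V W A α →
      (∀ T : ℝ, 0 < T → Chain.GeneratesDynamics V γ T) →
      ∃ κ : ℝ → ℝ, (∀ T : ℝ, 0 < T → Chain.IsConductivity V γ T (κ T)) ∧
        ∀ᶠ T in atTop, C⁻¹ ≤ κ T ∧ κ T ≤ C * T ^ (1 - 2 / α)) ∧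
    -- low temperature, superharmonic at the origin
    (∀ (δ A α B : ℝ) (V W : ℝ → ℝ), 2 < δ → 0 < A → 0 < α → 0 < B →
      Chain.IsChainPotential V → V ~[𝓝[>] 0] (fun r => A * r ^ δ) →
      Chain.HasPowerTail V W B α →
      (∀ T : ℝ, 0 < T → Chain.GeneratesDynamics V γ T) →
      ∃ κ : ℝ → ℝ, (∀ T : ℝ, 0 < T → Chain.IsConductivity V γ T (κ T)) ∧
        κ ~[𝓝[>] 0] (fun T => γ + Chain.tailConst A δ / (6 * γ) * T ^ (1 - 2 / δ)) ∧
        ((∃ T₀ : ℝ, 0 < T₀ ∧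
            Integrable (fun r : ℝ => (deriv (deriv V) r) ^ 2 * Real.exp (-V r / T₀))) →
          (fun T => κ T - γ) ~[𝓝[>] 0]
            (fun T => Chain.tailConst A δ / (6 * γ) * T ^ (1 - 2 / δ)))) := by
  refine ⟨fun α A V W hα1 hα2 hA hV hW hd => ?_, fun α A hα hA => ?_,
    fun δ A α B V W hδ hA hα hB hV hVA hW hd => ?_⟩
  · have hα0 : 0 < α := by linarith
    obtain ⟨k, hk⟩ := Chain.exists_conductivity_function hγ
      (fun T hT => hW.admissible hV hα0 hA hT) hd
    have hm := Chain.tendsto_forceSq_high hV hW hα1 hA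
    have hc := Chain.tailConst_pos hA hα1.le
    refine ⟨fun T => γ + (T ^ 2)⁻¹ * k T, fun T hT => (hk T hT).1,
      Chain.conductivity_isEquivalent hγ (eventually_gt_atTop 0) (fun T hT => (hk T hT).2) hm ?_,
      fun ho => Chain.conductivity_sub_isEquivalent hγ hc (eventually_gt_atTop 0)
        (fun T hT => (hk T hT).2) ?_ hm ?_⟩
    · have h1 : 0 < 2 / α - 1 := by rw [sub_pos, lt_div_iff₀ hα0]; linarith
      simpa using tendsto_rpow_neg_atTop h1
    · filter_upwards [eventually_gt_atTop 0] with T hT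
      exact hW.memLp_stiffness hV hα1 hα2 hA hT ho
    · have h1 := Chain.tendsto_div_rpow_of_comp (eventually_gt_atTop 0) hα0
        (tendsto_rpow_atTop (inv_pos.2 hα0)) (hW.tendsto_stiffnessSq hV hα1 hα2 hA ho)
      rwa [show (α - 2) / α = 1 - 2 / α by field_simp] at h1
  · have hα0 : 0 < α := by linarith
    have hc := Chain.tailConst_pos hA (by linarith : 1 ≤ α)
    -- The first and last summands serve the upper bound; `γ⁻¹` is added so that `C⁻¹ ≤ γ`. The
    -- constant is fixed before `V` and `W`.
    refine ⟨γ + γ⁻¹ + Chain.tailConst A α / γ, by positivity, fun V W hV hW hd => ?_⟩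
    obtain ⟨k, hk⟩ := Chain.exists_conductivity_function hγ
      (fun T hT => hW.admissible hV hα0 hA hT) hd
    have hm := Chain.tendsto_forceSq_high hV hW (by linarith) hA
    refine ⟨fun T => γ + (T ^ 2)⁻¹ * k T, fun T hT => (hk T hT).1, ?_⟩
    have hexp : 0 ≤ 1 - 2 / α := by rw [sub_nonneg, div_le_iff₀ hα0]; linarith
    filter_upwards [Chain.eventually_conductivity_le hγ (eventually_gt_atTop 0)
      (fun T hT => (hk T hT).2) hc hm ((eventually_ge_atTop 1).mono fun T hT =>
        Real.one_le_rpow hT hexp), eventually_gt_atTop 0] with T hT hT0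
    have hp : 0 ≤ T ^ (1 - 2 / α) := Real.rpow_nonneg hT0.le _
    have hcγ : 0 < Chain.tailConst A α / γ := div_pos hc hγ
    have hγi : 0 < γ⁻¹ := inv_pos.2 hγ
    refine ⟨le_trans ?_ hT.1, hT.2.trans ?_⟩
    · exact inv_le_of_inv_le₀ hγ (by linarith)
    · exact mul_le_mul_of_nonneg_right (by linarith) hp
  · have hδ0 : 0 < δ := by linarith
    have had := fun T (hT : 0 < T) => hW.admissible hV hα hB hT
    obtain ⟨k, hk⟩ := Chain.exists_conductivity_function hγ had hd
    have hpos : ∀ᶠ T : ℝ in 𝓝[>] 0, 0 < T := self_mem_nhdsWithin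
    have hc := Chain.tailConst_pos hA (by linarith : 1 ≤ δ)
    have hroot := Chain.tendsto_rpow_inv_nhdsGT_zero hδ0
    -- The asymptotics were derived along `T = ε^δ`; substituting `ε = T^{1/δ}` restores the
    -- temperature.
    have hm := Chain.tendsto_div_rpow_of_comp hpos hδ0 hroot
      (hW.tendsto_forceSq_low hV hα hB hA hδ hVA)
    rw [show (2 * δ - 2) / δ = 2 - 2 / δ by field_simp] at hm
    refine ⟨fun T => γ + (T ^ 2)⁻¹ * k T, fun T hT => (hk T hT).1,
      Chain.conductivity_isEquivalent hγ hpos (fun T hT => (hk T hT).2) hm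
        (Chain.tendsto_rpow_nhdsGT_zero ?_),
      fun ⟨T₀, hT₀, hi⟩ => Chain.conductivity_sub_isEquivalent hγ hc hpos
        (fun T hT => (hk T hT).2) (Chain.eventually_memLp_stiffness_low hV had hT₀ hi) hm ?_⟩
    · rw [sub_pos, div_lt_iff₀ hδ0]; linarith
    · have h1 := Chain.tendsto_div_rpow_of_comp hpos hδ0 hroot
        (hW.tendsto_stiffnessSq_low hV hα hB hA hδ hVA hT₀ hi)
      rwa [show (δ - 2) / δ = 1 - 2 / δ by field_simp] at h1
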